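/- **Setting.** A graph $\mathcal G=\langle V,v^0,E\rangle$ has a finite vertex set $V$, an initial vertex $v^0$ and edges $E\subseteq V\times V$, where every vertex has at least one successor (sinks carry self-loops); it is *binary* if every vertex has at most two successors. Paths start at $v^0$. An *$\omega$-regular objective* is a set $\Phi$ of infinite paths of one of these forms: reachability (some vertex of the path is in $S$), safety (all vertices are in $S$), Büchi (some vertex of $S$ is visited infinitely often), for some $S\subseteq V$, or parity (the largest color seen infinitely often is even, for a coloring $V\to\mathbb N$). Two objectives *overlap* if they have a common path. An *action policy* $\alpha$ maps each finite path to a successor of its last vertex; a *bidding policy* is $\beta:V\times[0,1]\to[0,1]$ with $\beta(v,B)\le B$. A *tender* is $\langle\alpha,\beta,\mathbb B\rangle$ with *threshold budget* $\mathbb B\in[0,1]$. Tenders $t_1,t_2$ are *compatible* if $\mathbb B_1+\mathbb B_2<1$. Their composition runs from $\langle v^0,B_1\rangle$ as follows: in a configuration with vertex $v$ and budgets $B_1$, $B_2=1-B_1$, tender $i$ bids $b_i=\beta_i(v,B_i)$; if $b_1\ge b_2$, then tender $1$ picks the next vertex by $\alpha_1$ (applied to the path so far) and pays $b_1$ to tender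 $2$; otherwise tender $2$ picks it by $\alpha_2$ and pays $b_2$ to tender $1$. The composition satisfies $\Phi$ if, from every initial allocation with $B_1>\mathbb B_1$ and $1-B_1>\mathbb B_2$, the resulting path is in $\Phi$. Tender $t_i$ (in role $i$) is *robust* for $\Phi_i$ if its composition with every compatible tender in the other role satisfies $\Phi_i$. In the *bidding game* $\langle\mathcal G,\Phi\rangle$ two players with strategies $\langle\alpha,\beta\rangle$ interact in the same way, Player X being the first. The *threshold* $\mathrm{Th}^{\mathcal G}_{\Phi}(v)$ is the infimum, in $[0,1]$, of the $B\in[0,1]$ for which Player X has a strategy that ensures $\Phi$ from $\langle v,B\rangle$ against every strategy of the opponent. $\mathsf{STRONG\text{-}SYNT}$ is the problem to decide, given $\mathcal G$ and overlapping $\omega$-regular objectives $\Phi_1,\Phi_2$ (edges as adjacency matrix, vertex sets as indicator vectors, colors in binary), whether there are compatible tenders $t_1,t_2$ with $t_1$ robust for $\Phi_1$ and $t_2$ robust for $\Phi_2$. **Theorem (Strong decentralized synthesis).** Let $\mathcal G=\langle V,v^0,E\rangle$ be a graph and $\Phi_1,\Phi_2$ a pair of overlapping $\omega$-regular objectives.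 There is a pair of compatible tenders $t_1,t_2$ with $t_1$ robust for $\Phi_1$ and $t_2$ robust for $\Phi_2$ if and only if $$\mathrm{Th}^{\mathcal G}_{\Phi_1}(v^0)+\mathrm{Th}^{\mathcal G}_{\Phi_2}(v^0)<1 .$$ Moreover, $\mathsf{STRONG\text{-}SYNT}$ is in $\mathrm{NP}\cap\mathrm{coNP}$, and its restriction to binary graphs is in $\mathrm{PTIME}$. -/

import Mathlib

/-! ### Graphs, paths and objectives -/

/-- A directed graph with a designated initial vertex. Every vertex has a successor (a sink carries a
self-loop), so that every finite path can be prolonged and action policies exist. -/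
structure BidGraph (V : Type*) where
  /-- the initial vertex -/
  init : V
  /-- the edge relation -/
  Adj : V → V → Prop
  exists_succ : ∀ v, ∃ w, Adj v w

namespace BidGraph

variable {V : Type*}

/-- The same graph with initial vertex `v`. -/
def startAt (G : BidGraph V) (v : V) : BidGraph V := { G with init := v }

/-- Every vertex has at most two successors. -/
def Binary (G : BidGraph V) : Prop := ∀ v, {w | G.Adj v w}.encard ≤ 2

/-- The finite paths that start at the initial vertex. -/
def IsFinPath (G : BidGraph V) (ρ : List V) : Prop :=
  ρ.head? = some G.init ∧ ρ.IsChain G.Adj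

/-- The infinite paths that start at the initial vertex. -/
def infPaths (G : BidGraph V) : Set (ℕ → V) :=
  {ρ | ρ 0 = G.init ∧ ∀ i, G.Adj (ρ i) (ρ (i + 1))}

end BidGraph

/-- The vertices that are visited infinitely often. -/
def infOften {V : Type*} (ρ : ℕ → V) : Set V := {v | ∀ N, ∃ i, N ≤ i ∧ ρ i = v}

/-- The `ω`-regular objectives on the vertices of a graph: reachability, safety, Büchi, and parity
(the greatest color seen infinitely often is even). On a finite vertex set the colors of a parity
objective are bounded. -/
inductive Objective (V : Type*) where
  | reach (S : Set V)
  | safe (S : Set V)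
  | buchi (S : Set V)
  | parity (col : V → ℕ)

/-- The set of infinite paths of `G` that satisfy an objective. -/
def Objective.paths {V : Type*} (G : BidGraph V) : Objective V → Set (ℕ → V)
  | .reach S => {ρ ∈ G.infPaths | ∃ i, ρ i ∈ S}
  | .safe S => {ρ ∈ G.infPaths | ∀ i, ρ i ∈ S}
  | .buchi S => {ρ ∈ G.infPaths | (infOften ρ ∩ S).Nonempty}
  | .parity col =>
      {ρ ∈ G.infPaths | ∃ m, IsGreatest {i | ∃ v ∈ infOften ρ, col v = i} m ∧ Even m}

/-- Two objectives overlap if some infinite path satisfies both. -/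
def Overlapping {V : Type*} (G : BidGraph V) (Φ₁ Φ₂ : Objective V) : Prop :=
  (Φ₁.paths G ∩ Φ₂.paths G).Nonempty

/-! ### Policies, tenders and their composition -/

/-- An action policy chooses a successor of the last vertex of every finite path; its values on lists
that are not finite paths are irrelevant. -/
structure ActionPolicy {V : Type*} (G : BidGraph V) where
  next : List V → V
  adj : ∀ (ρ : List V) (v : V), G.IsFinPath (ρ ++ [v]) → G.Adj v (next (ρ ++ [v]))

/-- A bidding policy maps a vertex and an available budget in `[0,1]` to a bid that does not exceed
the budget; its values on budgets outside `[0,1]` are irrelevant. -/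
structure BiddingPolicy (V : Type*) where
  bid : V → ℝ → ℝ
  bid_nonneg : ∀ (v : V) (B : ℝ), 0 ≤ B → B ≤ 1 → 0 ≤ bid v B
  bid_le : ∀ (v : V) (B : ℝ), 0 ≤ B → B ≤ 1 → bid v B ≤ B

/-- A strategy: an action policy with a bidding policy. -/
structure Strategy {V : Type*} (G : BidGraph V) where
  act : ActionPolicy G
  bidding : BiddingPolicy V

/-- A tender: an action policy, a bidding policy and a threshold budget. -/
structure Tender {V : Type*} (G : BidGraph V) extends Strategy G where
  budget : ℝ
  budget_nonneg : 0 ≤ budget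
  budget_le_one : budget ≤ 1

section Composition

variable {V : Type*} {G : BidGraph V}

open Classical in
/-- The configuration that follows the history `h ++ [c]` when `σ` and `τ` are composed. A
configuration is a vertex with the budget of the first strategy; the second one owns the rest of the
total budget `1`. The higher bidder moves and pays its bid to the other; ties go to the first. -/
noncomputable def composeStep (σ τ : Strategy G) (h : List (V × ℝ)) (c : V × ℝ) : V × ℝ :=
  let ρ := (h ++ [c]).map Prod.fst
  let b₁ := σ.bidding.bid c.1 c.2
  let b₂ := τ.bidding.bid c.1 (1 - c.2)
  if b₂ ≤ b₁ then (σ.act.next ρ, c.2 - b₁) else (τ.act.next ρ, c.2 + b₂)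

/-- The first `k + 1` configurations of the composition from `⟨G.init, B⟩`: the first `k` of them as
a list, and the last one. -/
noncomputable def composeHistory (σ τ : Strategy G) (B : ℝ) : ℕ → List (V × ℝ) × (V × ℝ)
  | 0 => ([], (G.init, B))
  | k + 1 =>
      let s := composeHistory σ τ B k
      (s.1 ++ [s.2], composeStep σ τ s.1 s.2)

/-- The infinite sequence of configurations that the composition outputs from `⟨G.init, B⟩`. -/
noncomputable def composeOut (σ τ : Strategy G) (B : ℝ) (k : ℕ) : V × ℝ :=
  (composeHistory σ τ B k).2

/-- The sequence of vertices of the output of the composition. -/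
noncomputable def composePath (σ τ : Strategy G) (B : ℝ) (k : ℕ) : V :=
  (composeOut σ τ B k).1

/-- Two tenders are compatible if their threshold budgets sum up to less than `1`. -/
def Compatible (t₁ t₂ : Tender G) : Prop := t₁.budget + t₂.budget < 1

/-- The composition of `t₁` (first) and `t₂` (second) satisfies `Φ`, from every initial allocation of
the budget that exceeds both threshold budgets. -/
def ComposeSat (t₁ t₂ : Tender G) (Φ : Set (ℕ → V)) : Prop :=
  ∀ B : ℝ, t₁.budget < B → t₂.budget < 1 - B → composePath t₁.toStrategy t₂.toStrategy B ∈ Φ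

/-- A tender that acts as the first one is robust for `Φ`. -/
def RobustFirst (t₁ : Tender G) (Φ : Set (ℕ → V)) : Prop :=
  ∀ t₂ : Tender G, Compatible t₁ t₂ → ComposeSat t₁ t₂ Φ

/-- A tender that acts as the second one is robust for `Φ`. -/
def RobustSecond (t₂ : Tender G) (Φ : Set (ℕ → V)) : Prop :=
  ∀ t₁ : Tender G, Compatible t₁ t₂ → ComposeSat t₁ t₂ Φ

end Composition

/-- There is a pair of compatible tenders, the first robust for `Φ₁` and the second robust for
`Φ₂`. -/
def HasRobustPair {V : Type*} (G : BidGraph V) (Φ₁ Φ₂ : Objective V) : Prop :=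
  ∃ t₁ t₂ : Tender G,
    Compatible t₁ t₂ ∧ RobustFirst t₁ (Φ₁.paths G) ∧ RobustSecond t₂ (Φ₂.paths G)

/-! ### Thresholds of bidding games -/

/-- In the bidding game on `G` with objective `Φ`, the first player has a winning strategy from
`⟨v, B⟩`. -/
def WinsFrom {V : Type*} (G : BidGraph V) (Φ : Objective V) (v : V) (B : ℝ) : Prop :=
  ∃ σ : Strategy (G.startAt v), ∀ τ : Strategy (G.startAt v),
    composePath σ τ B ∈ Φ.paths (G.startAt v)

/-- The threshold of the first player at `v`: the infimum, in `[0,1]`, of the budgets from which it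
has a winning strategy. (Adding `1` to the set gives the empty set its infimum in `[0,1]`.) -/
noncomputable def threshold {V : Type*} (G : BidGraph V) (Φ : Objective V) (v : V) : ℝ :=
  sInf (insert 1 {B : ℝ | 0 ≤ B ∧ B ≤ 1 ∧ WinsFrom G Φ v B})

/-! ### Complexity classes

The machine model is the random access machine with the logarithmic cost criterion, with structured
control flow. Memory cells hold natural numbers, an input is a finite sequence of natural numbers,
and its size is the number of bits needed to write it down. -/

namespace RAM

/-- The content of the memory. -/
abbrev Mem := ℕ → ℕ

/-- Arithmetic operations. -/
inductive Op where
  | add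
  | sub
  | mul
  | div

/-- Subtraction is truncated, division is rounded down (with `x / 0 = 0`). -/
def Op.eval : Op → ℕ → ℕ → ℕ
  | .add, x, y => x + y
  | .sub, x, y => x - y
  | .mul, x, y => x * y
  | .div, x, y => x / y

/-- Programs; `M[i]` denotes the content of the memory cell `i`. -/
inductive Prog where
  /-- `M[d] := c` -/
  | const (d c : ℕ)
  /-- `M[d] := M[a] o M[b]` -/
  | arith (o : Op) (d a b : ℕ)
  /-- `M[d] := M[M[a]]` -/
  | load (d a : ℕ)
  /-- `M[M[a]] := M[s]` -/
  | store (a s : ℕ)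
  /-- `p; q` -/
  | seq (p q : Prog)
  /-- if `M[a] ≠ 0` then `p` else `q` -/
  | ite (a : ℕ) (p q : Prog)
  /-- while `M[a] ≠ 0` do `p` -/
  | loop (a : ℕ) (p : Prog)

/-- `Exec p M t M'`: started on the memory `M`, the program `p` halts with the memory `M'`, at total
cost `t`. An instruction costs `1` plus the bit lengths of the numbers and of the computed addresses
that it uses. -/
inductive Exec : Prog → Mem → ℕ → Mem → Prop where
  | const (d c : ℕ) (M : Mem) :
      Exec (.const d c) M 1 (Function.update M d c)
  | arith (o : Op) (d a b : ℕ) (M : Mem) :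
      Exec (.arith o d a b) M (1 + (M a).size + (M b).size)
        (Function.update M d (o.eval (M a) (M b)))
  | load (d a : ℕ) (M : Mem) :
      Exec (.load d a) M (1 + (M a).size + (M (M a)).size) (Function.update M d (M (M a)))
  | store (a s : ℕ) (M : Mem) :
      Exec (.store a s) M (1 + (M a).size + (M s).size) (Function.update M (M a) (M s))
  | seq {p q : Prog} {M M' M'' : Mem} {t t' : ℕ} :
      Exec p M t M' → Exec q M' t' M'' → Exec (.seq p q) M (t + t') M''
  | ite_true {a : ℕ} {p q : Prog} {M M' : Mem} {t : ℕ} :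
      M a ≠ 0 → Exec p M t M' → Exec (.ite a p q) M (1 + (M a).size + t) M'
  | ite_false {a : ℕ} {p q : Prog} {M M' : Mem} {t : ℕ} :
      M a = 0 → Exec q M t M' → Exec (.ite a p q) M (1 + t) M'
  | loop_true {a : ℕ} {p : Prog} {M M' M'' : Mem} {t t' : ℕ} :
      M a ≠ 0 → Exec p M t M' → Exec (.loop a p) M' t' M'' →
        Exec (.loop a p) M (1 + (M a).size + t + t') M''
  | loop_false {a : ℕ} {p : Prog} {M : Mem} :
      M a = 0 → Exec (.loop a p) M 1 M

/-- The initial memory on input `w`: cell `0` holds the length of `w`, the next cells hold its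
entries, and all others hold `0`. -/
def input (w : List ℕ) : Mem
  | 0 => w.length
  | i + 1 => w.getD i 0

end RAM

/-- The size of an input in bits; each entry costs one more, for its delimiter. -/
def wordSize (w : List ℕ) : ℕ := (w.map fun x => x.size + 1).sum

/-- The class P: some program halts on every input `w` within a cost polynomial in the size of `w`,
with `M[0] = 1` if and only if `w` belongs to the language. -/
def InP (L : Set (List ℕ)) : Prop :=
  ∃ (p : RAM.Prog) (f : Polynomial ℕ), ∀ w : List ℕ, ∃ (t : ℕ) (M : RAM.Mem),
    RAM.Exec p (RAM.input w) t M ∧ t ≤ f.eval (wordSize w) ∧ (M 0 = 1 ↔ w ∈ L)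

/-- The encoding of a pair of words as a word. -/
def pairWord (w y : List ℕ) : List ℕ := w.length :: (w ++ y)

/-- The class NP: membership has certificates of polynomial size that can be verified in polynomial
time. -/
def InNP (L : Set (List ℕ)) : Prop :=
  ∃ (R : Set (List ℕ)) (f : Polynomial ℕ), InP R ∧
    ∀ w : List ℕ, w ∈ L ↔ ∃ y : List ℕ, wordSize y ≤ f.eval (wordSize w) ∧ pairWord w y ∈ R

/-- The class coNP. -/
def InCoNP (L : Set (List ℕ)) : Prop := InNP Lᶜ

/-! ### The decision problem -/

/-- An instance: a graph with vertices `0, …, n - 1` and two objectives. -/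
structure Instance where
  n : ℕ
  graph : BidGraph (Fin n)
  obj₁ : Objective (Fin n)
  obj₂ : Objective (Fin n)

open Classical in
/-- An objective is written as its kind, followed by the indicator function of the vertex set or, for
parity, by the sequence of colors. -/
noncomputable def Objective.encode {n : ℕ} : Objective (Fin n) → List ℕ
  | .reach S => 0 :: List.ofFn fun v => if v ∈ S then 1 else 0
  | .safe S => 1 :: List.ofFn fun v => if v ∈ S then 1 else 0
  | .buchi S => 2 :: List.ofFn fun v => if v ∈ S then 1 else 0
  | .parity col => 3 :: List.ofFn col

open Classical in
/-- An instance is written as the number of vertices, the initial vertex, the rows of the adjacency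
matrix, and the two objectives. -/
noncomputable def Instance.encode (I : Instance) : List ℕ :=
  [I.n, (I.graph.init : ℕ)]
    ++ (List.finRange I.n).flatMap (fun u => List.ofFn fun v => if I.graph.Adj u v then 1 else 0)
    ++ I.obj₁.encode ++ I.obj₂.encode

/-- The strong synthesis problem. -/
def StrongSynt : Set (List ℕ) :=
  {w | ∃ I : Instance, I.encode = w ∧ Overlapping I.graph I.obj₁ I.obj₂ ∧
    HasRobustPair I.graph I.obj₁ I.obj₂}

/-- The strong synthesis problem for binary graphs. -/
def BinaryStrongSynt : Set (List ℕ) :=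
  {w | ∃ I : Instance, I.encode = w ∧ I.graph.Binary ∧ Overlapping I.graph I.obj₁ I.obj₂ ∧
    HasRobustPair I.graph I.obj₁ I.obj₂}

/-! ### The play of a composition -/

section Composition

variable {V : Type*} {G : BidGraph V}

/-! The threshold is computed by a Richman function `f`. Vertices at which a reachability or safety
objective is decided are made absorbing, and colors turn every objective into a parity condition. In
a bottom strongly connected component a player with any positive surplus of budget can force
infinitely many visits to the vertices of greatest color, so `f` is `0` or `1` there according to
the parity of that color. Elsewhere `f` is the mean of its smallest and greatest value on the
successors. Such an `f` is a fixed point of a monotone operator (`exists_isRichman`).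

A player whose budget exceeds `f` bids half the gap between the extreme successors plus a small
fraction of the surplus, and moves to a minimal successor that approaches the top colors. The base
bid keeps the budget above `f`. The extra bid makes lost rounds enlarge the surplus, and since the
budget never exceeds `1`, the player must win long enough runs of rounds to reach the top colors
again and again (`Potential.IsPlay.exists_mem`). The complementary objective has the Richman
function `1 - f`, so below `f` the opponent wins. Hence `Objective.threshold_eq`: every Richman
function gives the threshold at the initial vertex.

The strategy above `f` works in either role, which gives robust tenders when the thresholds sum to
less than `1`. Conversely, a robust tender wins the bidding game against all opponents, because the
tender with threshold budget `0` and an arbitrary strategy is compatible with it. For the second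
role, plays are transferred by `exists_composePath_swap`.

For complexity, a Richman function with fixed extreme successors solves a nonsingular integer linear
system, so by Cramer's rule its values have a common denominator at most `n! * 2 ^ n`
(`IsRichman.exists_denominator`). Guessing these numbers and checking the local conditions decides
both the problem and its complement, whence NP and coNP. On a binary graph the mean of the extremes
is the mean over the successors, so `f` is the probability that a random walk is absorbed in an odd
bottom component. Squaring its transition matrix `8 * n` times in fixed-point arithmetic
approximates `f` well enough to decide the strict inequality between rationals of bounded
denominator (`IsRichman.oddMass_bounds`, `add_lt_one_iff_of_approx`).

Membership in P on the random access machine comes from a small language of bounded sums and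
iterated tabulations, whose compiled programs run in polynomial time because table entries are cut
off at a fixed bound (`inP_of_stmt`). -/

theorem composeHistory_map_fst (σ τ : Strategy G) (B : ℝ) (k : ℕ) :
    ((composeHistory σ τ B k).1 ++ [(composeHistory σ τ B k).2]).map Prod.fst =
      (List.range (k + 1)).map (composePath σ τ B) := by
  induction k with
  | zero => simp [composeHistory, composePath, composeOut]
  | succ k ih =>
    rw [List.range_succ, List.map_append (f := composePath σ τ B), ← ih]
    simp [composeHistory, composePath, composeOut]

open Classical in
theorem composeOut_succ (σ τ : Strategy G) (B : ℝ) (k : ℕ) :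
    composeOut σ τ B (k + 1) =
      if τ.bidding.bid (composeOut σ τ B k).1 (1 - (composeOut σ τ B k).2) ≤
          σ.bidding.bid (composeOut σ τ B k).1 (composeOut σ τ B k).2 then
        (σ.act.next ((List.range (k + 1)).map (composePath σ τ B)),
          (composeOut σ τ B k).2 -
            σ.bidding.bid (composeOut σ τ B k).1 (composeOut σ τ B k).2)
      else
        (τ.act.next ((List.range (k + 1)).map (composePath σ τ B)),
          (composeOut σ τ B k).2 +
            τ.bidding.bid (composeOut σ τ B k).1 (1 - (composeOut σ τ B k).2)) := by
  rw [← composeHistory_map_fst]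
  rfl

theorem isFinPath_range_map {ρ : ℕ → V} (h0 : ρ 0 = G.init) (k : ℕ)
    (h : ∀ i < k, G.Adj (ρ i) (ρ (i + 1))) : G.IsFinPath ((List.range (k + 1)).map ρ) := by
  refine ⟨by simp [List.range_succ_eq_map, h0], ?_⟩
  rw [List.isChain_iff_getElem]
  intro i hi
  simp only [List.length_map, List.length_range] at hi
  simpa using h i (by omega)

theorem ActionPolicy.adj_range_map (α : ActionPolicy G) {ρ : ℕ → V} (h0 : ρ 0 = G.init) (k : ℕ)
    (h : ∀ i < k, G.Adj (ρ i) (ρ (i + 1))) :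
    G.Adj (ρ k) (α.next ((List.range (k + 1)).map ρ)) := by
  have := isFinPath_range_map h0 k h
  rw [List.range_succ, List.map_append] at this ⊢
  exact α.adj _ _ this

theorem composePath_mem_infPaths (σ τ : Strategy G) (B : ℝ) :
    composePath σ τ B ∈ G.infPaths := by
  refine ⟨rfl, fun i => ?_⟩
  induction i using Nat.strong_induction_on with
  | _ k ih =>
    have hσ := σ.act.adj_range_map (ρ := composePath σ τ B) rfl k ih
    have hτ := τ.act.adj_range_map (ρ := composePath σ τ B) rfl k ih
    have : composePath σ τ B (k + 1) = (composeOut σ τ B (k + 1)).1 := rfl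
    rw [this, composeOut_succ]
    split_ifs
    · exact hσ
    · exact hτ

theorem composeOut_budget_mem (σ τ : Strategy G) {B : ℝ} (h0 : 0 ≤ B) (h1 : B ≤ 1) (k : ℕ) :
    0 ≤ (composeOut σ τ B k).2 ∧ (composeOut σ τ B k).2 ≤ 1 := by
  induction k with
  | zero => exact ⟨h0, h1⟩
  | succ k ih =>
    rw [composeOut_succ]
    have a1 := σ.bidding.bid_nonneg (composeOut σ τ B k).1 _ ih.1 ih.2
    have a2 := σ.bidding.bid_le (composeOut σ τ B k).1 _ ih.1 ih.2
    have b1 := τ.bidding.bid_nonneg (composeOut σ τ B k).1 (1 - (composeOut σ τ B k).2)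
      (by linarith) (by linarith)
    have b2 := τ.bidding.bid_le (composeOut σ τ B k).1 (1 - (composeOut σ τ B k).2)
      (by linarith) (by linarith)
    split_ifs <;> constructor <;> simp only <;> linarith

open Classical in
/-- The action policy that prolongs the prefixes of a given infinite path along that path. -/
noncomputable def followPath (ρ : ℕ → V) (hρ : ρ ∈ G.infPaths) : ActionPolicy G where
  next l := if l = (List.range l.length).map ρ then ρ l.length
    else (G.exists_succ (l.getLast?.getD G.init)).choose
  adj l v _ := by
    split_ifs with h
    · have hv : v = ρ l.length := by
        have := congrArg (fun l => l.getLast?) h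
        simpa [List.range_succ] using this
      simpa [hv] using hρ.2 l.length
    · simpa using (G.exists_succ v).choose_spec

theorem followPath_next (ρ : ℕ → V) (hρ : ρ ∈ G.infPaths) (k : ℕ) :
    (followPath ρ hρ).next ((List.range (k + 1)).map ρ) = ρ (k + 1) := by
  simp [followPath]

open Classical in
/-- The bidding policy that bids as `β` against `γ`, but turns positive ties into lost bids. -/
noncomputable def untie (β γ : BiddingPolicy V) : BiddingPolicy V where
  bid v B := if β.bid v B ≤ γ.bid v (1 - B) then 0 else β.bid v B
  bid_nonneg v B h0 h1 := by
    split_ifs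
    · exact le_rfl
    · exact β.bid_nonneg v B h0 h1
  bid_le v B h0 h1 := by
    split_ifs
    · exact h0
    · exact β.bid_le v B h0 h1

/-- Every play of `σ` in the first role is a play of `σ` in the second role. -/
theorem exists_composePath_swap (σ τ : Strategy G) {B : ℝ} (h0 : 0 ≤ B) (h1 : B ≤ 1) :
    ∃ τ' : Strategy G, composePath τ' σ (1 - B) = composePath σ τ B := by
  set ρ := composePath σ τ B with hρ
  have hmem : ρ ∈ G.infPaths := composePath_mem_infPaths σ τ B
  -- Only a tie at bid `0` still goes to `τ'` where `σ` used to win. There `τ'` moves along `ρ`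
  -- itself and pays nothing, so neither the path nor the budgets change.
  let τ' : Strategy G := ⟨followPath ρ hmem, untie τ.bidding σ.bidding⟩
  -- Agreement on the whole prefix is part of the induction, since the action policy of `σ` sees the
  -- entire path.
  have key : ∀ k, (∀ i ≤ k, composePath τ' σ (1 - B) i = ρ i) ∧
      composeOut τ' σ (1 - B) k = (ρ k, 1 - (composeOut σ τ B k).2) := by
    intro k
    induction k with
    | zero =>
      refine ⟨fun i hi => ?_, rfl⟩
      obtain rfl : i = 0 := by omega
      rfl
    | succ k ih =>
      have hr : (List.range (k + 1)).map (composePath τ' σ (1 - B)) =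
          (List.range (k + 1)).map ρ :=
        List.map_congr_left fun i hi => ih.1 i (by simpa [Nat.lt_succ_iff] using hi)
      have hout : composeOut τ' σ (1 - B) (k + 1) = (ρ (k + 1), 1 - (composeOut σ τ B (k + 1)).2) := by
        have hb := composeOut_budget_mem σ τ h0 h1 k
        have hk : (composeOut σ τ B k).1 = ρ k := rfl
        have e : composeOut σ τ B (k + 1) = (ρ (k + 1), (composeOut σ τ B (k + 1)).2) := rfl
        have s := composeOut_succ σ τ B k
        rw [composeOut_succ, ih.2, hr]
        have hf := followPath_next ρ hmem k
        rw [hk, ← hρ] at s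
        have hnn := σ.bidding.bid_nonneg (ρ k) _ hb.1 hb.2
        have hn2 := τ.bidding.bid_nonneg (ρ k) (1 - (composeOut σ τ B k).2)
          (by linarith) (by linarith)
        simp only [τ', untie, sub_sub_cancel, hf]
        by_cases hle : τ.bidding.bid (ρ k) (1 - (composeOut σ τ B k).2) ≤
            σ.bidding.bid (ρ k) (composeOut σ τ B k).2
        · rw [if_pos hle] at s
          have s1 : ρ (k + 1) = _ := (congrArg Prod.fst e).symm.trans (congrArg Prod.fst s)
          have s2 := congrArg Prod.snd s
          simp only at s1 s2
          rw [if_pos hle]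
          split_ifs with h'
          · rw [s2]
            simp only [Prod.mk.injEq, true_and]
            linarith
          · rw [s1, s2]
            simp only [Prod.mk.injEq, true_and]
            ring
        · rw [if_neg hle] at s
          have s2 := congrArg Prod.snd s
          simp only at s2
          rw [if_neg hle, if_pos (not_le.mp hle).le, s2]
          simp only [Prod.mk.injEq, true_and]
          ring
      refine ⟨fun i hi => ?_, hout⟩
      rcases Nat.lt_or_ge i (k + 1) with h | h
      · exact ih.1 i (by omega)
      · obtain rfl : i = k + 1 := by omega
        exact (congrArg Prod.fst hout :)
  exact ⟨τ', funext fun k => (key k).1 k le_rfl⟩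

end Composition

/-! ### Strategies from potentials -/

/-- A function `f` on the vertices of a graph together with a base bid `β`, a move `move` and a rank,
such that a player whose budget exceeds `f` keeps it so outside `A` by bidding at least `β`, and its
moves lead to `T ∪ A`. -/
structure Potential {V : Type*} (G : BidGraph V) (A T : Set V) where
  f : V → ℝ
  β : V → ℝ
  move : V → V
  rank : V → ℕ
  f_nonneg : ∀ v, 0 ≤ f v
  β_nonneg : ∀ v, 0 ≤ β v
  adj : ∀ v, G.Adj v (move v)
  lower : ∀ v ∉ A, f (move v) + β v ≤ f v
  upper : ∀ v ∉ A, ∀ w, G.Adj v w → f w ≤ f v + β v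
  rank_lt : ∀ v ∉ A, v ∉ T → rank (move v) < rank v

namespace Potential

variable {V : Type*} {G : BidGraph V} {A T : Set V}

/-- The weight of a rank. -/
noncomputable def weight (j : ℕ) : ℝ := (1 / 4) * (1 / 8) ^ j

theorem weight_pos (j : ℕ) : 0 < weight j := by unfold weight; positivity

theorem weight_anti {i j : ℕ} (h : i ≤ j) : weight j ≤ weight i := by
  unfold weight
  gcongr 1 / 4 * ?_
  exact pow_le_pow_of_le_one (by norm_num) (by norm_num) h

theorem weight_le (j : ℕ) : weight j ≤ 1 / 4 := by
  have := weight_anti (Nat.zero_le j)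
  simpa [weight] using this

/-- The ratio `8` serves `IsPlay.exists_mem`: a won round keeps at least the fraction `1 - 2w` of
the surplus while the weight rises from `w` to at least `8w`, and `(1 - 2w)(1 + 8w) ≥ 1 + w` for `w
≤ 1/4`. -/
theorem weight_lt {i j : ℕ} (h : i < j) : 8 * weight j ≤ weight i := by
  have := weight_anti (Nat.succ_le_of_lt h)
  have e : 8 * weight (i + 1) = weight i := by unfold weight; ring
  simp only [Nat.succ_eq_add_one] at this
  linarith

open Classical in
/-- The base bid plus a fraction of the surplus of the budget over the potential. -/
noncomputable def bid (P : Potential G A T) (v : V) (B : ℝ) : ℝ :=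
  if P.f v ≤ B ∧ v ∉ A then P.β v + 2 * weight (P.rank v) * (B - P.f v) else 0

theorem bid_nonneg (P : Potential G A T) (v : V) (B : ℝ) : 0 ≤ P.bid v B := by
  unfold bid
  split_ifs with h
  · have := weight_pos (P.rank v)
    have := P.β_nonneg v
    have := mul_nonneg (weight_pos (P.rank v)).le (sub_nonneg.mpr h.1)
    linarith
  · exact le_rfl

/-- The base bid is at most `f v`, because `lower` leaves the nonnegative value `f (move v)`, and
the extra bid is at most half the surplus `B - f v`. -/
theorem bid_le (P : Potential G A T) (v : V) (B : ℝ) (h0 : 0 ≤ B) : P.bid v B ≤ B := by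
  unfold bid
  split_ifs with h
  · have h1 := weight_le (P.rank v)
    have h2 := P.lower v h.2
    have h3 := P.f_nonneg (P.move v)
    nlinarith [sub_nonneg.mpr h.1]
  · exact h0

/-- The strategy of a potential. -/
noncomputable def strategy (P : Potential G A T) : Strategy G where
  act :=
    { next := fun l => P.move (l.getLast?.getD G.init)
      adj := fun ρ v _ => by simpa using P.adj v }
  bidding :=
    { bid := P.bid
      bid_nonneg := fun v B _ _ => P.bid_nonneg v B
      bid_le := fun v B h _ => P.bid_le v B h }

/-- A sequence of vertices and budgets that is consistent with the strategy of a potential. -/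
structure IsPlay (P : Potential G A T) (x : ℕ → V) (B : ℕ → ℝ) : Prop where
  le_one : ∀ i, B i ≤ 1
  start : P.f (x 0) < B 0
  step : ∀ i, (x (i + 1) = P.move (x i) ∧ B (i + 1) = B i - P.bid (x i) (B i)) ∨
    (G.Adj (x i) (x (i + 1)) ∧ B i + P.bid (x i) (B i) ≤ B (i + 1))

theorem isPlay_first (P : Potential G A T) (τ : Strategy G) {B : ℝ} (hB : P.f G.init < B)
    (h1 : B ≤ 1) :
    P.IsPlay (composePath P.strategy τ B) fun i => (composeOut P.strategy τ B i).2 where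
  le_one i := (composeOut_budget_mem _ _ ((P.f_nonneg _).trans hB.le) h1 i).2
  start := hB
  step i := by
    have hadj := (composePath_mem_infPaths P.strategy τ B).2 i
    have s := composeOut_succ P.strategy τ B i
    have e1 : ∀ i, (composeOut P.strategy τ B i).1 = composePath P.strategy τ B i := fun _ => rfl
    have hbid : P.strategy.bidding.bid = P.bid := rfl
    split_ifs at s with h
    · left
      refine ⟨?_, congrArg Prod.snd s⟩
      have := congrArg Prod.fst s
      rw [e1] at this
      rw [this]
      simp [strategy, List.range_succ]
    · right
      refine ⟨hadj, ?_⟩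
      have := congrArg Prod.snd s
      simp only [this]
      push Not at h
      have h' := h.le
      rw [hbid, e1] at *
      linarith

/-- Losing ties in the second role is harmless: `IsPlay` only asks that in a lost round the player
receives at least its own bid. -/
theorem isPlay_second (P : Potential G A T) (τ : Strategy G) {B : ℝ} (hB : P.f G.init < 1 - B)
    (h0 : 0 ≤ B) :
    P.IsPlay (composePath τ P.strategy B) fun i => 1 - (composeOut τ P.strategy B i).2 where
  le_one i := by
    have := (composeOut_budget_mem τ P.strategy h0
      (by linarith [P.f_nonneg G.init]) i).1
    linarith
  start := hB
  step i := by
    have hadj := (composePath_mem_infPaths τ P.strategy B).2 i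
    have s := composeOut_succ τ P.strategy B i
    have e1 : ∀ i, (composeOut τ P.strategy B i).1 = composePath τ P.strategy B i := fun _ => rfl
    have hbid : P.strategy.bidding.bid = P.bid := rfl
    split_ifs at s with h
    · right
      refine ⟨hadj, ?_⟩
      have := congrArg Prod.snd s
      simp only [this]
      rw [hbid, e1] at *
      linarith
    · left
      constructor
      · have := congrArg Prod.fst s
        rw [e1] at this
        rw [this]
        simp [strategy, List.range_succ]
      · have := congrArg Prod.snd s
        simp only [this]
        rw [hbid, e1]
        ring

variable {P : Potential G A T} {x : ℕ → V} {B : ℕ → ℝ}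

/-- In a won round the base bid is paid for by the drop of `f`, and the extra bid costs at most half
the surplus. In a lost round the income is at least the base bid plus the extra bid, while `f` rises
by at most the base bid. -/
theorem IsPlay.lt_budget (h : P.IsPlay x B) (i : ℕ) (hi : ∀ j < i, x j ∉ A) :
    P.f (x i) < B i := by
  induction i with
  | zero => exact h.start
  | succ i ih =>
    have ih := ih fun j hj => hi j (by omega)
    have hA := hi i (by omega)
    have hb : P.bid (x i) (B i) = P.β (x i) + 2 * weight (P.rank (x i)) * (B i - P.f (x i)) :=
      if_pos ⟨ih.le, hA⟩
    have hw := weight_le (P.rank (x i))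
    have hw0 := weight_pos (P.rank (x i))
    have hs := sub_pos.mpr ih
    rcases h.step i with ⟨hx, hB⟩ | ⟨hx, hB⟩
    · have := P.lower _ hA
      rw [hx, hB, hb]
      nlinarith
    · have := P.upper _ hA _ hx
      rw [hb] at hB
      nlinarith

/-- Suppose `T` is avoided from time `N` on. The surplus, weighted by `1 + weight (rank)`, does not
decrease in a won round, since the rank drops and the gain in weight compensates the extra bid. In a
lost round it grows by a fixed factor `1 + δ`. Ranks cannot drop forever, so lost rounds recur and
the weighted surplus is unbounded, against the bound `1` on the budget. -/
theorem IsPlay.exists_mem [Finite V] (h : P.IsPlay x B) (hA : ∀ i, x i ∉ A) (N : ℕ) :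
    ∃ i, N ≤ i ∧ x i ∈ T := by
  by_contra! hT
  have hlt := fun i => h.lt_budget i fun j _ => hA j
  have hb : ∀ i, P.bid (x i) (B i) =
      P.β (x i) + 2 * weight (P.rank (x i)) * (B i - P.f (x i)) := fun i =>
    if_pos ⟨(hlt i).le, hA i⟩
  have : Nonempty V := ⟨x 0⟩
  obtain ⟨m, hm⟩ := Finite.exists_max P.rank
  -- Half the smallest weight: for a weight `w ≤ 1/4` with `δ ≤ w / 2` one has `(1 + δ)(1 + w) ≤ 1 +
  -- 2w`, which is what a lost round yields.
  set δ : ℝ := weight (P.rank m) / 2 with hδ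
  have hδ0 : 0 < δ := by have := weight_pos (P.rank m); positivity
  let Ψ : ℕ → ℝ := fun i => (B i - P.f (x i)) * (1 + weight (P.rank (x i)))
  have hΨ0 : ∀ i, 0 < Ψ i := fun i =>
    mul_pos (sub_pos.mpr (hlt i)) (by linarith [weight_pos (P.rank (x i))])
  have hwin : ∀ i, N ≤ i → x (i + 1) = P.move (x i) → B (i + 1) = B i - P.bid (x i) (B i) →
      Ψ i ≤ Ψ (i + 1) := by
    intro i hi hx hB
    have h1 := P.lower _ (hA i)
    have h2 := weight_lt (P.rank_lt _ (hA i) (hT i hi))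
    have h3 := weight_pos (P.rank (x i))
    have h4 := weight_le (P.rank (x i))
    have h5 := sub_pos.mpr (hlt i)
    have h6 : (B i - P.f (x i)) * (1 - 2 * weight (P.rank (x i))) ≤ B (i + 1) - P.f (x (i + 1)) := by
      rw [hB, hb, hx]; linarith
    simp only [Ψ]
    rw [← hx] at h2
    set w := weight (P.rank (x i))
    set w' := weight (P.rank (x (i + 1)))
    set s := B i - P.f (x i)
    calc s * (1 + w) ≤ s * ((1 - 2 * w) * (1 + w')) := by
          gcongr
          nlinarith
      _ = s * (1 - 2 * w) * (1 + w') := by ring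
      _ ≤ _ := by
          gcongr
          linarith
  have hlose : ∀ i, G.Adj (x i) (x (i + 1)) → B i + P.bid (x i) (B i) ≤ B (i + 1) →
      (1 + δ) * Ψ i ≤ Ψ (i + 1) := by
    intro i hx hB
    have h1 := P.upper _ (hA i) _ hx
    have h2 := weight_pos (P.rank (x (i + 1)))
    have h3 := weight_pos (P.rank (x i))
    have h4 := weight_le (P.rank (x i))
    have h5 := sub_pos.mpr (hlt i)
    have h7 : δ ≤ weight (P.rank (x i)) / 2 := by
      rw [hδ]; linarith [weight_anti (hm (x i))]
    have h6 : (B i - P.f (x i)) * (1 + 2 * weight (P.rank (x i))) ≤ B (i + 1) - P.f (x (i + 1)) := by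
      rw [hb] at hB; linarith
    simp only [Ψ]
    set w := weight (P.rank (x i))
    set w' := weight (P.rank (x (i + 1)))
    set s := B i - P.f (x i)
    calc (1 + δ) * (s * (1 + w)) = s * ((1 + δ) * (1 + w)) := by ring
      _ ≤ s * (1 + 2 * w) := by
          gcongr
          nlinarith
      _ ≤ (B (i + 1) - P.f (x (i + 1))) * 1 := by linarith
      _ ≤ _ := by
          gcongr
          · exact (sub_pos.mpr (hlt _)).le
          · linarith
  have hmono : ∀ i, N ≤ i → Ψ i ≤ Ψ (i + 1) := by
    intro i hi
    rcases h.step i with ⟨hx, hB⟩ | ⟨hx, hB⟩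
    · exact hwin i hi hx hB
    · have := hlose i hx hB
      nlinarith [hΨ0 i]
  have hmono' : ∀ i j, N ≤ i → i ≤ j → Ψ i ≤ Ψ j := by
    intro i j hi hij
    induction j, hij using Nat.le_induction with
    | base => exact le_rfl
    | succ j hj ih => exact ih.trans (hmono j (by omega))
  -- A run of won rounds outside `T` is no longer than the rank at its start.
  have hex : ∀ i, N ≤ i → ∃ j, i ≤ j ∧ (1 + δ) * Ψ j ≤ Ψ (j + 1) := by
    intro i hi
    by_contra! hno
    have hdec : ∀ j, P.rank (x (i + j)) + j ≤ P.rank (x i) := by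
      intro j
      induction j with
      | zero => simp
      | succ j ih =>
        rcases h.step (i + j) with ⟨hx, -⟩ | ⟨hx, hB⟩
        · have := P.rank_lt _ (hA (i + j)) (hT (i + j) (by omega))
          rw [← hx] at this
          rw [← add_assoc i j 1]
          omega
        · exact absurd (hlose _ hx hB) (not_le.mpr (hno _ (by omega)))
    have := hdec (P.rank (x i) + 1)
    omega
  have hgrow : ∀ k : ℕ, ∃ j, N ≤ j ∧ (1 + δ) ^ k * Ψ N ≤ Ψ j := by
    intro k
    induction k with
    | zero => exact ⟨N, le_rfl, by simp⟩
    | succ k ih =>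
      obtain ⟨j, hj, hk⟩ := ih
      obtain ⟨j', hj', hk'⟩ := hex j hj
      refine ⟨j' + 1, by omega, ?_⟩
      calc (1 + δ) ^ (k + 1) * Ψ N = (1 + δ) * ((1 + δ) ^ k * Ψ N) := by ring
        _ ≤ (1 + δ) * Ψ j' := by
            gcongr
            exact hk.trans (hmono' _ _ hj hj')
        _ ≤ _ := hk'
  -- The weighted surplus is at most `1 + 1/4`, so exceeding `2` is a contradiction.
  obtain ⟨k, hk⟩ := pow_unbounded_of_one_lt (2 / Ψ N) (show 1 < 1 + δ by linarith)
  obtain ⟨j, -, hj⟩ := hgrow k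
  have h2 : 2 < Ψ j := lt_of_lt_of_le ((div_lt_iff₀ (hΨ0 N)).mp hk) hj
  have h3 : Ψ j ≤ 1 * (1 + 1 / 4) := by
    simp only [Ψ]
    have := h.le_one j
    have := P.f_nonneg (x j)
    have := weight_le (P.rank (x j))
    have := weight_pos (P.rank (x j))
    gcongr
    linarith
  linarith

end Potential

open Relation

/-! ### Richman functions -/

section Richman

variable {V : Type*}

/-- The relation `E` with the vertices of `A` made absorbing. -/
def freeze (E : V → V → Prop) (A : Set V) (v w : V) : Prop :=
  (v ∈ A ∧ v = w) ∨ (v ∉ A ∧ E v w)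

/-- `v` lies in a bottom strongly connected component of `E`. -/
def IsBottom (E : V → V → Prop) (v : V) : Prop :=
  ∀ w, ReflTransGen E v w → ReflTransGen E w v

/-- The greatest color that is reachable from `v` is even. -/
def EvenTop (E : V → V → Prop) (col : V → ℕ) (v : V) : Prop :=
  ∃ w, ReflTransGen E v w ∧ Even (col w) ∧ ∀ u, ReflTransGen E v u → col u ≤ col w

/-- The vertices of greatest color in the bottom strongly connected components. -/
def topSet (E : V → V → Prop) (col : V → ℕ) : Set V :=
  {t | IsBottom E t ∧ ∀ u, ReflTransGen E t u → col u ≤ col t}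

/-- `f` is `0` on the bottom components whose greatest color is even and `1` on the other ones, and
elsewhere the mean of its extreme values on the successors. -/
structure IsRichman (E : V → V → Prop) (col : V → ℕ) (f : V → ℝ) : Prop where
  nonneg : ∀ v, 0 ≤ f v
  le_one : ∀ v, f v ≤ 1
  bottom_even : ∀ v, IsBottom E v → EvenTop E col v → f v = 0
  bottom_odd : ∀ v, IsBottom E v → ¬ EvenTop E col v → f v = 1
  avg : ∀ v, ¬ IsBottom E v → ∃ p q, E v p ∧ E v q ∧ (∀ w, E v w → f p ≤ f w ∧ f w ≤ f q) ∧
    2 * f v = f p + f q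

variable {E : V → V → Prop} {col : V → ℕ} {f : V → ℝ}

theorem evenTop_congr {v w : V} (h : ∀ u, ReflTransGen E v u ↔ ReflTransGen E w u) :
    EvenTop E col v ↔ EvenTop E col w := by
  simp only [EvenTop, h]

theorem IsBottom.of_reach {v w : V} (h : IsBottom E v) (hw : ReflTransGen E v w) :
    IsBottom E w := fun u hu => (h u (hw.trans hu)).trans hw

theorem IsBottom.reach_iff {v w : V} (h : IsBottom E v) (hw : ReflTransGen E v w) (u : V) :
    ReflTransGen E v u ↔ ReflTransGen E w u :=
  ⟨fun hu => (h w hw).trans hu, fun hu => hw.trans hu⟩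

theorem evenTop_succ_iff [Finite V] (v : V) :
    EvenTop E (fun u => col u + 1) v ↔ ¬ EvenTop E col v := by
  constructor
  · rintro ⟨w, hw, he, hm⟩ ⟨w', hw', he', hm'⟩
    have : col w = col w' := le_antisymm (hm' w hw) (by simpa using hm w' hw')
    exact (Nat.even_add_one.mp he) (this ▸ he')
  · intro h
    obtain ⟨w, hw, hm⟩ := Set.exists_max_image {u | ReflTransGen E v u} col (Set.toFinite _)
      ⟨v, ReflTransGen.refl⟩
    refine ⟨w, hw, Nat.even_add_one.mpr fun he => h ⟨w, hw, he, hm⟩, fun u hu => ?_⟩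
    simpa using hm u hu

/-- This is the game of the opponent: raising all colors by one complements the parity condition,
and passing to `1 - f` exchanges the smallest and the greatest successor. -/
theorem IsRichman.dual [Finite V] (hf : IsRichman E col f) :
    IsRichman E (fun u => col u + 1) fun v => 1 - f v where
  nonneg v := by linarith [hf.le_one v]
  le_one v := by linarith [hf.nonneg v]
  bottom_even v hb he := by
    rw [hf.bottom_odd v hb ((evenTop_succ_iff v).mp he)]; norm_num
  bottom_odd v hb he := by
    rw [hf.bottom_even v hb (by simpa [evenTop_succ_iff] using he)]; norm_num
  avg v hv := by
    obtain ⟨p, q, hp, hq, hpq, h⟩ := hf.avg v hv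
    exact ⟨q, p, hq, hp, fun w hw => ⟨by linarith [(hpq w hw).2], by linarith [(hpq w hw).1]⟩,
      by linarith⟩

/-- The average property holds at the bottom vertices too. -/
theorem IsRichman.avg' (hE : ∀ v, ∃ w, E v w) (hf : IsRichman E col f) (v : V) :
    ∃ p q, E v p ∧ E v q ∧ (∀ w, E v w → f p ≤ f w ∧ f w ≤ f q) ∧ 2 * f v = f p + f q := by
  by_cases hv : IsBottom E v
  · have key : ∀ w, E v w → f w = f v := by
      intro w hw
      have hr : ReflTransGen E v w := ReflTransGen.single hw
      have hi := evenTop_congr (col := col) (hv.reach_iff hr)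
      by_cases he : EvenTop E col v
      · rw [hf.bottom_even v hv he, hf.bottom_even w (hv.of_reach hr) (hi.mp he)]
      · rw [hf.bottom_odd v hv he, hf.bottom_odd w (hv.of_reach hr) (fun h => he (hi.mpr h))]
    obtain ⟨w, hw⟩ := hE v
    refine ⟨w, w, hw, hw, fun u hu => ?_, ?_⟩
    · rw [key w hw, key u hu]; exact ⟨le_rfl, le_rfl⟩
    · rw [key w hw]; ring
  · exact hf.avg v hv

/-- A vertex reachable from `v` whose own set of reachable vertices is as small as possible lies in
a bottom component. A vertex of greatest color there is in the top set. -/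
theorem exists_reach_topSet [Finite V] (E : V → V → Prop) (col : V → ℕ) (v : V) :
    ∃ t ∈ topSet E col, ReflTransGen E v t := by
  obtain ⟨w, hw, hm⟩ := Set.exists_min_image {u | ReflTransGen E v u}
    (fun u => {x | ReflTransGen E u x}.ncard) (Set.toFinite _) ⟨v, ReflTransGen.refl⟩
  have hb : IsBottom E w := by
    intro u hu
    have hsub : {x | ReflTransGen E u x} ⊆ {x | ReflTransGen E w x} := fun x hx => hu.trans hx
    have := Set.eq_of_subset_of_ncard_le hsub (hm u (ReflTransGen.trans hw hu)) (Set.toFinite _)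
    have hw' : w ∈ {x | ReflTransGen E w x} := ReflTransGen.refl
    rwa [← this] at hw'
  obtain ⟨t, ht, hmt⟩ := Set.exists_max_image {u | ReflTransGen E w u} col (Set.toFinite _)
    ⟨w, ReflTransGen.refl⟩
  exact ⟨t, ⟨hb.of_reach ht, fun u hu => hmt u (ReflTransGen.trans ht hu)⟩,
    ReflTransGen.trans hw ht⟩

/-- A key in a linear order can be replaced by a natural number. -/
theorem exists_rank [Finite V] {α : Type*} [LinearOrder α] (κ : V → α) :
    ∃ r : V → ℕ, (∀ v, r v < Nat.card V) ∧ ∀ v w, κ w < κ v → r w < r v := by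
  refine ⟨fun v => {w | κ w < κ v}.ncard, fun v => ?_, fun v w h => ?_⟩
  · rw [← Set.ncard_univ]
    refine Set.ncard_lt_ncard ⟨Set.subset_univ _, fun h => ?_⟩ (Set.toFinite _)
    exact lt_irrefl _ (h (Set.mem_univ v) : κ v < κ v)
  · refine Set.ncard_lt_ncard ⟨fun x hx => lt_trans hx h, fun h' => ?_⟩ (Set.toFinite _)
    exact lt_irrefl _ (h' h : κ w < κ w)

theorem exists_dist (E : V → V → Prop) (T : Set V) (h : ∀ v, ∃ t ∈ T, ReflTransGen E v t) :
    ∃ d : V → ℕ, ∀ v ∉ T, ∃ w, E v w ∧ d w < d v := by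
  classical
  -- `D k` consists of the vertices with a walk of length exactly `k` into `T`.
  let D : ℕ → Set V := fun k => Nat.rec T (fun _ S => {v | ∃ w, E v w ∧ w ∈ S}) k
  have hD : ∀ v, ∃ k, v ∈ D k := by
    intro v
    obtain ⟨t, ht, hr⟩ := h v
    induction hr using ReflTransGen.head_induction_on with
    | refl => exact ⟨0, ht⟩
    | head hab _ ih =>
      obtain ⟨k, hk⟩ := ih
      exact ⟨k + 1, _, hab, hk⟩
  refine ⟨fun v => sInf {k | v ∈ D k}, fun v hv => ?_⟩
  have hs : v ∈ D (sInf {k | v ∈ D k}) := Nat.sInf_mem (hD v)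
  rcases hk : sInf {k | v ∈ D k} with _ | k
  · rw [hk] at hs
    exact absurd hs hv
  · rw [hk] at hs
    obtain ⟨w, hw, hwk⟩ := hs
    exact ⟨w, hw, (Nat.lt_succ_of_le (Nat.sInf_le hwk)).trans_eq hk.symm⟩

/-- Moves to a minimal successor that approach the top set. -/
theorem IsRichman.exists_move [Finite V] (hE : ∀ v, ∃ w, E v w) (hf : IsRichman E col f) :
    ∃ (p q : V → V) (r : V → ℕ), ∀ v, E v (p v) ∧ E v (q v) ∧
      (∀ w, E v w → f (p v) ≤ f w ∧ f w ≤ f (q v)) ∧ 2 * f v = f (p v) + f (q v) ∧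
      (v ∉ topSet E col → r (p v) < r v) := by
  obtain ⟨d, hd⟩ := exists_dist E (topSet E col) (exists_reach_topSet E col)
  -- If the extreme successors have different values, the mean property makes the minimal one
  -- strictly smaller than `f v`. Otherwise `f` is constant on `v` and its successors, so every
  -- successor is minimal and one closer to the top set can be chosen. The lexicographic order
  -- covers both cases.
  obtain ⟨r, -, hr⟩ := exists_rank fun v => toLex (f v, d v)
  have key : ∀ v, ∃ p q, E v p ∧ E v q ∧ (∀ w, E v w → f p ≤ f w ∧ f w ≤ f q) ∧
      2 * f v = f p + f q ∧ (v ∉ topSet E col → r p < r v) := by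
    intro v
    obtain ⟨p, q, hp, hq, hpq, h⟩ := hf.avg' hE v
    rcases (hpq q hq).1.lt_or_eq with hlt | heq
    · refine ⟨p, q, hp, hq, hpq, h, fun _ => hr _ _ ?_⟩
      exact Prod.Lex.left _ _ (by linarith)
    · by_cases hv : v ∈ topSet E col
      · exact ⟨p, q, hp, hq, hpq, h, fun h' => absurd hv h'⟩
      · obtain ⟨w, hw, hdw⟩ := hd v hv
        have hfw : f w = f v := by linarith [(hpq w hw).1, (hpq w hw).2]
        refine ⟨w, q, hw, hq, fun u hu => ⟨?_, (hpq u hu).2⟩, by linarith, fun _ => hr _ _ ?_⟩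
        · linarith [(hpq u hu).1]
        · rw [Prod.Lex.toLex_lt_toLex]
          exact Or.inr ⟨hfw, hdw⟩
  choose p q h using key
  exact ⟨p, q, r, h⟩

theorem exists_freeze (G : BidGraph V) (A : Set V) (v : V) : ∃ w, freeze G.Adj A v w := by
  by_cases hv : v ∈ A
  · exact ⟨v, Or.inl ⟨hv, rfl⟩⟩
  · exact (G.exists_succ v).imp fun w hw => Or.inr ⟨hv, hw⟩

theorem freeze_iff_of_notMem {A : Set V} {v w : V} (hv : v ∉ A) : freeze E A v w ↔ E v w := by
  simp [freeze, hv]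

/-- With `β` half the gap between the extreme successors, the mean property says exactly that `f` at
the minimal successor is `f v - β v` and at the maximal one `f v + β v`. On `A` the frozen relation
has only loops, which need not be edges of `G`, so the move there is an arbitrary edge. -/
theorem IsRichman.exists_potential [Finite V] {G : BidGraph V} {A : Set V}
    (hf : IsRichman (freeze G.Adj A) col f) :
    ∃ P : Potential G A (topSet (freeze G.Adj A) col), P.f = f := by
  classical
  obtain ⟨p, q, r, h⟩ := hf.exists_move (exists_freeze G A)
  refine ⟨{ f := f, β := fun v => (f (q v) - f (p v)) / 2,
            move := fun v => if v ∈ A then (G.exists_succ v).choose else p v, rank := r,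
            f_nonneg := hf.nonneg, β_nonneg := fun v => ?_, adj := fun v => ?_,
            lower := fun v hv => ?_, upper := fun v hv w hw => ?_,
            rank_lt := fun v hv hT => ?_ }, rfl⟩
  · have := ((h v).2.2.1 _ (h v).2.1).1
    linarith
  · split_ifs with hv
    · exact (G.exists_succ v).choose_spec
    · exact (freeze_iff_of_notMem hv).mp (h v).1
  · rw [if_neg hv]
    linarith [(h v).2.2.2.1]
  · have := ((h v).2.2.1 w ((freeze_iff_of_notMem hv).mpr hw)).2
    linarith [(h v).2.2.2.1]
  · rw [if_neg hv]
    exact (h v).2.2.2.2 hT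

/-- The condition on a path `x`, that either `x` enters `A` at a vertex of even color, or it avoids
`A` and the greatest color seen infinitely often is even. -/
def GoodPath (A : Set V) (col : V → ℕ) (x : ℕ → V) : Prop :=
  (∃ i, x i ∈ A ∧ (∀ j < i, x j ∉ A) ∧ Even (col (x i))) ∨
    ((∀ i, x i ∉ A) ∧ ∃ m, IsGreatest {i | ∃ v ∈ infOften x, col v = i} m ∧ Even m)

theorem exists_mem_infOften [Finite V] {x : ℕ → V} {T : Set V} (h : ∀ N, ∃ i, N ≤ i ∧ x i ∈ T) :
    ∃ t ∈ T, t ∈ infOften x := by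
  by_contra! hno
  have : ∀ t, ∃ N, ∀ i, N ≤ i → x i = t → t ∉ T := by
    intro t
    by_cases ht : t ∈ T
    · have := hno t ht
      simp only [infOften, Set.mem_ofPred_eq, not_forall, not_exists, not_and] at this
      obtain ⟨N, hN⟩ := this
      exact ⟨N, fun i hi hx => absurd hx (hN i hi)⟩
    · exact ⟨0, fun _ _ _ => ht⟩
  choose N hN using this
  obtain ⟨b, hb⟩ := (Set.finite_range N).bddAbove
  obtain ⟨i, hi, hT⟩ := h b
  exact hN (x i) i ((hb ⟨x i, rfl⟩).trans hi) rfl hT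

theorem reach_freeze_of_mem {A : Set V} {v w : V} (hv : v ∈ A)
    (h : ReflTransGen (freeze E A) v w) : w = v := by
  induction h with
  | refl => rfl
  | tail _ hbc ih =>
    subst ih
    rcases hbc with ⟨-, h⟩ | ⟨h, -⟩
    · exact h.symm
    · exact absurd hv h

/-- While `A` is avoided the budget stays above `f` and at most `1`, so the play cannot be at a
bottom vertex with `f = 1`. A vertex of `A` is a bottom component by itself, so its color is even on
entry. If `A` is never entered, some vertex of the top set recurs. It is bottom and its color, the
greatest one reachable from it, is even and bounds all recurring colors. -/
theorem IsRichman.goodPath_of_isPlay [Finite V] {G : BidGraph V} {A : Set V}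
    (hf : IsRichman (freeze G.Adj A) col f)
    {P : Potential G A (topSet (freeze G.Adj A) col)} (hP : P.f = f) {x : ℕ → V} {B : ℕ → ℝ}
    (hx : x ∈ G.infPaths) (h : P.IsPlay x B) : GoodPath A col x := by
  classical
  have heven : ∀ i, IsBottom (freeze G.Adj A) (x i) → (∀ j < i, x j ∉ A) →
      EvenTop (freeze G.Adj A) col (x i) := by
    intro i hb hi
    by_contra he
    have h1 := hf.bottom_odd _ hb he
    have h2 := h.lt_budget i hi
    rw [hP, h1] at h2
    linarith [h.le_one i]
  by_cases hA : ∃ i, x i ∈ A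
  · left
    have hm : ∀ j < Nat.find hA, x j ∉ A := fun j hj => Nat.find_min hA hj
    have hs : x (Nat.find hA) ∈ A := Nat.find_spec hA
    refine ⟨Nat.find hA, hs, hm, ?_⟩
    obtain ⟨w, hw, he, -⟩ := heven _ (fun w hw => by
      rw [reach_freeze_of_mem hs hw]) hm
    rwa [reach_freeze_of_mem hs hw] at he
  · right
    push Not at hA
    refine ⟨hA, ?_⟩
    obtain ⟨t, ht, hio⟩ := exists_mem_infOften (h.exists_mem hA)
    refine ⟨col t, ⟨⟨t, hio, rfl⟩, ?_⟩, ?_⟩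
    · rintro _ ⟨v, hv, rfl⟩
      obtain ⟨i, -, rfl⟩ := hio 0
      obtain ⟨j, hj, rfl⟩ := hv i
      refine ht.2 _ ?_
      induction j, hj using Nat.le_induction with
      | base => exact ReflTransGen.refl
      | succ j hj ih =>
        -- The induction hypothesis carries the assumption that `x j` recurs. When it fails,
        -- reachability along the path is proved again without it.
        by_cases hv' : x j ∈ infOften x
        · exact (ih hv').tail ((freeze_iff_of_notMem (hA j)).mpr (hx.2 j))
        · clear ih hv hv'
          induction j, hj using Nat.le_induction with
          | base => exact ReflTransGen.single ((freeze_iff_of_notMem (hA i)).mpr (hx.2 i))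
          | succ j hj ih => exact ih.tail ((freeze_iff_of_notMem (hA _)).mpr (hx.2 _))
    · obtain ⟨i, -, rfl⟩ := hio 0
      obtain ⟨w, hw, he, hm⟩ := heven i ht.1 fun j _ => hA j
      rwa [le_antisymm (ht.2 w hw) (hm _ ReflTransGen.refl)] at he

/-- Every finite graph has a Richman function. -/
theorem exists_isRichman [Finite V] (E : V → V → Prop) (hE : ∀ v, ∃ w, E v w) (col : V → ℕ) :
    ∃ f, IsRichman E col f := by
  classical
  have : ∀ v, Nonempty {w // E v w} := fun v => (hE v).elim fun w hw => ⟨⟨w, hw⟩⟩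
  have hmem : ∀ a b : unitInterval, ((a : ℝ) + b) / 2 ∈ unitInterval := fun a b =>
    ⟨by linarith [a.2.1, b.2.1], by linarith [a.2.2, b.2.2]⟩
  let F : (V → unitInterval) → V → unitInterval := fun f v =>
    if IsBottom E v then (if EvenTop E col v then 0 else 1)
    else ⟨_, hmem (⨆ w : {w // E v w}, f w) (⨅ w : {w // E v w}, f w)⟩
  have hF : Monotone F := by
    intro f g hfg v
    simp only [F]
    split_ifs
    · exact le_rfl
    · exact le_rfl
    · have h1 : (⨆ w : {w // E v w}, f w : unitInterval) ≤ ⨆ w : {w // E v w}, g w :=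
        iSup_mono fun w => hfg w
      have h2 : (⨅ w : {w // E v w}, f w : unitInterval) ≤ ⨅ w : {w // E v w}, g w :=
        iInf_mono fun w => hfg w
      have h1' := Subtype.coe_le_coe.mpr h1
      have h2' := Subtype.coe_le_coe.mpr h2
      exact Subtype.mk_le_mk.mpr (by linarith)
  -- Knaster–Tarski on the complete lattice `V → unitInterval`. Which fixed point is taken does not
  -- matter later, since `Objective.threshold_eq` holds for every Richman function.
  obtain ⟨g, hg⟩ : ∃ g, F g = g := ⟨_, OrderHom.map_lfp ⟨F, hF⟩⟩
  have hv : ∀ v, F g v = g v := fun v => by rw [hg]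
  refine ⟨fun v => g v, fun v => (g v).2.1, fun v => (g v).2.2, fun v hb he => ?_,
    fun v hb he => ?_, fun v hb => ?_⟩
  · have := hv v
    simp only [F, if_pos hb, if_pos he] at this
    simp [← this]
  · have := hv v
    simp only [F, if_pos hb, if_neg he] at this
    simp [← this]
  · obtain ⟨p, hp⟩ := Finite.exists_min fun w : {w // E v w} => g w
    obtain ⟨q, hq⟩ := Finite.exists_max fun w : {w // E v w} => g w
    refine ⟨p, q, p.2, q.2, fun w hw => ⟨hp ⟨w, hw⟩, hq ⟨w, hw⟩⟩, ?_⟩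
    have := congrArg Subtype.val (hv v)
    simp only [F, if_neg hb] at this
    rw [← this, le_antisymm (iSup_le hq) (le_iSup (fun w : {w // E v w} => g w) q),
      le_antisymm (iInf_le (fun w : {w // E v w} => g w) p) (le_iInf hp)]
    ring

end Richman

/-! ### Thresholds -/

namespace Objective

variable {V : Type*}

/-- The vertices where the objective is decided. -/
def absorb : Objective V → Set V
  | .reach S => S
  | .safe S => Sᶜ
  | .buchi _ => ∅
  | .parity _ => ∅

open Classical in
/-- The coloring of the objective. -/
noncomputable def color : Objective V → V → ℕ
  | .reach S => fun v => if v ∈ S then 2 else 1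
  | .safe S => fun v => if v ∈ S then 2 else 1
  | .buchi S => fun v => if v ∈ S then 2 else 1
  | .parity col => col

/-- The edges of the graph, with the vertices where the objective is decided made absorbing. -/
def edge (Φ : Objective V) (G : BidGraph V) : V → V → Prop := freeze G.Adj Φ.absorb

theorem exists_edge (Φ : Objective V) (G : BidGraph V) (v : V) : ∃ w, Φ.edge G v w :=
  exists_freeze G _ v

/-- The shift `k` lets the same statement serve the coloring of a Büchi objective and its dual. -/
theorem isGreatest_two_colors [Finite V] (S : Set V) [DecidablePred (· ∈ S)] (k : ℕ) (x : ℕ → V)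
    {m : ℕ} (h : IsGreatest {i | ∃ v ∈ infOften x, (if v ∈ S then 2 + k else 1 + k) = i} m) :
    ((infOften x ∩ S).Nonempty → m = 2 + k) ∧ (¬ (infOften x ∩ S).Nonempty → m = 1 + k) := by
  obtain ⟨⟨v, hv, rfl⟩, hm⟩ := h
  constructor
  · rintro ⟨u, hu, hS⟩
    have := hm ⟨u, hu, rfl⟩
    rw [if_pos hS] at this
    split_ifs at this ⊢
    · rfl
    · omega
  · intro h
    rw [if_neg fun hS => h ⟨v, hv, hS⟩]

/-- A reachability path that avoids `S` sees only the odd color `1`, so it is good only by entering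
`S`. A safety path would leave `S` at the odd color `1`, so it is good only by staying in `S`. -/
theorem mem_paths_of_goodPath [Finite V] {G : BidGraph V} (Φ : Objective V) {x : ℕ → V}
    (hx : x ∈ G.infPaths) (h : GoodPath Φ.absorb Φ.color x) : x ∈ Φ.paths G := by
  classical
  cases Φ with
  | reach S =>
    refine ⟨hx, ?_⟩
    rcases h with ⟨i, hi, -⟩ | ⟨hA, m, ⟨⟨v, hv, rfl⟩, -⟩, he⟩
    · exact ⟨i, hi⟩
    · obtain ⟨i, -, rfl⟩ := hv 0
      have := hA i
      simp only [absorb] at this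
      simp [color, this] at he
  | safe S =>
    refine ⟨hx, ?_⟩
    rcases h with ⟨i, hi, -, he⟩ | ⟨hA, -⟩
    · have : x i ∉ S := hi
      simp [color, this] at he
    · intro i
      simpa [absorb] using hA i
  | buchi S =>
    refine ⟨hx, ?_⟩
    rcases h with ⟨i, hi, -, he⟩ | ⟨hA, m, hm, he⟩
    · exact absurd hi (Set.notMem_empty _)
    · by_contra hS
      have := (isGreatest_two_colors S 0 x hm).2 hS
      subst this
      simp at he
  | parity col =>
    refine ⟨hx, ?_⟩
    rcases h with ⟨i, hi, -, he⟩ | ⟨hA, h⟩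
    · exact absurd hi (Set.notMem_empty _)
    · exact h

/-- With the colors raised by one, a good path for the opponent violates the objective. In the
parity case the greatest recurring color is unique, so it cannot be even both before and after the
shift. -/
theorem notMem_paths_of_goodPath [Finite V] {G : BidGraph V} (Φ : Objective V) {x : ℕ → V}
    (h : GoodPath Φ.absorb (fun v => Φ.color v + 1) x) : x ∉ Φ.paths G := by
  classical
  cases Φ with
  | reach S =>
    rintro ⟨-, i, hi⟩
    rcases h with ⟨j, hj, -, he⟩ | ⟨hA, -⟩
    · have : x j ∈ S := hj
      simp [color, this] at he
      exact absurd he (by decide)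
    · exact hA i hi
  | safe S =>
    rintro ⟨-, hi⟩
    rcases h with ⟨i, hj, -⟩ | ⟨hA, m, ⟨⟨v, hv, rfl⟩, -⟩, he⟩
    · exact hj (hi i)
    · obtain ⟨i, -, rfl⟩ := hv 0
      simp [color, hi i] at he
      exact absurd he (by decide)
  | buchi S =>
    rintro ⟨-, hi⟩
    rcases h with ⟨i, hi, -, he⟩ | ⟨hA, m, hm, he⟩
    · exact absurd hi (Set.notMem_empty _)
    · have hm' : IsGreatest {i | ∃ v ∈ infOften x, (if v ∈ S then 2 + 1 else 1 + 1) = i} m := by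
        convert hm using 6
        simp only [color]
        split_ifs <;> rfl
      have := (isGreatest_two_colors S 1 x hm').1 hi
      subst this
      exact absurd he (by decide)
  | parity col =>
    rintro ⟨-, m', hm', he'⟩
    rcases h with ⟨i, hi, -, he⟩ | ⟨hA, m, ⟨⟨v, hv, rfl⟩, hm⟩, he⟩
    · exact absurd hi (Set.notMem_empty _)
    · obtain ⟨⟨u, hu, rfl⟩, hum⟩ := hm'
      have h1 : col v ≤ col u := hum ⟨v, hv, rfl⟩
      have h2 : col u + 1 ≤ col v + 1 := hm ⟨u, hu, rfl⟩
      have : col u = col v := by omega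
      rw [this] at he'
      exact (Nat.even_add_one.mp he) he'

variable [Finite V] {G : BidGraph V} {Φ : Objective V} {f : V → ℝ}

/-- Some strategy wins in both roles from every budget above a Richman function. -/
theorem exists_strategy (hf : IsRichman (Φ.edge G) Φ.color f) :
    ∃ σ : Strategy G,
      (∀ (τ : Strategy G) (B : ℝ), f G.init < B → B ≤ 1 → composePath σ τ B ∈ Φ.paths G) ∧
      (∀ (τ : Strategy G) (B : ℝ), f G.init < 1 - B → 0 ≤ B → composePath τ σ B ∈ Φ.paths G) := by
  obtain ⟨P, rfl⟩ := hf.exists_potential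
  refine ⟨P.strategy, fun τ B h h1 => ?_, fun τ B h h0 => ?_⟩
  · exact Φ.mem_paths_of_goodPath (composePath_mem_infPaths _ _ _)
      (hf.goodPath_of_isPlay rfl (composePath_mem_infPaths _ _ _) (P.isPlay_first τ h h1))
  · exact Φ.mem_paths_of_goodPath (composePath_mem_infPaths _ _ _)
      (hf.goodPath_of_isPlay rfl (composePath_mem_infPaths _ _ _) (P.isPlay_second τ h h0))

/-- No strategy wins from a budget below a Richman function. -/
theorem exists_spoiler (hf : IsRichman (Φ.edge G) Φ.color f) :
    ∃ τ : Strategy G, ∀ (σ : Strategy G) (B : ℝ), B < f G.init → 0 ≤ B →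
      composePath σ τ B ∉ Φ.paths G := by
  -- The opponent owns `1 - B`, which exceeds the dual Richman value `1 - f G.init` exactly when `B
  -- < f G.init`.
  obtain ⟨P, hP⟩ := hf.dual.exists_potential
  refine ⟨P.strategy, fun σ B h h0 => ?_⟩
  refine Φ.notMem_paths_of_goodPath
    (hf.dual.goodPath_of_isPlay hP (composePath_mem_infPaths _ _ _) (P.isPlay_second σ ?_ h0))
  rw [hP]
  linarith

/-- Above `f` the player wins and below `f` it is spoiled. The budget equal to `f` is left open,
which the infimum does not notice. -/
theorem threshold_eq (hf : IsRichman (Φ.edge G) Φ.color f) : threshold G Φ G.init = f G.init := by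
  unfold threshold
  have hbdd : BddBelow (insert 1 {B : ℝ | 0 ≤ B ∧ B ≤ 1 ∧ WinsFrom G Φ G.init B}) := by
    refine ⟨0, ?_⟩
    rintro B (rfl | hB)
    · exact zero_le_one
    · exact hB.1
  apply le_antisymm
  · refine le_of_forall_gt_imp_ge_of_dense fun B hB => ?_
    rcases le_or_gt B 1 with h1 | h1
    · obtain ⟨σ, hσ, -⟩ := exists_strategy hf
      -- `G.startAt G.init` is `G` by definitional unfolding, so strategies of `G` can be used as
      -- they are.
      exact csInf_le hbdd (Or.inr ⟨(hf.nonneg _).trans hB.le, h1, σ, fun τ => hσ τ B hB h1⟩)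
    · exact (csInf_le hbdd (Or.inl rfl)).trans h1.le
  · refine le_csInf ⟨1, Or.inl rfl⟩ ?_
    rintro B (rfl | ⟨h0, -, σ, hσ⟩)
    · exact hf.le_one _
    · by_contra! hlt
      obtain ⟨τ, hτ⟩ := exists_spoiler hf
      exact hτ σ B hlt h0 (hσ τ)

end Objective

/-! ### Robust tenders and thresholds -/

section Robust

variable {V : Type*} {G : BidGraph V} {Φ₁ Φ₂ : Objective V} {f₁ f₂ : V → ℝ}

/-- An arbitrary opposing strategy, made a tender with threshold budget `0`, is compatible with `t`
and admits every initial budget strictly between `t.budget` and `1`. So the strategy of `t` wins the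
bidding game from all these budgets. -/
theorem RobustFirst.threshold_le {t : Tender G} {Φ : Objective V} (ht : RobustFirst t (Φ.paths G))
    (h1 : t.budget < 1) : threshold G Φ G.init ≤ t.budget := by
  refine le_of_forall_gt_imp_ge_of_dense fun B hB => ?_
  rcases lt_or_ge B 1 with hB1 | hB1
  · refine csInf_le ⟨0, ?_⟩ (Or.inr ⟨t.budget_nonneg.trans hB.le, hB1.le, t.toStrategy, fun τ => ?_⟩)
    · rintro B (rfl | hB)
      · exact zero_le_one
      · exact hB.1
    · exact ht ⟨τ, 0, le_rfl, zero_le_one⟩ (by simpa [Compatible] using h1) B hB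
        (by simpa using hB1)
  · refine le_trans (csInf_le (a := 1) ⟨0, ?_⟩ (Or.inl rfl)) hB1
    rintro B (rfl | hB)
    · exact zero_le_one
    · exact hB.1

/-- The threshold is defined for the first role only. By `exists_composePath_swap` each play of the
strategy of `t` in the first role also arises in the second role, so `t` is robust as a first tender
as well. -/
theorem RobustSecond.threshold_le {t : Tender G} {Φ : Objective V}
    (ht : RobustSecond t (Φ.paths G)) (h1 : t.budget < 1) :
    threshold G Φ G.init ≤ t.budget := by
  refine RobustFirst.threshold_le (fun t₂ hc B hB hB' => ?_) h1
  have hB0 := t.budget_nonneg.trans hB.le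
  have hB1 : B < 1 := by linarith [t₂.budget_nonneg]
  obtain ⟨τ', h⟩ := exists_composePath_swap t.toStrategy t₂.toStrategy hB0 hB1.le
  rw [← h]
  exact ht ⟨τ', 0, le_rfl, zero_le_one⟩ (by simpa [Compatible] using h1) (1 - B)
    (by simpa using hB1) (by simpa using hB)

/-- Compatibility leaves room for an admissible budget, and composing the two tenders from it gives
a path in both objectives. A decision procedure therefore need not test for overlap. -/
theorem HasRobustPair.overlapping (h : HasRobustPair G Φ₁ Φ₂) : Overlapping G Φ₁ Φ₂ := by
  obtain ⟨t₁, t₂, hc, h₁, h₂⟩ := h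
  have hc' : t₁.budget + t₂.budget < 1 := hc
  obtain ⟨B, hB, hB'⟩ := exists_between (show t₁.budget < 1 - t₂.budget by linarith)
  exact ⟨_, h₁ t₂ hc B hB (by linarith), h₂ t₁ hc B hB (by linarith)⟩

variable [Finite V]

theorem hasRobustPair_of_lt (h₁ : IsRichman (Φ₁.edge G) Φ₁.color f₁)
    (h₂ : IsRichman (Φ₂.edge G) Φ₂.color f₂) (h : f₁ G.init + f₂ G.init < 1) :
    HasRobustPair G Φ₁ Φ₂ := by
  obtain ⟨σ₁, hσ₁, -⟩ := Objective.exists_strategy h₁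
  obtain ⟨σ₂, -, hσ₂⟩ := Objective.exists_strategy h₂
  refine ⟨⟨σ₁, f₁ G.init, h₁.nonneg _, h₁.le_one _⟩, ⟨σ₂, f₂ G.init, h₂.nonneg _, h₂.le_one _⟩, h,
    fun t₂ _ B hB hB' => ?_, fun t₁ _ B hB hB' => ?_⟩
  · exact hσ₁ _ B hB (by linarith [t₂.budget_nonneg])
  · exact hσ₂ _ B hB' (t₁.budget_nonneg.trans hB.le)

theorem hasRobustPair_iff (G : BidGraph V) (Φ₁ Φ₂ : Objective V) :
    HasRobustPair G Φ₁ Φ₂ ↔ threshold G Φ₁ G.init + threshold G Φ₂ G.init < 1 := by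
  constructor
  · rintro ⟨t₁, t₂, hc, h₁, h₂⟩
    have hc' : t₁.budget + t₂.budget < 1 := hc
    have := h₁.threshold_le (by linarith [t₂.budget_nonneg])
    have := h₂.threshold_le (by linarith [t₁.budget_nonneg])
    linarith
  · intro h
    obtain ⟨f₁, h₁⟩ := exists_isRichman (Φ₁.edge G) (Φ₁.exists_edge G) Φ₁.color
    obtain ⟨f₂, h₂⟩ := exists_isRichman (Φ₂.edge G) (Φ₂.exists_edge G) Φ₂.color
    rw [Objective.threshold_eq h₁, Objective.threshold_eq h₂] at h
    exact hasRobustPair_of_lt h₁ h₂ h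

/-- Any pair of Richman functions decides the question, so a certificate only has to be checked
against the local conditions of `IsRichman`. -/
theorem hasRobustPair_iff_of_isRichman (h₁ : IsRichman (Φ₁.edge G) Φ₁.color f₁)
    (h₂ : IsRichman (Φ₂.edge G) Φ₂.color f₂) :
    HasRobustPair G Φ₁ Φ₂ ↔ f₁ G.init + f₂ G.init < 1 := by
  rw [hasRobustPair_iff, Objective.threshold_eq h₁, Objective.threshold_eq h₂]

end Robust

/-! ### Denominators -/

section Denominators

variable {V : Type*} [Fintype V] [DecidableEq V]

/-- The values of a Richman function have a common denominator of moderate size. -/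
theorem IsRichman.exists_denominator {E : V → V → Prop} {col : V → ℕ} {f : V → ℝ}
    (hE : ∀ v, ∃ w, E v w) (hf : IsRichman E col f) :
    ∃ (D : ℕ) (N : V → ℕ), 0 < D ∧ D ≤ (Fintype.card V).factorial * 2 ^ Fintype.card V ∧
      ∀ v, (D : ℝ) * f v = N v := by
  classical
  obtain ⟨p, q, r, h⟩ := hf.exists_move hE
  -- Once the extreme successors `p` and `q` are fixed, the conditions on `f` form a linear system
  -- `M f = b` with integer coefficients.
  let M : Matrix V V ℤ := Matrix.of fun v w =>
    if IsBottom E v then (if w = v then 1 else 0)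
    else (if w = v then 2 else 0) - (if w = p v then 1 else 0) - (if w = q v then 1 else 0)
  let b : V → ℤ := fun v => if IsBottom E v then (if EvenTop E col v then 0 else 1) else 0
  have hmul : ∀ (x : V → ℝ) v, (M.map (Int.cast : ℤ → ℝ)).mulVec x v =
      if IsBottom E v then x v else 2 * x v - x (p v) - x (q v) := by
    intro x v
    by_cases hv : IsBottom E v <;>
      simp [M, Matrix.mulVec, dotProduct, hv, sub_mul, Finset.sum_sub_distrib]
  have hMf : (M.map (Int.cast : ℤ → ℝ)).mulVec f = fun v => (b v : ℝ) := by
    funext v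
    rw [hmul]
    by_cases hv : IsBottom E v
    · by_cases he : EvenTop E col v
      · simp [b, hv, he, hf.bottom_even v hv he]
      · simp [b, hv, he, hf.bottom_odd v hv he]
    · simp only [b, hv, if_false]
      have := (h v).2.2.2.1
      push_cast
      linarith
  -- A maximum principle: at a positive maximum of a kernel vector, taken of least rank, the mean
  -- property moves the maximum to `p u`, which has smaller rank. At bottom vertices the vector
  -- vanishes. Applied to `x` and `-x` it shows that the kernel is trivial.
  have hker : ∀ x : V → ℝ, (M.map (Int.cast : ℤ → ℝ)).mulVec x = 0 → ∀ v, x v ≤ 0 := by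
    intro x hx v
    have hx' := fun v => (hmul x v).symm.trans (congrFun hx v)
    simp only [Pi.zero_apply] at hx'
    by_contra! hpos
    have : Nonempty V := ⟨v⟩
    obtain ⟨m, hm⟩ := Finite.exists_max x
    obtain ⟨u, hu, hur⟩ := Set.exists_min_image {u | x u = x m} r (Set.toFinite _) ⟨m, rfl⟩
    have hu' : x u = x m := hu
    have hmpos : 0 < x m := hpos.trans_le (hm v)
    have h1 := hx' u
    by_cases hb : IsBottom E u
    · rw [if_pos hb] at h1
      linarith
    · rw [if_neg hb] at h1
      have h2 := hm (p u)
      have h3 := hm (q u)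
      have h4 := hur (p u) (show x (p u) = x m by linarith)
      have h5 := (h u).2.2.2.2 fun ht => hb ht.1
      omega
  have hdet : M.det ≠ 0 := by
    intro h0
    have h0' : (M.map (Int.cast : ℤ → ℝ)).det = 0 := by
      have := (Int.castRingHom ℝ).map_det M
      rw [h0] at this
      simpa using this.symm
    obtain ⟨x, hx0, hx⟩ := Matrix.exists_mulVec_eq_zero_iff.mpr h0'
    refine hx0 (funext fun v => le_antisymm (hker x hx v) ?_)
    have := hker (-x) (by rw [Matrix.mulVec_neg, hx, neg_zero]) v
    simpa using this
  have hcr : ∀ v, (M.det : ℝ) * f v = (M.adjugate.mulVec b v : ℤ) := by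
    intro v
    have h1 : (M.adjugate.map (Int.cast : ℤ → ℝ)) * (M.map (Int.cast : ℤ → ℝ)) =
        (M.det : ℝ) • (1 : Matrix V V ℝ) := by
      have := congrArg (fun A : Matrix V V ℤ => A.map (Int.castRingHom ℝ)) M.adjugate_mul
      simp only [Matrix.map_mul] at this
      refine this.trans ?_
      ext i j
      simp only [Matrix.map_apply, Matrix.smul_apply, Matrix.one_apply, smul_eq_mul, eq_intCast]
      split_ifs <;> simp
    have h2 := congrFun (congrArg (fun A : Matrix V V ℝ => A.mulVec f) h1) v
    simp only [← Matrix.mulVec_mulVec, hMf, Matrix.smul_mulVec, Matrix.one_mulVec,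
      Pi.smul_apply, smul_eq_mul] at h2
    rw [← h2]
    simp [Matrix.mulVec, dotProduct]
  refine ⟨M.det.natAbs, fun v => (M.adjugate.mulVec b v).natAbs, Int.natAbs_pos.mpr hdet, ?_,
    fun v => ?_⟩
  -- All entries of `M` have absolute value at most `2`, and the determinant is a sum of `n!` signed
  -- products of `n` entries.
  · have := Matrix.det_le (A := M) (abv := AbsoluteValue.abs) (x := 2) (fun i j => by
      simp only [AbsoluteValue.abs_apply, M, Matrix.of_apply]
      split_ifs <;> simp)
    simp only [AbsoluteValue.abs_apply, nsmul_eq_mul] at this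
    zify
    exact_mod_cast this
  · have := congrArg (fun x : ℝ => |x|) (hcr v)
    simp only [abs_mul, abs_of_nonneg (hf.nonneg v)] at this
    rw [Nat.cast_natAbs, Nat.cast_natAbs, Int.cast_abs, Int.cast_abs]
    exact this

end Denominators

/-! ### A language of comprehensions

Expressions are built from arithmetic, array access and sums over the indices below a fixed dimension;
statements tabulate expressions, and iterate. They compile to programs that run in polynomial time,
because the entries of the tables are cut off at a fixed number. -/

namespace RAM

/-- Expressions. -/
inductive Expr where
  | const (c : ℕ)
  | var (x : ℕ)
  | dim
  | cap
  | len
  | get (a : Fin 7) (e : Expr)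
  | op (o : Op) (e₁ e₂ : Expr)
  | sum (x : ℕ) (e : Expr)

/-- The data that expressions and statements refer to. -/
structure State where
  dim : ℕ
  cap : ℕ
  len : ℕ
  arr : Fin 7 → ℕ → ℕ

/-- The value of an expression in an environment. -/
def Expr.eval (st : State) : Expr → (ℕ → ℕ) → ℕ
  | .const c, _ => c
  | .var x, env => env x
  | .dim, _ => st.dim
  | .cap, _ => st.cap
  | .len, _ => st.len
  | .get a e, env => st.arr a (e.eval st env)
  | .op o e₁ e₂, env => o.eval (e₁.eval st env) (e₂.eval st env)
  | .sum x e, env => ∑ j ∈ Finset.range st.dim, e.eval st (Function.update env x j)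

/-- The number of registers that the evaluation of an expression uses. -/
def Expr.height : Expr → ℕ
  | .const _ => 1
  | .var _ => 1
  | .dim => 1
  | .cap => 1
  | .len => 1
  | .get _ e => e.height + 2
  | .op _ e₁ e₂ => e₁.height + e₂.height + 1
  | .sum _ e => e.height + 3

/-- `M[r] := M[s]`, provided that `M[0] = 0`. -/
def copy (r s : ℕ) : Prog := .arith .add r s 0

/-- The sequence of several programs. -/
def block : List Prog → Prog → Prog
  | [], q => q
  | p :: l, q => .seq p (block l q)

/-- Replaces the index in register `r` by the entry of the array `a`, using register `r + 1`. -/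
def fetch (r a : ℕ) : Prog :=
  -- The seven arrays are interleaved with stride `8` from the address in register `4` on. The
  -- residue `7` is left as scratch space for tabulations.
  block [.const (r + 1) 8, .arith .mul r r (r + 1), .const (r + 1) a, .arith .add r r (r + 1),
    .arith .add r r 4] (.load r r)

/-- The program that stores the value of an expression in register `r`; the variables are held in the
registers given by `ρ`. -/
def Expr.compile : Expr → (ℕ → ℕ) → ℕ → Prog
  | .const c, _, r => .const r c
  | .var x, ρ, r => copy r (ρ x)
  | .len, _, r => copy r 1
  | .dim, _, r => copy r 2
  | .cap, _, r => copy r 3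
  | .get a e, ρ, r => .seq (e.compile ρ r) (fetch r a)
  | .op o e₁ e₂, ρ, r => block [e₁.compile ρ r, e₂.compile ρ (r + 1)] (.arith o r r (r + 1))
  | .sum x e, ρ, r =>
      -- The loop counter itself is the register of the summation variable. It is decremented before
      -- the summand is evaluated, so it takes the values `dim - 1, …, 0`.
      block [.const r 0, copy (r + 1) 2]
        (.loop (r + 1)
          (block [.const (r + 2) 1, .arith .sub (r + 1) (r + 1) (r + 2),
            e.compile (Function.update ρ x (r + 1)) (r + 2)] (.arith .add r r (r + 2))))

/-- Statements. -/
inductive Stmt where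
  | tab (a : Fin 7) (e : Expr)
  | seq (s₁ s₂ : Stmt)
  | rep (s : Stmt)

/-- The environment with the values `i` and `j` of the variables `0` and `1`. -/
def env₂ (i j : ℕ) : ℕ → ℕ := Function.update (Function.update (fun _ => 0) 0 i) 1 j

/-- The effect of a statement. -/
def Stmt.run : Stmt → State → State
  | .tab a e, st =>
    { st with
      arr := Function.update st.arr a fun k =>
        if k < st.dim * st.dim then min (e.eval st (env₂ (k / st.dim) (k % st.dim))) st.cap
        else st.arr a k }
  | .seq s₁ s₂, st => s₂.run (s₁.run st)
  | .rep s, st => s.run^[st.dim] st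

/-- The number of registers that a statement uses. -/
def Stmt.height : Stmt → ℕ
  | .tab _ e => e.height + 6
  | .seq s₁ s₂ => s₁.height + s₂.height
  | .rep s => s.height + 2

/-- The program of a statement, with free registers from `r` on. -/
def Stmt.compile : Stmt → ℕ → Prog
  | .tab a e, r =>
      -- The expression may read the array that is being overwritten. Hence the entries first go to
      -- the scratch residue `7`, and a second loop copies them.
      block [.arith .mul r 2 2,
        .loop r (block [.const (r + 1) 1, .arith .sub r r (r + 1), .arith .div (r + 1) r 2,
          .arith .mul (r + 2) (r + 1) 2, .arith .sub (r + 2) r (r + 2),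
          e.compile (Function.update (Function.update (fun _ => 0) 0 (r + 1)) 1 (r + 2)) (r + 3),
          -- With truncated subtraction, `cap - (cap - x)` is the minimum of `x` and `cap`.
          .arith .sub (r + 4) 3 (r + 3), .arith .sub (r + 3) 3 (r + 4),
          .const (r + 5) 8, .arith .mul (r + 4) r (r + 5), .const (r + 5) 7,
          .arith .add (r + 4) (r + 4) (r + 5), .arith .add (r + 4) (r + 4) 4]
          (.store (r + 4) (r + 3))),
        .arith .mul r 2 2]
        (.loop r (block [.const (r + 1) 1, .arith .sub r r (r + 1),
          .const (r + 1) 8, .arith .mul (r + 1) r (r + 1), .arith .add (r + 1) (r + 1) 4,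
          .const (r + 2) 7, .arith .add (r + 2) (r + 1) (r + 2), .load (r + 2) (r + 2),
          .const (r + 3) a, .arith .add (r + 3) (r + 1) (r + 3)] (.store (r + 3) (r + 2))))
  | .seq s₁ s₂, r => .seq (s₁.compile r) (s₂.compile r)
  | .rep s, r =>
      .seq (copy r 2)
        (.loop r (block [.const (r + 1) 1, .arith .sub r r (r + 1)] (s.compile (r + 1))))

/-! ### Correctness of the compilation -/

/-- The memory `M` represents the state `st`, with the arrays interleaved from address `b` on. -/
structure Holds (b : ℕ) (M : Mem) (st : State) : Prop where
  zero : M 0 = 0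
  len : M 1 = st.len
  dim : M 2 = st.dim
  cap : M 3 = st.cap
  base : M 4 = b
  arr : ∀ (a : Fin 7) (i : ℕ), M (b + 8 * i + a) = st.arr a i

/-- The numbers of a state have at most `β` bits. -/
structure Fits (β b : ℕ) (st : State) : Prop where
  four_le : 4 ≤ β
  len : st.len.size ≤ β
  dim : st.dim.size ≤ β
  cap : st.cap.size ≤ β
  base : b.size ≤ β
  arr : ∀ a i, (st.arr a i).size ≤ β

theorem size_add_le (x y : ℕ) : (x + y).size ≤ x.size + y.size + 1 := by
  rw [Nat.size_le, pow_succ, pow_add]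
  have hx := Nat.lt_size_self x
  have hy := Nat.lt_size_self y
  have h1 : 2 ^ x.size ≤ 2 ^ x.size * 2 ^ y.size := Nat.le_mul_of_pos_right _ (by positivity)
  have h2 : 2 ^ y.size ≤ 2 ^ x.size * 2 ^ y.size := Nat.le_mul_of_pos_left _ (by positivity)
  omega

theorem size_mul_le (x y : ℕ) : (x * y).size ≤ x.size + y.size := by
  rw [Nat.size_le, pow_add]
  exact Nat.mul_lt_mul'' (Nat.lt_size_self x) (Nat.lt_size_self y)

theorem Op.size_eval_le (o : Op) (x y : ℕ) : (o.eval x y).size ≤ x.size + y.size + 1 := by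
  cases o with
  | add => exact size_add_le x y
  | sub => exact (Nat.size_le_size (Nat.sub_le x y)).trans (by omega)
  | mul => exact (size_mul_le x y).trans (by omega)
  | div => exact (Nat.size_le_size (Nat.div_le_self x y)).trans (by omega)

theorem size_sum_le {d s : ℕ} {g : ℕ → ℕ} (h : ∀ j < d, (g j).size ≤ s) :
    (∑ j ∈ Finset.range d, g j).size ≤ d.size + s := by
  have h1 : ∑ j ∈ Finset.range d, g j ≤ d * (2 ^ s - 1) := by
    calc ∑ j ∈ Finset.range d, g j ≤ ∑ _j ∈ Finset.range d, (2 ^ s - 1) :=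
          Finset.sum_le_sum fun j hj => by
            have := Nat.size_le.mp (h j (Finset.mem_range.mp hj))
            omega
      _ = _ := by simp
  refine (Nat.size_le_size h1).trans ((size_mul_le _ _).trans ?_)
  gcongr
  rw [Nat.size_le]
  have : 0 < 2 ^ s := by positivity
  omega

/-- A counting loop with invariant `I`. -/
theorem exec_for {c : ℕ} {p : Prog} {I : ℕ → Mem → Prop} {C β : ℕ} (hI : ∀ j M, I j M → M c = j)
    (hp : ∀ j M, I (j + 1) M → ∃ t M', Exec p M t M' ∧ t ≤ C ∧ I j M') (j : ℕ) (M : Mem)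
    (h : I j M) (hj : j.size ≤ β) :
    ∃ t M', Exec (.loop c p) M t M' ∧ I 0 M' ∧ t ≤ j * (C + 1 + β) + 1 := by
  induction j generalizing M with
  | zero => exact ⟨1, M, .loop_false (hI 0 M h), h, by omega⟩
  | succ j ih =>
    obtain ⟨t, M', he, ht, h'⟩ := hp j M h
    obtain ⟨t', M'', he', h'', ht'⟩ := ih M' h' ((Nat.size_le_size (Nat.le_succ j)).trans hj)
    have hc := hI _ _ h
    refine ⟨_, M'', .loop_true (by omega) he he', h'', ?_⟩
    rw [hc, Nat.succ_mul]
    omega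

theorem exec_fetch {r a : ℕ} {M : Mem} (hr : 5 ≤ r) (hb : r + 2 ≤ M 4) :
    ∃ t M', Exec (fetch r a) M t M' ∧ M' r = M (M 4 + 8 * M r + a) ∧
      (∀ x, x ≠ r → x ≠ r + 1 → M' x = M x) ∧
      t ≤ 60 + 10 * (M r).size + 10 * a.size + 3 * (M 4).size +
        (M (M 4 + 8 * M r + a)).size := by
  have e4 : 4 ≠ r := by omega
  have e4' : 4 ≠ r + 1 := by omega
  have e8 : Nat.size 8 = 4 := by simp [Nat.size, Nat.binaryRec]
  have hs1 := size_mul_le (M r) 8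
  have hs2 := size_add_le (M r * 8) a
  have hs3 := size_add_le (M r * 8 + a) (M 4)
  have hne : M r * 8 + a + M 4 ≠ r := by omega
  have hne' : M r * 8 + a + M 4 ≠ r + 1 := by omega
  have hadd : M 4 + 8 * M r + a = M r * 8 + a + M 4 := by ring
  refine ⟨_, _, .seq (.const _ _ _) (.seq (.arith _ _ _ _ _) (.seq (.const _ _ _)
    (.seq (.arith _ _ _ _ _) (.seq (.arith _ _ _ _ _) (.load _ _ _))))), ?_, ?_, ?_⟩
  · simp [Op.eval, e4, e4', hne, hne', hadd]
  · intro x h1 h2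
    simp [Op.eval, h1, h2]
  · simp only [Op.eval, Function.update_self, ne_eq, Nat.left_eq_add, Nat.succ_ne_zero,
      not_false_eq_true, Function.update_of_ne, e4, e4', hne, hne', hadd]
    omega

/-- All costs are kept in the shape `K * β * D ^ k`. Adding the exponents is wasteful, but makes
this shape closed under sums without comparing exponents. -/
theorem bound_add {a b K₁ K₂ β D k₁ k₂ : ℕ} (hD : 1 ≤ D) (ha : a ≤ K₁ * β * D ^ k₁)
    (hb : b ≤ K₂ * β * D ^ k₂) : a + b ≤ (K₁ + K₂) * β * D ^ (k₁ + k₂) := by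
  have h1 : D ^ k₁ ≤ D ^ (k₁ + k₂) := Nat.pow_le_pow_right hD (by omega)
  have h2 : D ^ k₂ ≤ D ^ (k₁ + k₂) := Nat.pow_le_pow_right hD (by omega)
  calc a + b ≤ K₁ * β * D ^ (k₁ + k₂) + K₂ * β * D ^ (k₁ + k₂) :=
        add_le_add (ha.trans (Nat.mul_le_mul_left _ h1)) (hb.trans (Nat.mul_le_mul_left _ h2))
    _ = _ := by ring

/-- The constants depend on the expression alone. An operation adds at most the bit lengths of its
arguments plus one, and a sum adds the bit length of `dim`, so values have length linear in `β`.
Each sum raises the degree of the cost in `dim` by one. -/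
theorem Expr.exec_compile (e : Expr) : ∃ K k, ∀ (β b : ℕ) (st : State) (M : Mem) (ρ env : ℕ → ℕ)
    (r : ℕ), 5 ≤ r → r + e.height ≤ b → Holds b M st → Fits β b st →
    (∀ x, M (ρ x) = env x ∧ ρ x < r ∧ (env x).size ≤ β) →
    (e.eval st env).size ≤ K * β ∧ ∃ t M', Exec (e.compile ρ r) M t M' ∧ M' r = e.eval st env ∧
      (∀ x, x < r ∨ r + e.height ≤ x → M' x = M x) ∧ t ≤ K * β * (st.dim + 1) ^ k := by
  have hcopy : ∀ (β r s v : ℕ) (M : Mem), M 0 = 0 → M s = v → v.size ≤ β → 4 ≤ β →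
      ∃ t M', Exec (copy r s) M t M' ∧ M' r = v ∧ (∀ x, x < r ∨ r + 1 ≤ x → M' x = M x) ∧
        t ≤ 2 * β := by
    intro β r s v M h0 hs hv hβ
    refine ⟨_, _, .arith _ _ _ _ _, ?_, fun x hx => ?_, ?_⟩
    · simp [Op.eval, h0, hs]
    · rw [Function.update_of_ne (by omega)]
    · rw [h0, hs]; simp; omega
  induction e with
  | const c =>
    refine ⟨c.size + 1, 0, fun β b st M ρ env r hr hb hM hF hρ => ⟨?_, 1, _, .const _ _ _, ?_, ?_, ?_⟩⟩
    · have := hF.four_le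
      simp only [Expr.eval]
      nlinarith
    · simp [Expr.eval]
    · intro x hx
      simp only [Expr.height] at hx
      rw [Function.update_of_ne (by omega)]
    · have := hF.four_le
      nlinarith
  | var x =>
    refine ⟨2, 0, fun β b st M ρ env r hr hb hM hF hρ => ⟨?_, ?_⟩⟩
    · simp only [Expr.eval]
      linarith [(hρ x).2.2]
    · simpa [Expr.eval, Expr.height, Expr.compile] using
        hcopy β r (ρ x) (env x) M hM.zero (hρ x).1 (hρ x).2.2 hF.four_le
  | dim =>
    refine ⟨2, 0, fun β b st M ρ env r hr hb hM hF hρ => ⟨?_, ?_⟩⟩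
    · simp only [Expr.eval]
      linarith [hF.dim]
    · simpa [Expr.eval, Expr.height, Expr.compile] using
        hcopy β r _ _ M hM.zero hM.dim hF.dim hF.four_le
  | cap =>
    refine ⟨2, 0, fun β b st M ρ env r hr hb hM hF hρ => ⟨?_, ?_⟩⟩
    · simp only [Expr.eval]
      linarith [hF.cap]
    · simpa [Expr.eval, Expr.height, Expr.compile] using
        hcopy β r _ _ M hM.zero hM.cap hF.cap hF.four_le
  | len =>
    refine ⟨2, 0, fun β b st M ρ env r hr hb hM hF hρ => ⟨?_, ?_⟩⟩
    · simp only [Expr.eval]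
      linarith [hF.len]
    · simpa [Expr.eval, Expr.height, Expr.compile] using
        hcopy β r _ _ M hM.zero hM.len hF.len hF.four_le
  | get a e ih =>
    obtain ⟨K, k, ih⟩ := ih
    refine ⟨K + (60 + 10 * K), k + 0, fun β b st M ρ env r hr hb hM hF hρ => ?_⟩
    simp only [Expr.height] at hb
    obtain ⟨hs, t, M₁, he, hv, hfr, ht⟩ := ih β b st M ρ env r hr (by omega) hM hF hρ
    have h4 : M₁ 4 = b := (hfr 4 (by omega)).trans hM.base
    have hval : M₁ (M₁ 4 + 8 * M₁ r + a) = st.arr a (e.eval st env) := by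
      rw [h4, hv, hfr _ (by omega), hM.arr]
    obtain ⟨t', M₂, he', hv', hfr', ht'⟩ := exec_fetch (r := r) (a := a) (M := M₁) hr (by omega)
    rw [hval] at hv' ht'
    rw [hv, h4] at ht'
    have hβ := hF.four_le
    refine ⟨?_, t + t', M₂, .seq he he', hv', fun x hx => ?_, ?_⟩
    · simp only [Expr.eval]
      have := hF.arr a (e.eval st env)
      nlinarith
    · simp only [Expr.height] at hx
      rw [hfr' x (by omega) (by omega), hfr x (by omega)]
    · refine bound_add (by omega) ht ?_
      have h1 := hF.arr a (e.eval st env)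
      have h2 := hF.base
      have h3 : (a : ℕ).size ≤ 3 := by
        rw [Nat.size_le]
        have := a.2
        omega
      rw [pow_zero, mul_one]
      nlinarith
  | op o e₁ e₂ ih₁ ih₂ =>
    obtain ⟨K₁, k₁, ih₁⟩ := ih₁
    obtain ⟨K₂, k₂, ih₂⟩ := ih₂
    refine ⟨K₁ + (K₂ + (K₁ + K₂ + 1)), k₁ + (k₂ + 0), fun β b st M ρ env r hr hb hM hF hρ => ?_⟩
    simp only [Expr.height] at hb
    obtain ⟨hs₁, t₁, M₁, he₁, hv₁, hfr₁, ht₁⟩ := ih₁ β b st M ρ env r hr (by omega) hM hF hρ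
    have hM₁ : Holds b M₁ st :=
      ⟨(hfr₁ 0 (by omega)).trans hM.zero, (hfr₁ 1 (by omega)).trans hM.len,
        (hfr₁ 2 (by omega)).trans hM.dim, (hfr₁ 3 (by omega)).trans hM.cap,
        (hfr₁ 4 (by omega)).trans hM.base, fun a i => (hfr₁ _ (by omega)).trans (hM.arr a i)⟩
    obtain ⟨hs₂, t₂, M₂, he₂, hv₂, hfr₂, ht₂⟩ := ih₂ β b st M₁ ρ env (r + 1) (by omega)
      (by omega) hM₁ hF fun x => ⟨(hfr₁ _ (.inl (hρ x).2.1)).trans (hρ x).1,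
        (hρ x).2.1.trans (by omega), (hρ x).2.2⟩
    have hr₂ : M₂ r = e₁.eval st env := (hfr₂ r (by omega)).trans hv₁
    have hβ := hF.four_le
    have hso := o.size_eval_le (e₁.eval st env) (e₂.eval st env)
    refine ⟨?_, _, _, .seq he₁ (.seq he₂ (.arith _ _ _ _ _)), ?_, fun x hx => ?_, ?_⟩
    · simp only [Expr.eval]
      nlinarith
    · simp [Expr.eval, hr₂, hv₂]
    · simp only [Expr.height] at hx
      rw [Function.update_of_ne (by omega), hfr₂ x (by omega), hfr₁ x (by omega)]
    · refine bound_add (by omega) ht₁ (bound_add (by omega) ht₂ ?_)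
      rw [hr₂, hv₂, pow_zero, mul_one]
      nlinarith
  | sum x e ih =>
    obtain ⟨K, k, ih⟩ := ih
    refine ⟨3 * K + 20, k + 1, fun β b st M ρ env r hr hb hM hF hρ => ?_⟩
    simp only [Expr.height] at hb
    have hβ := hF.four_le
    set g : ℕ → ℕ := fun j => e.eval st (Function.update env x j) with hg
    set d := st.dim with hd
    -- The accumulator is described additively, together with the summands still to come, which
    -- avoids truncated subtraction.
    let I : ℕ → Mem → Prop := fun j M' => j ≤ d ∧ M' (r + 1) = j ∧
      M' r + ∑ i ∈ Finset.range j, g i = ∑ i ∈ Finset.range d, g i ∧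
      ∀ x, x < r ∨ r + (e.height + 3) ≤ x → M' x = M x
    have hsize : ∀ j < d, j.size ≤ β := fun j hj => (Nat.size_le_size hj.le).trans hF.dim
    have hbody : ∀ j M₁, j < d → Holds b M₁ st → M₁ (r + 1) = j →
        (∀ x, x < r → M₁ x = M x) → (g j).size ≤ K * β ∧ ∃ t M₂,
        Exec (e.compile (Function.update ρ x (r + 1)) (r + 2)) M₁ t M₂ ∧ M₂ (r + 2) = g j ∧
        (∀ x, x < r + 2 ∨ r + 2 + e.height ≤ x → M₂ x = M₁ x) ∧
        t ≤ K * β * (d + 1) ^ k := by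
      intro j M₁ hj hM₁ hj₁ hfr
      refine ih β b st M₁ _ _ (r + 2) (by omega) (by omega) hM₁ hF fun y => ?_
      by_cases hy : y = x
      · subst hy
        simpa [hj₁] using hsize j hj
      · simp only [Function.update_of_ne hy]
        exact ⟨(hfr _ (hρ y).2.1).trans (hρ y).1, (hρ y).2.1.trans (by omega), (hρ y).2.2⟩
    -- The induction hypothesis bounds a value only in the presence of a memory holding the
    -- environment, so a memory with `j` in the loop register is made up for this purpose.
    have hgsize : ∀ j < d, (g j).size ≤ K * β := by
      intro j hj
      refine (hbody j (Function.update M (r + 1) j) hj ?_ (by simp) fun x hx => ?_).1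
      · refine ⟨?_, ?_, ?_, ?_, ?_, fun a i => ?_⟩ <;> rw [Function.update_of_ne (by omega)]
        exacts [hM.zero, hM.len, hM.dim, hM.cap, hM.base, hM.arr a i]
      · rw [Function.update_of_ne (by omega)]
    have hS := size_sum_le hgsize
    have hS' : (∑ i ∈ Finset.range d, g i).size ≤ β + K * β := hS.trans (by
      have := hF.dim
      rw [← hd] at this
      omega)
    have hstep : ∀ j M', I (j + 1) M' → ∃ t M'', Exec (block [.const (r + 2) 1,
        .arith .sub (r + 1) (r + 1) (r + 2), e.compile (Function.update ρ x (r + 1)) (r + 2)]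
        (.arith .add r r (r + 2))) M' t M'' ∧ t ≤ K * β * (d + 1) ^ k + (2 * K + 5) * β ∧
        I j M'' := by
      rintro j M' ⟨hjd, hj, hsum, hfr⟩
      set M₁ := Function.update (Function.update M' (r + 2) 1) (r + 1) j with hM₁
      have hfr₁ : ∀ x, x < r ∨ r + (e.height + 3) ≤ x → M₁ x = M x := by
        intro x hx
        rw [hM₁, Function.update_of_ne (by omega), Function.update_of_ne (by omega), hfr x hx]
      have hH : Holds b M₁ st :=
        ⟨(hfr₁ 0 (by omega)).trans hM.zero, (hfr₁ 1 (by omega)).trans hM.len,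
          (hfr₁ 2 (by omega)).trans hM.dim, (hfr₁ 3 (by omega)).trans hM.cap,
          (hfr₁ 4 (by omega)).trans hM.base, fun a i => (hfr₁ _ (by omega)).trans (hM.arr a i)⟩
      obtain ⟨hsz, t, M₂, he, hv, hfr₂, ht⟩ := hbody j M₁ (by omega) hH (by simp [hM₁])
        fun x hx => hfr₁ x (.inl hx)
      have eb : Exec (.arith .sub (r + 1) (r + 1) (r + 2)) (Function.update M' (r + 2) 1)
          (1 + (j + 1).size + 1) M₁ := by
        convert Exec.arith .sub (r + 1) (r + 1) (r + 2) (Function.update M' (r + 2) 1) using 2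
        · simp [hj]
        · simp
        · simp [Op.eval, hj]
      have hr₂ : M₂ r = M' r := by
        rw [hfr₂ r (by omega), hM₁, Function.update_of_ne (by omega),
          Function.update_of_ne (by omega)]
      refine ⟨_, _, .seq (.const _ _ _) (.seq eb (.seq he (.arith _ _ _ _ _))), ?_, ?_, ?_, ?_, ?_⟩
      · rw [hr₂, hv]
        have h1 : (M' r).size ≤ β + K * β := (Nat.size_le_size (by omega)).trans hS'
        have h2 : (j + 1).size ≤ β := (Nat.size_le_size hjd).trans hF.dim
        nlinarith
      · omega
      · rw [Function.update_of_ne (by omega), hfr₂ _ (by omega)]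
        simp [hM₁]
      · rw [Function.update_self, hr₂, hv]
        rw [Finset.sum_range_succ] at hsum
        simp only [Op.eval]
        omega
      · intro y hy
        rw [Function.update_of_ne (by omega), hfr₂ _ (by omega), hfr₁ y hy]
    have hInit : I d (Function.update (Function.update M r 0) (r + 1) d) := by
      refine ⟨le_rfl, by simp, by simp, fun y hy => ?_⟩
      rw [Function.update_of_ne (by omega), Function.update_of_ne (by omega)]
    obtain ⟨t, M', he, hI, ht⟩ := exec_for (c := r + 1) (fun j M' h => h.2.1) hstep d _ hInit hF.dim
    have hupd : Function.update (Function.update M r 0) (r + 1)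
        (Op.add.eval (Function.update M r 0 2) (Function.update M r 0 0)) =
        Function.update (Function.update M r 0) (r + 1) d := by
      simp [Op.eval, hM.zero, Function.update_of_ne (show (2 : ℕ) ≠ r by omega),
        Function.update_of_ne (show (0 : ℕ) ≠ r by omega), hM.dim, ← hd]
    rw [← hupd] at he
    refine ⟨?_, _, M', .seq (.const _ _ _) (.seq (.arith _ _ _ _ _) he), ?_, ?_, ?_⟩
    rotate_left 1
    · have := hI.2.2.1
      rw [Finset.range_zero, Finset.sum_empty, add_zero] at this
      exact this
    · exact fun y hy => hI.2.2.2 y (by simpa [Expr.height, add_assoc] using hy)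
    · have h1 : (1 : ℕ) ≤ (d + 1) ^ k := Nat.one_le_pow _ _ (by omega)
      rw [Function.update_of_ne (show (2 : ℕ) ≠ r by omega), hM.dim,
        Function.update_of_ne (show (0 : ℕ) ≠ r by omega), hM.zero, ← hd, pow_succ]
      have h2 := hF.dim
      rw [← hd] at h2
      simp only [Nat.size_zero]
      have h3 : d * (K * β * (d + 1) ^ k + (2 * K + 5) * β + 1 + β) ≤
          d * ((3 * K + 7) * β * (d + 1) ^ k) := by
        gcongr
        nlinarith
      have h4 : β ≤ β * (d + 1) ^ k := Nat.le_mul_of_pos_right _ h1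
      have h5 : β * (d + 1) ^ k ≤ β * (d + 1) ^ k * (d + 1) := Nat.le_mul_of_pos_right _ (by omega)
      have h6 : (3 * K + 20) * β * ((d + 1) ^ k * (d + 1)) =
        d * ((3 * K + 7) * β * (d + 1) ^ k) + (3 * K + 7) * (β * (d + 1) ^ k) +
          13 * (β * (d + 1) ^ k * (d + 1)) := by ring
      rw [h6]
      omega
    · simp only [Expr.eval, ← hd]
      refine hS'.trans ?_
      nlinarith

end RAM

/-! ### Execution with cost bounds and the compilation of statements -/

namespace RAM

theorem Holds.of_frame {b r : ℕ} {M M' : Mem} {st : State} (h : Holds b M st) (hr : 5 ≤ r)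
    (hlow : ∀ x < r, M' x = M x) (hhigh : ∀ x, b ≤ x → M' x = M x) : Holds b M' st :=
  ⟨(hlow 0 (by omega)).trans h.zero, (hlow 1 (by omega)).trans h.len,
    (hlow 2 (by omega)).trans h.dim, (hlow 3 (by omega)).trans h.cap,
    (hlow 4 (by omega)).trans h.base, fun a i => (hhigh _ (by omega)).trans (h.arr a i)⟩

/-- Started on `M`, the program `p` halts at cost at most `C` with a memory that satisfies `Q`. -/
def Reaches (p : Prog) (M : Mem) (C : ℕ) (Q : Mem → Prop) : Prop :=
  ∃ t M', Exec p M t M' ∧ t ≤ C ∧ Q M'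

section Reaches

variable {p q : Prog} {M : Mem} {C C' n u : ℕ} {Q P : Mem → Prop}

theorem Reaches.mono (h : Reaches p M C P) (hC : C ≤ C') (hPQ : ∀ M', P M' → Q M') :
    Reaches p M C' Q := by
  obtain ⟨t, M', he, ht, hP⟩ := h
  exact ⟨t, M', he, ht.trans hC, hPQ M' hP⟩

theorem Reaches.seq (h : Reaches p M C P) (hq : ∀ M', P M' → Reaches q M' C' Q) :
    Reaches (.seq p q) M (C + C') Q := by
  obtain ⟨t, M', he, ht, hP⟩ := h
  obtain ⟨t', M'', he', ht', hQ⟩ := hq M' hP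
  exact ⟨_, M'', .seq he he', by omega, hQ⟩

/-- This gives a name to a nest of updates. After the relevant registers are read off, the defining
equation can be cleared. -/
theorem Reaches.of_eq (h : ∀ M', M' = M → Reaches p M' C Q) : Reaches p M C Q := h M rfl

theorem reaches_arith {o : Op} {d a b x y : ℕ} (ha : M a = x) (hb : M b = y)
    (hu : 1 + x.size + y.size ≤ u) (h : Q (Function.update M d (o.eval x y))) :
    Reaches (.arith o d a b) M u Q := by
  subst ha hb
  exact ⟨_, _, .arith _ _ _ _ _, hu, h⟩

theorem reaches_const {d c : ℕ} (hu : 1 ≤ u) (h : Q (Function.update M d c)) :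
    Reaches (.const d c) M u Q :=
  ⟨_, _, .const _ _ _, hu, h⟩

theorem reaches_load {d a x y : ℕ} (ha : M a = x) (hb : M x = y)
    (hu : 1 + x.size + y.size ≤ u) (h : Q (Function.update M d y)) :
    Reaches (.load d a) M u Q := by
  subst ha hb
  exact ⟨_, _, .load _ _ _, hu, h⟩

theorem reaches_store {a s x y : ℕ} (ha : M a = x) (hb : M s = y)
    (hu : 1 + x.size + y.size ≤ u) (h : Q (Function.update M x y)) :
    Reaches (.store a s) M u Q := by
  subst ha hb
  exact ⟨_, _, .store _ _ _, hu, h⟩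

/-- In a straight-line program every instruction is charged the same amount `u`, so its cost is the
number of instructions times `u`, plus `C` for a larger piece at the end. -/
theorem reaches_seq_arith {o : Op} {d a b x y : ℕ} (ha : M a = x) (hb : M b = y)
    (hu : 1 + x.size + y.size ≤ u)
    (h : Reaches q (Function.update M d (o.eval x y)) (C + n * u) Q) :
    Reaches (.seq (.arith o d a b) q) M (C + (n + 1) * u) Q :=
  ((reaches_arith (Q := fun M' => M' = Function.update M d (o.eval x y)) ha hb hu rfl).seq
    (fun M' hM' => hM' ▸ h)).mono (by linarith) fun _ h => h

theorem reaches_seq_const {d c : ℕ} (hu : 1 ≤ u)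
    (h : Reaches q (Function.update M d c) (C + n * u) Q) :
    Reaches (.seq (.const d c) q) M (C + (n + 1) * u) Q :=
  ((reaches_const (Q := fun M' => M' = Function.update M d c) hu rfl).seq
    (fun M' hM' => hM' ▸ h)).mono (by linarith) fun _ h => h

theorem reaches_seq_load {d a x y : ℕ} (ha : M a = x) (hb : M x = y)
    (hu : 1 + x.size + y.size ≤ u) (h : Reaches q (Function.update M d y) (C + n * u) Q) :
    Reaches (.seq (.load d a) q) M (C + (n + 1) * u) Q :=
  ((reaches_load (Q := fun M' => M' = Function.update M d y) ha hb hu rfl).seq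
    (fun M' hM' => hM' ▸ h)).mono (by linarith) fun _ h => h

theorem reaches_seq_store {a s x y : ℕ} (ha : M a = x) (hb : M s = y)
    (hu : 1 + x.size + y.size ≤ u) (h : Reaches q (Function.update M x y) (C + n * u) Q) :
    Reaches (.seq (.store a s) q) M (C + (n + 1) * u) Q :=
  ((reaches_store (Q := fun M' => M' = Function.update M x y) ha hb hu rfl).seq
    (fun M' hM' => hM' ▸ h)).mono (by linarith) fun _ h => h

theorem reaches_for {c : ℕ} {I : ℕ → Mem → Prop} {β : ℕ} (hI : ∀ j M, I j M → M c = j)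
    (hp : ∀ j M, I (j + 1) M → Reaches p M C (I j)) (j : ℕ) (h : I j M) (hj : j.size ≤ β) :
    Reaches (.loop c p) M (j * (C + 1 + β) + 1) (I 0) := by
  obtain ⟨t, M', he, h0, ht⟩ := exec_for hI hp j M h hj
  exact ⟨t, M', he, ht, h0⟩

end Reaches

theorem size_one_seven_eight : Nat.size 1 = 1 ∧ Nat.size 7 = 3 ∧ Nat.size 8 = 4 := by
  refine ⟨?_, ?_, ?_⟩ <;> simp [Nat.size, Nat.binaryRec]

/-- The first half of a tabulation writes the entries to the scratch array. -/
theorem reaches_tab_fill (e : Expr) : ∃ K k, ∀ (β b : ℕ) (st : State) (M : Mem) (r : ℕ), 5 ≤ r →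
    r + e.height + 6 ≤ b → Holds b M st → Fits β b st → M r = st.dim * st.dim →
    Reaches (.loop r (block [.const (r + 1) 1, .arith .sub r r (r + 1),
          .arith .div (r + 1) r 2, .arith .mul (r + 2) (r + 1) 2, .arith .sub (r + 2) r (r + 2),
          e.compile (Function.update (Function.update (fun _ => 0) 0 (r + 1)) 1 (r + 2)) (r + 3),
          .arith .sub (r + 4) 3 (r + 3), .arith .sub (r + 3) 3 (r + 4),
          .const (r + 5) 8, .arith .mul (r + 4) r (r + 5), .const (r + 5) 7,
          .arith .add (r + 4) (r + 4) (r + 5), .arith .add (r + 4) (r + 4) 4]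
          (.store (r + 4) (r + 3)))) M (K * β * (st.dim + 1) ^ k) fun M' =>
      Holds b M' st ∧ (∀ x < r, M' x = M x) ∧ ∀ k < st.dim * st.dim, M' (b + 8 * k + 7) =
        min (e.eval st (env₂ (k / st.dim) (k % st.dim))) st.cap := by
  obtain ⟨K, k, hK⟩ := e.exec_compile
  refine ⟨15 * K + 360, k + 2, fun β b st M r hr hb hM hF hMr => ?_⟩
  obtain ⟨z1, z7, z8⟩ := size_one_seven_eight
  have hβ := hF.four_le
  set d := st.dim with hd
  set v : ℕ → ℕ := fun k => min (e.eval st (env₂ (k / d) (k % d))) st.cap with hv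
  let I : ℕ → Mem → Prop := fun j M' => j ≤ d * d ∧ M' r = j ∧ Holds b M' st ∧
    (∀ x < r, M' x = M x) ∧ ∀ k < d * d, j ≤ k → M' (b + 8 * k + 7) = v k
  have hsd := hF.dim
  rw [← hd] at hsd
  have hdd : (d * d).size ≤ 2 * β := (size_mul_le d d).trans (by omega)
  have hstep : ∀ j M', I (j + 1) M' → Reaches (block [.const (r + 1) 1,
          .arith .sub r r (r + 1),
          .arith .div (r + 1) r 2, .arith .mul (r + 2) (r + 1) 2, .arith .sub (r + 2) r (r + 2),
          e.compile (Function.update (Function.update (fun _ => 0) 0 (r + 1)) 1 (r + 2)) (r + 3),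
          .arith .sub (r + 4) 3 (r + 3), .arith .sub (r + 3) 3 (r + 4),
          .const (r + 5) 8, .arith .mul (r + 4) r (r + 5), .const (r + 5) 7,
          .arith .add (r + 4) (r + 4) (r + 5), .arith .add (r + 4) (r + 4) 4]
          (.store (r + 4) (r + 3))) M' ((K * β * (d + 1) ^ k + 9 * ((K + 24) * β)) +
            5 * ((K + 24) * β)) (I j) := by
    rintro j M' ⟨hjd, hj, hH, hlow, hent⟩
    have hj' : j < d * d := hjd
    have hd0 : 0 < d := by
      rcases Nat.eq_zero_or_pos d with h | h
      · rw [h] at hj'; omega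
      · exact h
    have hs1 : (j + 1).size ≤ 2 * β := (Nat.size_le_size hjd).trans hdd
    have hs0 : j.size ≤ 2 * β := (Nat.size_le_size hj'.le).trans hdd
    have hdiv : j / d < d := Nat.div_lt_of_lt_mul hj'
    have hmod : j % d < d := Nat.mod_lt _ hd0
    have hmod' : j - j / d * d = j % d := by
      rw [mul_comm, Nat.mod_def]
    have hsdiv : (j / d).size ≤ β := (Nat.size_le_size hdiv.le).trans hsd
    have hsmod : (j % d).size ≤ β := (Nat.size_le_size hmod.le).trans hsd
    have hsmul : (j / d * d).size ≤ 2 * β := (size_mul_le _ _).trans (by omega)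
    have h2 : M' 2 = d := hH.dim
    have n0 : 2 ≠ r := by omega
    have n1 : 2 ≠ r + 1 := by omega
    have hu : 24 * β ≤ (K + 24) * β := by gcongr; omega
    refine reaches_seq_const (by omega) ?_
    refine reaches_seq_arith (x := j + 1) (y := 1) (by simp [hj]) (by simp) (by omega) ?_
    refine reaches_seq_arith (x := j) (y := d) (by simp [Op.eval]) (by simp [n0, n1, h2])
      (by omega) ?_
    refine reaches_seq_arith (x := j / d) (y := d) (by simp [Op.eval]) (by simp [n0, n1, h2])
      (by omega) ?_
    refine reaches_seq_arith (x := j) (y := j / d * d) (by simp [Op.eval]) (by simp [Op.eval])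
      (by omega) ?_
    rw [zero_mul, add_zero]
    refine Reaches.of_eq fun M₁ hM₁ => ?_
    have f0 : M₁ r = j := by rw [hM₁]; simp [Op.eval]
    have f1 : M₁ (r + 1) = j / d := by rw [hM₁]; simp [Op.eval]
    have f2 : M₁ (r + 2) = j % d := by rw [hM₁]; simp [Op.eval, hmod']
    have hfr₁ : ∀ x, x < r ∨ r + 3 ≤ x → M₁ x = M' x := by
      intro x hx
      rw [hM₁]
      simp [show x ≠ r by omega, show x ≠ r + 1 by omega, show x ≠ r + 2 by omega]
    clear hM₁
    have hH₁ : Holds b M₁ st := hH.of_frame hr (fun x hx => hfr₁ x (.inl hx))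
      fun x hx => hfr₁ x (by omega)
    obtain ⟨hsz, t, M₂, he, hval, hfr₂, ht⟩ := hK β b st M₁
      (Function.update (Function.update (fun _ => 0) 0 (r + 1)) 1 (r + 2))
      (env₂ (j / d) (j % d)) (r + 3) (by omega) (by omega) hH₁ hF (fun x => by
        by_cases hx1 : x = 1
        · subst hx1
          simpa [env₂, f2] using hsmod
        · by_cases hx0 : x = 0
          · subst hx0
            simpa [env₂, f1] using hsdiv
          · simp [env₂, hx1, hx0, hH₁.zero])
    refine Reaches.seq (P := fun M => M = M₂) ⟨t, M₂, he, ht, rfl⟩ fun M₃ h₃ => ?_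
    rw [h₃]
    clear h₃ M₃
    have hcapsz := hF.cap
    have hbsz := hF.base
    set w := e.eval st (env₂ (j / d) (j % d)) with hw
    have hvj : v j = min w st.cap := rfl
    have hmin : st.cap - (st.cap - w) = v j := by rw [hvj]; omega
    have hsub : (st.cap - w).size ≤ β := (Nat.size_le_size (by omega)).trans hcapsz
    have hvs : (v j).size ≤ β := (Nat.size_le_size (by omega)).trans hcapsz
    have g0 : M₂ r = j := (hfr₂ r (by omega)).trans f0
    have g3 : M₂ 3 = st.cap := (hfr₂ 3 (by omega)).trans hH₁.cap
    have g4 : M₂ 4 = b := (hfr₂ 4 (by omega)).trans hH₁.base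
    have hu' : K * β + 24 * β = (K + 24) * β := by ring
    have m1 : 4 ≠ r + 4 := by omega
    have m2 : 4 ≠ r + 3 := by omega
    have m3 : 4 ≠ r + 5 := by omega
    have a1 := size_mul_le j 8
    have a2 := size_add_le (j * 8) 7
    have a3 := size_add_le (j * 8 + 7) b
    conv => arg 3; rw [← Nat.zero_add (9 * ((K + 24) * β))]
    refine reaches_seq_arith (x := st.cap) (y := w) g3 hval (by omega) ?_
    refine reaches_seq_arith (x := st.cap) (y := st.cap - w) (by simp [g3])
      (by simp [Op.eval]) (by omega) ?_
    refine reaches_seq_const (by omega) ?_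
    refine reaches_seq_arith (x := j) (y := 8) (by simp [g0]) (by simp) (by omega) ?_
    refine reaches_seq_const (by omega) ?_
    refine reaches_seq_arith (x := j * 8) (y := 7) (by simp [Op.eval]) (by simp) (by omega) ?_
    refine reaches_seq_arith (x := j * 8 + 7) (y := b) (by simp [Op.eval])
      (by simp only [Function.update_of_ne m1, Function.update_of_ne m2,
        Function.update_of_ne m3, g4]) (by omega) ?_
    refine (reaches_store (x := j * 8 + 7 + b) (y := v j) (u := (K + 24) * β) (by simp [Op.eval])
      (by simp [Op.eval, hmin]) (by omega) ?_).mono (by omega) fun _ h => h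
    have hfin : ∀ x, x < r + 3 ∨ b ≤ x → ∀ z y1 y2 y3 y4 y5 y6 y7 : ℕ, x ≠ z →
        Function.update (Function.update (Function.update (Function.update (Function.update
          (Function.update (Function.update (Function.update M₂ (r + 4) y1) (r + 3) y2) (r + 5) y3)
          (r + 4) y4) (r + 5) y5) (r + 4) y6) (r + 4) y7) z (v j) x = M₁ x := by
      intro x hx z y1 y2 y3 y4 y5 y6 y7 hz
      rw [Function.update_of_ne hz]
      simp only [ne_eq, show x ≠ r + 3 by omega, show x ≠ r + 4 by omega, show x ≠ r + 5 by omega,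
        not_false_eq_true, Function.update_of_ne]
      exact hfr₂ x (by omega)
    refine ⟨by omega, ?_, ?_, fun x hx => ?_, fun k hk hjk => ?_⟩
    · rw [hfin r (by omega) _ _ _ _ _ _ _ _ (by omega), f0]
    · refine ⟨?_, ?_, ?_, ?_, ?_, fun a i => ?_⟩ <;>
        rw [hfin _ (by omega) _ _ _ _ _ _ _ _ (by omega)]
      exacts [hH₁.zero, hH₁.len, hH₁.dim, hH₁.cap, hH₁.base, hH₁.arr a i]
    · rw [hfin x (by omega) _ _ _ _ _ _ _ _ (by omega), hfr₁ x (.inl hx), hlow x hx]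
    · rcases hjk.eq_or_lt with rfl | hlt
      · rw [show b + 8 * j + 7 = j * 8 + 7 + b by ring, Function.update_self]
      · rw [hfin _ (by omega) _ _ _ _ _ _ _ _ (by omega), hfr₁ _ (by omega), hent k hk hlt]
  refine (reaches_for (I := I) (fun j M h => h.2.1) hstep (d * d)
    ⟨le_rfl, hMr, hM, fun _ _ => rfl, fun k hk hk' => by omega⟩ hdd).mono ?_ fun M' h =>
      ⟨h.2.2.1, h.2.2.2.1, fun k hk => h.2.2.2.2 k hk (Nat.zero_le k)⟩
  have h1 : (1 : ℕ) ≤ (d + 1) ^ k := Nat.one_le_pow _ _ (by omega)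
  have h3 : K * β * (d + 1) ^ k + 9 * ((K + 24) * β) + 5 * ((K + 24) * β) + 1 + 2 * β ≤
      (15 * K + 350) * β * (d + 1) ^ k := by
    have : (14 * K + 350) * β * 1 ≤ (14 * K + 350) * β * (d + 1) ^ k := by gcongr
    nlinarith
  have h4 : 1 ≤ β * (d + 1) ^ k := Nat.mul_pos (by omega) (by omega)
  have h5 := Nat.mul_le_mul_left (d * d) h3
  rw [pow_add]
  nlinarith [Nat.zero_le (d * (β * (d + 1) ^ k)), Nat.zero_le (d * d * (β * (d + 1) ^ k)),
    Nat.zero_le (d * (K * (β * (d + 1) ^ k))), Nat.zero_le (K * (β * (d + 1) ^ k))]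

/-- The second half of a tabulation copies the scratch array. -/
theorem reaches_tab_copy (a : Fin 7) (g : ℕ → ℕ) (β b : ℕ) (st : State) (M : Mem) (r : ℕ)
    (hr : 5 ≤ r) (hb : r + 4 ≤ b) (hM : Holds b M st) (hF : Fits β b st)
    (hMr : M r = st.dim * st.dim) (hg : ∀ k < st.dim * st.dim, M (b + 8 * k + 7) = g k)
    (hgs : ∀ k < st.dim * st.dim, (g k).size ≤ β) :
    Reaches (.loop r (block [.const (r + 1) 1, .arith .sub r r (r + 1),
          .const (r + 1) 8, .arith .mul (r + 1) r (r + 1), .arith .add (r + 1) (r + 1) 4,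
          .const (r + 2) 7, .arith .add (r + 2) (r + 1) (r + 2), .load (r + 2) (r + 2),
          .const (r + 3) a, .arith .add (r + 3) (r + 1) (r + 3)] (.store (r + 3) (r + 2)))) M
      (250 * β * (st.dim + 1) ^ 2) fun M' =>
      Holds b M' { st with arr := Function.update st.arr a fun k =>
        if k < st.dim * st.dim then g k else st.arr a k } ∧ (∀ x < r, M' x = M x) := by
  obtain ⟨z1, z7, z8⟩ := size_one_seven_eight
  have hβ := hF.four_le
  set d := st.dim with hd
  have hsd := hF.dim
  rw [← hd] at hsd
  have hbsz := hF.base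
  have ha := a.2
  have hasz : (a : ℕ).size ≤ 3 := by
    rw [Nat.size_le]
    omega
  have hdd : (d * d).size ≤ 2 * β := (size_mul_le d d).trans (by omega)
  let I : ℕ → Mem → Prop := fun j M' => j ≤ d * d ∧ M' r = j ∧ (∀ x < r, M' x = M x) ∧
    (∀ k < d * d, j ≤ k → M' (b + 8 * k + a) = g k) ∧
    (∀ x, b ≤ x → (∀ k < d * d, j ≤ k → x ≠ b + 8 * k + a) → M' x = M x)
  have hstep : ∀ j M', I (j + 1) M' → Reaches (block [.const (r + 1) 1, .arith .sub r r (r + 1),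
          .const (r + 1) 8, .arith .mul (r + 1) r (r + 1), .arith .add (r + 1) (r + 1) 4,
          .const (r + 2) 7, .arith .add (r + 2) (r + 1) (r + 2), .load (r + 2) (r + 2),
          .const (r + 3) a, .arith .add (r + 3) (r + 1) (r + 3)] (.store (r + 3) (r + 2))) M'
          (0 + 11 * (20 * β)) (I j) := by
    rintro j M' ⟨hjd, hj, hlow, hent, hrest⟩
    have hj' : j < d * d := hjd
    have hs1 : (j + 1).size ≤ 2 * β := (Nat.size_le_size hjd).trans hdd
    have hs0 : j.size ≤ 2 * β := (Nat.size_le_size hj'.le).trans hdd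
    have h4 : M' 4 = b := (hlow 4 (by omega)).trans hM.base
    have n0 : 4 ≠ r := by omega
    have n1 : 4 ≠ r + 1 := by omega
    have a1 := size_mul_le j 8
    have a2 := size_add_le (j * 8) b
    have a3 := size_add_le (j * 8 + b) 7
    have a4 := size_add_le (j * 8 + b) a
    have hgj := hgs j hj'
    have hval : M' (j * 8 + b + 7) = g j := by
      rw [← hg j hj', show j * 8 + b + 7 = b + 8 * j + 7 by ring]
      exact hrest _ (by omega) fun k _ _ => by omega
    refine reaches_seq_const (by omega) ?_
    refine reaches_seq_arith (x := j + 1) (y := 1) (by simp [hj]) (by simp) (by omega) ?_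
    refine reaches_seq_const (by omega) ?_
    refine reaches_seq_arith (x := j) (y := 8) (by simp [Op.eval]) (by simp) (by omega) ?_
    refine reaches_seq_arith (x := j * 8) (y := b) (by simp [Op.eval]) (by simp [n0, n1, h4])
      (by omega) ?_
    refine reaches_seq_const (by omega) ?_
    refine reaches_seq_arith (x := j * 8 + b) (y := 7) (by simp [Op.eval]) (by simp) (by omega) ?_
    refine reaches_seq_load (x := j * 8 + b + 7) (y := g j) (by simp [Op.eval]) ?_ (by omega) ?_
    · simpa [show j * 8 + b + 7 ≠ r by omega, show j * 8 + b + 7 ≠ r + 1 by omega,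
        show j * 8 + b + 7 ≠ r + 2 by omega] using hval
    refine reaches_seq_const (by omega) ?_
    refine reaches_seq_arith (x := j * 8 + b) (y := a) (by simp [Op.eval]) (by simp) (by omega) ?_
    refine (reaches_store (x := j * 8 + b + a) (y := g j) (u := 20 * β) (by simp [Op.eval])
      (by simp) (by omega) ?_).mono (by omega) fun _ h => h
    have hfin : ∀ x, x < r ∨ b ≤ x → ∀ z y0 y1 y2 y3 y4 y5 y6 y7 y8 y9 : ℕ, x ≠ z →
        Function.update (Function.update (Function.update (Function.update (Function.update
          (Function.update (Function.update (Function.update (Function.update (Function.update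
          (Function.update M' (r + 1) y0) r y1) (r + 1) y2) (r + 1) y3) (r + 1) y4) (r + 2) y5)
          (r + 2) y6) (r + 2) y7) (r + 3) y8) (r + 3) y9) z (g j) x = M' x := by
      intro x hx z y0 y1 y2 y3 y4 y5 y6 y7 y8 y9 hz
      rw [Function.update_of_ne hz]
      simp only [ne_eq, show x ≠ r + 3 by omega, show x ≠ r + 2 by omega, show x ≠ r + 1 by omega,
        show x ≠ r by omega, not_false_eq_true, Function.update_of_ne]
    refine ⟨by omega, ?_, fun x hx => ?_, fun k hk hjk => ?_, fun x hx hx' => ?_⟩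
    · rw [Function.update_of_ne (by omega)]
      simp [Op.eval]
    · rw [hfin x (.inl hx) _ _ _ _ _ _ _ _ _ _ _ (by omega), hlow x hx]
    · rcases hjk.eq_or_lt with rfl | hlt
      · rw [show b + 8 * j + a = j * 8 + b + a by ring, Function.update_self]
      · rw [hfin _ (by omega) _ _ _ _ _ _ _ _ _ _ _ (by omega), hent k hk hlt]
    · have := hx' j hj' le_rfl
      rw [hfin _ (by omega) _ _ _ _ _ _ _ _ _ _ _ (by omega)]
      exact hrest x hx fun k hk hk' => hx' k hk (by omega)
  refine (reaches_for (I := I) (fun j M h => h.2.1) hstep (d * d)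
    ⟨le_rfl, hMr, fun _ _ => rfl, fun k hk hk' => by omega, fun _ _ _ => rfl⟩ hdd).mono ?_ ?_
  · nlinarith [Nat.zero_le (d * β), Nat.zero_le (d * d * β)]
  · rintro M' ⟨-, -, hlow, hent, hrest⟩
    refine ⟨⟨(hlow 0 (by omega)).trans hM.zero, (hlow 1 (by omega)).trans hM.len,
      (hlow 2 (by omega)).trans hM.dim, (hlow 3 (by omega)).trans hM.cap,
      (hlow 4 (by omega)).trans hM.base, fun a' i => ?_⟩, hlow⟩
    have ha' := a'.2
    by_cases haa : a' = a
    · subst haa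
      simp only [Function.update_self]
      split_ifs with hi
      · exact hent i hi (Nat.zero_le i)
      · rw [hrest _ (by omega) fun k hk _ => by omega, hM.arr]
    · rw [hrest _ (by omega) fun k _ _ h => haa (Fin.ext (by omega)), hM.arr]
      simp [Function.update_of_ne haa]

/-- The cut-off at `cap` is what makes one bit bound survive any number of iterations. Without it,
repeated squaring of tables would produce numbers of exponential length. -/
theorem Stmt.run_fits {β b : ℕ} (s : Stmt) (st : State) (hF : Fits β b st) :
    Fits β b (s.run st) ∧ (s.run st).dim = st.dim ∧ (s.run st).cap = st.cap ∧
      (s.run st).len = st.len := by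
  induction s generalizing st with
  | tab a e =>
    refine ⟨⟨hF.four_le, hF.len, hF.dim, hF.cap, hF.base, fun a' i => ?_⟩, rfl, rfl, rfl⟩
    simp only [Stmt.run]
    by_cases h : a' = a
    · subst h
      simp only [Function.update_self]
      split_ifs
      · exact (Nat.size_le_size (min_le_right _ _)).trans hF.cap
      · exact hF.arr _ _
    · rw [Function.update_of_ne h]
      exact hF.arr _ _
  | seq s₁ s₂ ih₁ ih₂ =>
    have h₁ := ih₁ st hF
    have h₂ := ih₂ _ h₁.1
    exact ⟨h₂.1, h₂.2.1.trans h₁.2.1, h₂.2.2.1.trans h₁.2.2.1, h₂.2.2.2.trans h₁.2.2.2⟩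
  | rep s ih =>
    simp only [Stmt.run]
    have : ∀ n, Fits β b (s.run^[n] st) ∧ (s.run^[n] st).dim = st.dim ∧
        (s.run^[n] st).cap = st.cap ∧ (s.run^[n] st).len = st.len := by
      intro n
      induction n with
      | zero => exact ⟨hF, rfl, rfl, rfl⟩
      | succ n ihn =>
        rw [Function.iterate_succ_apply']
        have h := ih _ ihn.1
        exact ⟨h.1, h.2.1.trans ihn.2.1, h.2.2.1.trans ihn.2.2.1, h.2.2.2.trans ihn.2.2.2⟩
    exact this _

/-- A repetition multiplies the cost of its body by `dim`, because by `Stmt.run_fits` every round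
starts from a state with the same dimension and the same bit bound. -/
theorem Stmt.reaches_compile (s : Stmt) : ∃ K k, ∀ (β b : ℕ) (st : State) (M : Mem) (r : ℕ),
    5 ≤ r → r + s.height ≤ b → Holds b M st → Fits β b st →
    Reaches (s.compile r) M (K * β * (st.dim + 1) ^ k) fun M' =>
      Holds b M' (s.run st) ∧ ∀ x < r, M' x = M x := by
  induction s with
  | tab a e =>
    obtain ⟨K, k, h⟩ := reaches_tab_fill e
    refine ⟨3 + (K + (3 + 250)), 0 + (k + (0 + 2)), fun β b st M r hr hb hM hF => ?_⟩
    simp only [Stmt.height] at hb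
    have hβ := hF.four_le
    have hsd := hF.dim
    have hmul : ∀ M : Mem, Holds b M st → Reaches (.arith .mul r 2 2) M (3 * β * (st.dim + 1) ^ 0)
        fun M' => Holds b M' st ∧ (∀ x, x ≠ r → M' x = M x) ∧ M' r = st.dim * st.dim := by
      intro M hM
      refine reaches_arith hM.dim hM.dim (by rw [pow_zero, mul_one]; omega) ⟨?_, ?_, ?_⟩
      · refine hM.of_frame hr (fun x hx => ?_) fun x hx => ?_ <;>
          rw [Function.update_of_ne (by omega)]
      · intro x hx
        rw [Function.update_of_ne hx]
      · simp [Op.eval]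
    have hone : 1 ≤ st.dim + 1 := by omega
    have key : Reaches ((Stmt.tab a e).compile r) M (3 * β * (st.dim + 1) ^ 0 +
        (K * β * (st.dim + 1) ^ k + (3 * β * (st.dim + 1) ^ 0 + 250 * β * (st.dim + 1) ^ 2)))
        fun M' => Holds b M' ((Stmt.tab a e).run st) ∧ ∀ x < r, M' x = M x := by
      refine (hmul M hM).seq fun M₁ h₁ => (h β b st M₁ r hr (by omega) h₁.1 hF h₁.2.2).seq
        fun M₂ h₂ => (hmul M₂ h₂.1).seq fun M₃ h₃ => ?_
      refine (reaches_tab_copy a (fun k => min (e.eval st (env₂ (k / st.dim) (k % st.dim))) st.cap)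
        β b st M₃ r hr (by omega) h₃.1 hF h₃.2.2
        (fun k hk => (h₃.2.1 _ (by omega)).trans (h₂.2.2 k hk))
        fun k hk => (Nat.size_le_size (min_le_right _ _)).trans hF.cap).mono le_rfl
        fun M₄ h₄ => ⟨h₄.1, fun x hx => ?_⟩
      rw [h₄.2 x hx, h₃.2.1 x (by omega), h₂.2.1 x hx, h₁.2.1 x (by omega)]
    exact key.mono
      (bound_add hone le_rfl (bound_add hone le_rfl (bound_add hone le_rfl le_rfl))) fun _ h => h
  | seq s₁ s₂ ih₁ ih₂ =>
    obtain ⟨K₁, k₁, ih₁⟩ := ih₁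
    obtain ⟨K₂, k₂, ih₂⟩ := ih₂
    refine ⟨K₁ + K₂, k₁ + k₂, fun β b st M r hr hb hM hF => ?_⟩
    simp only [Stmt.height] at hb
    have hrun := s₁.run_fits st hF
    refine ((ih₁ β b st M r hr (by omega) hM hF).seq fun M₁ h₁ =>
      (ih₂ β b _ M₁ r hr (by omega) h₁.1 hrun.1).mono (C' := K₂ * β * (st.dim + 1) ^ k₂)
        (by rw [hrun.2.1]) fun M₂ h₂ => ⟨h₂.1, fun x hx => (h₂.2 x hx).trans (h₁.2 x hx)⟩).mono
      (bound_add (by omega) le_rfl le_rfl) fun _ h => h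
  | rep s ih =>
    obtain ⟨K, k, ih⟩ := ih
    refine ⟨K + 20, k + 1, fun β b st M r hr hb hM hF => ?_⟩
    simp only [Stmt.height] at hb
    obtain ⟨z1, z7, z8⟩ := size_one_seven_eight
    have hβ := hF.four_le
    have hsd := hF.dim
    set d := st.dim with hd
    have hfit : ∀ n, Fits β b (s.run^[n] st) ∧ (s.run^[n] st).dim = d := by
      intro n
      induction n with
      | zero => exact ⟨hF, rfl⟩
      | succ n ihn =>
        rw [Function.iterate_succ_apply']
        have h := s.run_fits _ ihn.1
        exact ⟨h.1, h.2.1.trans ihn.2⟩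
    let I : ℕ → Mem → Prop := fun j M' => j ≤ d ∧ M' r = j ∧ Holds b M' (s.run^[d - j] st) ∧
      ∀ x < r, M' x = M x
    have hstep : ∀ j M', I (j + 1) M' → Reaches (block [.const (r + 1) 1, .arith .sub r r (r + 1)]
        (s.compile (r + 1))) M' (K * β * (d + 1) ^ k + 2 * (3 * β)) (I j) := by
      rintro j M' ⟨hjd, hj, hH, hlow⟩
      have hs1 : (j + 1).size ≤ β := (Nat.size_le_size hjd).trans hsd
      refine reaches_seq_const (by omega) ?_
      refine reaches_seq_arith (x := j + 1) (y := 1) (by simp [hj]) (by simp) (by omega) ?_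
      have hF' := hfit (d - (j + 1))
      refine (ih β b _ _ (r + 1) (by omega) (by omega) (hH.of_frame hr (fun x hx => ?_)
        fun x hx => ?_) hF'.1).mono (by rw [hF'.2]; omega) ?_
      · simp [show x ≠ r by omega, show x ≠ r + 1 by omega]
      · simp [show x ≠ r by omega, show x ≠ r + 1 by omega]
      · rintro M'' ⟨h1, h2⟩
        refine ⟨by omega, ?_, ?_, fun x hx => ?_⟩
        · rw [h2 r (by omega)]
          simp [Op.eval]
        · rw [← Function.iterate_succ_apply' (f := s.run)] at h1
          rwa [show (d - (j + 1)).succ = d - j by omega] at h1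
        · rw [h2 x (by omega)]
          simp [show x ≠ r by omega, show x ≠ r + 1 by omega, hlow x hx]
    have hinit : Reaches (copy r 2) M (2 * β) (I d) := by
      refine reaches_arith hM.dim hM.zero (by rw [← hd]; simp; omega) ⟨le_rfl, ?_, ?_, fun x hx => ?_⟩
      · simp [Op.eval]; rfl
      · rw [Nat.sub_self]
        refine hM.of_frame hr (fun x hx => ?_) fun x hx => ?_ <;>
          rw [Function.update_of_ne (by omega)]
      · rw [Function.update_of_ne (by omega)]
    refine (hinit.seq fun M' h => reaches_for (I := I) (fun j M h => h.2.1) hstep d h hsd).mono ?_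
      fun M' h => ⟨h.2.2.1, h.2.2.2⟩
    have h1 : (1 : ℕ) ≤ (d + 1) ^ k := Nat.one_le_pow _ _ (by omega)
    have h4 : β ≤ β * (d + 1) ^ k := Nat.le_mul_of_pos_right _ h1
    have h5 : d * (K * β * (d + 1) ^ k + 2 * (3 * β) + 1 + β) ≤
        d * ((K + 8) * (β * (d + 1) ^ k)) := by
      gcongr
      nlinarith
    rw [pow_succ]
    nlinarith [Nat.zero_le (d * (β * (d + 1) ^ k)), Nat.zero_le (K * (β * (d + 1) ^ k))]

end RAM

namespace RAM

/-! ### Setting up the memory -/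

/-- The number at which the entries of tables are cut off on input `u`. -/
def capOf (g : ℕ) (u : List ℕ) : ℕ := u.foldr (fun x c => (c + x) * 2 ^ g) 1

/-- The initial state on input `u`; the dimension is the entry of `u` at `o`, if this does not exceed
the length of `u`. -/
def initState (g o : ℕ) (u : List ℕ) : State where
  -- The minimum keeps the running time polynomial on words that announce a huge number of vertices.
  -- On encodings of instances it equals the announced number.
  dim := min u.length (u.getD o 0)
  cap := capOf g u
  len := u.length
  arr a i := if a = 0 then u.getD i 0 else 0

/-- `M[0] := 2 ^ (k + 1) * M[0]` -/
def double : ℕ → Prog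
  | 0 => .arith .add 0 0 0
  | k + 1 => .seq (double k) (.arith .add 0 0 0)

/-- Moves the registers `1, …, m + 1` to the addresses `b, b + 8, …`, where `b = M[0]`. -/
def evacuate : ℕ → Prog
  -- Once cell `1` is saved it can hold the stride `8`, by which cell `0` then advances.
  | 0 => .seq (.store 0 1) (.const 1 8)
  | m + 1 => .seq (evacuate m) (.seq (.arith .add 0 0 1) (.store 0 (m + 2)))

/-- Moves the remaining part of the input. -/
def moveRest (m : ℕ) : Prog :=
  .loop 5 (block [.const 6 1, .arith .sub 5 5 6, .const 6 (m + 1), .arith .add 6 5 6, .const 7 8,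
    .arith .mul 7 6 7, .arith .add 7 7 4, .const 8 1, .arith .add 6 6 8, .load 6 6] (.store 7 6))

/-- Computes the cut-off in register `3`. -/
def makeCap (g : ℕ) : Prog :=
  .loop 5 (block [.const 6 1, .arith .sub 5 5 6, .const 7 8, .arith .mul 7 5 7, .arith .add 7 7 4,
    .load 7 7, .arith .add 3 3 7, .const 7 (2 ^ g)] (.arith .mul 3 3 7))

/-- Sets up the memory on a nonempty input. -/
def setup (k m g o : ℕ) : Prog :=
  -- The input may occupy all the cells needed as registers, and only cell `0`, its length, can be
  -- reused at once. Multiplying it by `2 ^ (k + 1)` gives an address `b` beyond both the input and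
  -- the registers. After the low cells are saved there, `b` is recovered by subtracting `8 * m`,
  -- and the length by dividing by `2 ^ (k + 1)`. The dimension is finally obtained as a minimum by
  -- two truncated subtractions.
  block [double k, evacuate m, .const 2 (8 * m), .arith .sub 4 0 2, .const 2 (2 ^ (k + 1)),
    .arith .div 1 4 2, .const 0 0, .const 2 (m + 1), .arith .sub 5 1 2, moveRest m, .const 3 1,
    .arith .add 5 1 0, makeCap g, .const 6 (8 * o), .arith .add 6 6 4, .load 6 6,
    .arith .sub 2 1 6] (.arith .sub 2 1 2)

theorem reaches_double (β k : ℕ) (M : Mem) (h : (2 ^ (k + 1) * M 0).size ≤ β) :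
    Reaches (double k) M ((k + 1) * (2 * β + 1)) fun M' =>
      M' = Function.update M 0 (2 ^ (k + 1) * M 0) := by
  induction k with
  | zero =>
    have : (M 0).size ≤ β := (Nat.size_le_size (by omega)).trans h
    refine reaches_arith rfl rfl (by omega) ?_
    simp [Op.eval, two_mul]
  | succ k ih =>
    have h1 : (2 ^ (k + 1) * M 0).size ≤ β := by
      refine (Nat.size_le_size ?_).trans h
      gcongr <;> omega
    refine ((ih h1).seq (C' := 2 * β + 1) fun M' hM' => ?_).mono (by linarith) fun _ h => h
    subst hM'
    refine reaches_arith (x := 2 ^ (k + 1) * M 0) (y := 2 ^ (k + 1) * M 0) (by simp) (by simp)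
      (by omega) ?_
    simp only [Op.eval, Function.update_idem]
    congr 1
    rw [pow_succ 2 (k + 1)]
    ring

/-- The memory above `b` holds the entries of `u` with index in `P` at multiples of `8`. -/
structure Stored (b : ℕ) (u : List ℕ) (P : ℕ → Prop) (M : Mem) : Prop where
  entry : ∀ i, P i → M (b + 8 * i) = u.getD i 0
  rest : ∀ x, b ≤ x → (∀ i, P i → x ≠ b + 8 * i) → M x = 0

theorem Stored.of_frame {b : ℕ} {u : List ℕ} {P : ℕ → Prop} {M M' : Mem} (h : Stored b u P M)
    (hM : ∀ x, b ≤ x → M' x = M x) : Stored b u P M' :=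
  ⟨fun i hi => (hM _ (by omega)).trans (h.entry i hi), fun x hx h' =>
    (hM x hx).trans (h.rest x hx h')⟩

theorem Stored.insert {b j : ℕ} {u : List ℕ} {P P' : ℕ → Prop} {M : Mem} (h : Stored b u P M)
    (hP : ∀ i, P' i ↔ i = j ∨ P i) :
    Stored b u P' (Function.update M (b + 8 * j) (u.getD j 0)) := by
  refine ⟨fun i hi => ?_, fun x hx h' => ?_⟩
  · by_cases hij : i = j
    · subst hij
      simp
    · rw [Function.update_of_ne (by omega)]
      exact h.entry i (((hP i).mp hi).resolve_left hij)
  · rw [Function.update_of_ne (h' j ((hP j).mpr (.inl rfl)))]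
    exact h.rest x hx fun i hi => h' i ((hP i).mpr (.inr hi))

theorem input_of_length_lt {u : List ℕ} {x : ℕ} (h : u.length < x) : input u x = 0 := by
  obtain ⟨i, rfl⟩ : ∃ i, x = i + 1 := ⟨x - 1, by omega⟩
  simp only [input]
  exact List.getD_eq_default _ _ (by omega)

theorem reaches_evacuate (β b : ℕ) (u : List ℕ) (m : ℕ) (M : Mem) (hb : u.length < b)
    (hm : m + 2 ≤ b) (h0 : M 0 = b) (hM : ∀ x, x ≠ 0 → M x = input u x)
    (hβ : (b + 8 * m).size ≤ β) (h4 : 4 ≤ β) (hu : ∀ i, (u.getD i 0).size ≤ β) :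
    Reaches (evacuate m) M ((m + 1) * (4 * β + 2)) fun M' =>
      M' 0 = b + 8 * m ∧ M' 1 = 8 ∧ (∀ x, 2 ≤ x → x < b → M' x = input u x) ∧
      Stored b u (· ≤ m) M' := by
  obtain ⟨z1, z7, z8⟩ := size_one_seven_eight
  induction m with
  | zero =>
    have hb' : b.size ≤ β := by simpa using hβ
    have hu0 := hu 0
    have hv : M 1 = u.getD 0 0 := hM 1 (by omega)
    conv => arg 3; rw [show (0 + 1) * (4 * β + 2) = (2 * β + 1) + (0 + 1) * (2 * β + 1) by ring]
    refine reaches_seq_store (x := b) (y := u.getD 0 0) h0 hv (by omega) ?_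
    refine reaches_const (by omega) ⟨?_, ?_, ?_, ?_⟩
    · simp [h0, show 0 ≠ b by omega]
    · simp
    · intro x hx hxb
      rw [Function.update_of_ne (by omega), Function.update_of_ne (by omega), hM x (by omega)]
    · have hS : Stored b u (fun _ => False) M :=
        ⟨fun i hi => hi.elim, fun x hx _ => by
          rw [hM x (by omega), input_of_length_lt (by omega)]⟩
      refine (hS.insert (j := 0) (P' := (· ≤ 0)) fun i => by simp).of_frame fun x hx => ?_
      rw [Function.update_of_ne (by omega)]
      simp
  | succ m ih =>
    have hβ' : (b + 8 * m).size ≤ β := (Nat.size_le_size (by omega)).trans hβ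
    refine ((ih (by omega) hβ').seq (C' := (2 * β + 1) + (0 + 1) * (2 * β + 1))
      fun M' hM' => ?_).mono (by linarith) fun _ h => h
    obtain ⟨e0, e1, e2, hS⟩ := hM'
    have hum := hu (m + 1)
    refine reaches_seq_arith (x := b + 8 * m) (y := 8) e0 e1 (by omega) ?_
    have hv : M' (m + 2) = u.getD (m + 1) 0 := e2 _ (by omega) (by omega)
    refine (reaches_store (x := b + 8 * (m + 1)) (y := u.getD (m + 1) 0) (u := 2 * β + 1)
      (by simp [Op.eval]; ring) (by simpa using hv) (by omega) ⟨?_, ?_, ?_, ?_⟩).mono (by omega)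
        fun _ h => h
    · rw [Function.update_of_ne (by omega)]
      simp only [Function.update_self, Op.eval]
      ring
    · rw [Function.update_of_ne (by omega), Function.update_of_ne (by omega), e1]
    · intro x hx hxb
      rw [Function.update_of_ne (by omega), Function.update_of_ne (by omega), e2 x hx hxb]
    · refine (hS.of_frame fun x hx => ?_).insert fun i => by omega
      rw [Function.update_of_ne (by omega)]

/-- The loop works in registers `5` to `8`, which `7 ≤ m` guarantees to be evacuated. It writes only
at addresses from `b` on, so it never overwrites an entry that is still to be moved. -/
theorem reaches_moveRest (β b : ℕ) (u : List ℕ) (m : ℕ) (M : Mem) (hb : u.length < b)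
    (hm' : 7 ≤ m) (hm : m + 2 ≤ b) (h4 : M 4 = b) (h5 : M 5 = u.length - (m + 1))
    (hM : ∀ x, m + 2 ≤ x → x < b → M x = input u x) (hS : Stored b u (· ≤ m) M)
    (hβ : b.size ≤ β) (hβ4 : 4 ≤ β) (hu : ∀ i, (u.getD i 0).size ≤ β) :
    Reaches (moveRest m) M (200 * β * (u.length + 1)) fun M' =>
      (∀ x < 5, M' x = M x) ∧ Stored b u (fun _ => True) M' := by
  obtain ⟨z1, z7, z8⟩ := size_one_seven_eight
  let I : ℕ → Mem → Prop := fun c M' => c ≤ u.length - (m + 1) ∧ M' 5 = c ∧ (∀ x < 5, M' x = M x) ∧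
    (∀ x, m + 2 ≤ x → x < b → M' x = input u x) ∧ Stored b u (fun i => i ≤ m ∨ c + m + 1 ≤ i) M'
  have hLs : u.length.size ≤ β := (Nat.size_le_size hb.le).trans hβ
  have hstep : ∀ c M', I (c + 1) M' → Reaches (block [.const 6 1, .arith .sub 5 5 6,
      .const 6 (m + 1), .arith .add 6 5 6, .const 7 8, .arith .mul 7 6 7, .arith .add 7 7 4,
      .const 8 1, .arith .add 6 6 8, .load 6 6] (.store 7 6)) M' (0 + 11 * (12 * β)) (I c) := by
    rintro c M' ⟨hc, e5, hlow, hin, hS'⟩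
    have s1 : (c + 1).size ≤ β := (Nat.size_le_size (by omega)).trans hLs
    have s2 : c.size ≤ β := (Nat.size_le_size (by omega)).trans hLs
    have s3 : (m + 1).size ≤ β := (Nat.size_le_size (by omega)).trans hβ
    have s4 : (c + (m + 1)).size ≤ β := (Nat.size_le_size (by omega)).trans hLs
    have s5 := size_mul_le (c + (m + 1)) 8
    have s6 := size_add_le ((c + (m + 1)) * 8) b
    have s7 : (c + (m + 1) + 1).size ≤ β := (Nat.size_le_size (by omega)).trans hβ
    have s8 := hu (c + (m + 1))
    have e4 : M' 4 = b := (hlow 4 (by omega)).trans h4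
    have hval : M' (c + (m + 1) + 1) = u.getD (c + (m + 1)) 0 := hin _ (by omega) (by omega)
    refine reaches_seq_const (by omega) ?_
    refine reaches_seq_arith (x := c + 1) (y := 1) (by simp [e5]) (by simp) (by omega) ?_
    refine reaches_seq_const (by omega) ?_
    refine reaches_seq_arith (x := c) (y := m + 1) (by simp [Op.eval]) (by simp) (by omega) ?_
    refine reaches_seq_const (by omega) ?_
    refine reaches_seq_arith (x := c + (m + 1)) (y := 8) (by simp [Op.eval]) (by simp)
      (by omega) ?_
    refine reaches_seq_arith (x := (c + (m + 1)) * 8) (y := b) (by simp [Op.eval])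
      (by simp [e4]) (by omega) ?_
    refine reaches_seq_const (by omega) ?_
    refine reaches_seq_arith (x := c + (m + 1)) (y := 1) (by simp [Op.eval]) (by simp)
      (by omega) ?_
    refine reaches_seq_load (x := c + (m + 1) + 1) (y := u.getD (c + (m + 1)) 0)
      (by simp [Op.eval]) ?_ (by omega) ?_
    · rw [← hval]
      simp only [ne_eq, show c + (m + 1) + 1 ≠ 5 by omega, show c + (m + 1) + 1 ≠ 6 by omega,
        show c + (m + 1) + 1 ≠ 7 by omega, show c + (m + 1) + 1 ≠ 8 by omega, not_false_eq_true,
        Function.update_of_ne]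
    refine (reaches_store (x := b + 8 * (c + (m + 1))) (y := u.getD (c + (m + 1)) 0)
      (u := 12 * β) (by simp [Op.eval]; ring) (by simp) ?_ ?_).mono (by omega) fun _ h => h
    · rw [show b + 8 * (c + (m + 1)) = (c + (m + 1)) * 8 + b by ring]
      omega
    refine ⟨by omega, ?_, fun x hx => ?_, fun x hx hxb => ?_, ?_⟩
    · rw [Function.update_of_ne (by omega)]
      simp [Op.eval]
    · rw [Function.update_of_ne (by omega), ← hlow x hx]
      simp only [ne_eq, show x ≠ 5 by omega, show x ≠ 6 by omega,
        show x ≠ 7 by omega, show x ≠ 8 by omega, not_false_eq_true, Function.update_of_ne]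
    · rw [Function.update_of_ne (by omega), ← hin x hx hxb]
      simp only [ne_eq, show x ≠ 5 by omega, show x ≠ 6 by omega,
        show x ≠ 7 by omega, show x ≠ 8 by omega, not_false_eq_true, Function.update_of_ne]
    · refine (hS'.of_frame fun x hx => ?_).insert fun i => by omega
      simp only [ne_eq, show x ≠ 5 by omega, show x ≠ 6 by omega,
        show x ≠ 7 by omega, show x ≠ 8 by omega, not_false_eq_true, Function.update_of_ne]
  refine (reaches_for (I := I) (β := β) (fun j M h => h.2.1) hstep (u.length - (m + 1))
    ⟨le_rfl, h5, fun _ _ => rfl, hM, ⟨fun i hi => ?_, fun x hx h' => ?_⟩⟩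
    ((Nat.size_le_size (by omega)).trans hLs)).mono ?_ fun M' h => ⟨h.2.2.1, ?_⟩
  · rcases le_or_gt i m with him | him
    · exact hS.entry i him
    · rw [hS.rest _ (by omega) fun j hj => by omega]
      exact (List.getD_eq_default _ _ (by omega)).symm
  · exact hS.rest x hx fun i hi => h' i (.inl hi)
  · have : u.length - (m + 1) ≤ u.length := by omega
    calc _ ≤ u.length * (0 + 11 * (12 * β) + 1 + β) + 1 := by gcongr
      _ ≤ _ := by nlinarith [Nat.zero_le (u.length * β)]
  · have := h.2.2.2.2
    refine ⟨fun i _ => this.entry i (by omega), fun x hx h' => this.rest x hx fun i _ => h' i trivial⟩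

theorem capOf_pos (g : ℕ) (u : List ℕ) : 0 < capOf g u := by
  induction u with
  | nil => simp [capOf]
  | cons y u ih => exact Nat.mul_pos (by change 0 < capOf g u + y; omega) (by positivity)

/-- Each entry multiplies the cut-off by at most `(x + 1) * 2 ^ g`, so it contributes at most its
own bit length plus `g + 1`. -/
theorem capOf_size_le (g : ℕ) (u : List ℕ) : (capOf g u).size ≤ (g + 1) * wordSize u + 1 := by
  induction u with
  | nil => simp [capOf, wordSize]
  | cons x u ih =>
    have h1 : capOf g (x :: u) = (capOf g u + x) * 2 ^ g := rfl
    have h2 := capOf_pos g u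
    have h3 : (capOf g u + x) * 2 ^ g ≤ capOf g u * ((x + 1) * 2 ^ g) := by
      have : capOf g u + x ≤ capOf g u * (x + 1) := by nlinarith
      calc _ ≤ capOf g u * (x + 1) * 2 ^ g := by gcongr
        _ = _ := by ring
    have h4 : ((x + 1) * 2 ^ g).size ≤ x.size + 1 + g := by
      rw [Nat.size_le, pow_add, pow_succ]
      have := Nat.lt_size_self x
      gcongr
      have : 1 ≤ 2 ^ x.size := Nat.one_le_two_pow
      omega
    rw [h1]
    refine (Nat.size_le_size h3).trans ((size_mul_le _ _).trans ?_)
    have : wordSize (x :: u) = x.size + 1 + wordSize u := by simp [wordSize]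
    rw [this]
    nlinarith [Nat.zero_le (g * x.size)]

theorem capOf_append_le (g : ℕ) (v u : List ℕ) : capOf g u ≤ capOf g (v ++ u) := by
  induction v with
  | nil => exact le_rfl
  | cons x v ih =>
    have h1 : capOf g (x :: v ++ u) = (capOf g (v ++ u) + x) * 2 ^ g := rfl
    rw [h1]
    exact ih.trans ((Nat.le_add_right _ x).trans (Nat.le_mul_of_pos_right _ (by positivity)))

theorem le_capOf (g : ℕ) (u : List ℕ) (i : ℕ) : u.getD i 0 ≤ capOf g u := by
  induction u generalizing i with
  | nil => simp
  | cons x u ih =>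
    have h1 : capOf g (x :: u) = (capOf g u + x) * 2 ^ g := rfl
    have h2 : capOf g u + x ≤ (capOf g u + x) * 2 ^ g :=
      Nat.le_mul_of_pos_right _ (by positivity)
    cases i with
    | zero => simp only [List.getD_cons_zero]; omega
    | succ i =>
      simp only [List.getD_cons_succ]
      have := ih i
      omega

theorem two_pow_dvd_capOf (g : ℕ) (u : List ℕ) (hu : u ≠ []) : 2 ^ g ∣ capOf g u := by
  cases u with
  | nil => exact absurd rfl hu
  | cons x u => exact ⟨_, mul_comm _ _⟩

/-- The cut-off also serves as the unit of fixed-point arithmetic. An encoding with `n` vertices has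
more than `n * n` entries, so a unit of more than `g * n * n` bits is available. -/
theorem two_pow_le_capOf (g : ℕ) (u : List ℕ) : 2 ^ (g * u.length) ≤ capOf g u := by
  induction u with
  | nil => simp [capOf]
  | cons x u ih =>
    have h1 : capOf g (x :: u) = (capOf g u + x) * 2 ^ g := rfl
    rw [h1, List.length_cons, mul_add, mul_one, pow_add]
    gcongr
    omega

theorem reaches_makeCap (β b g : ℕ) (u : List ℕ) (M : Mem) (hb : u.length < b) (h9 : 9 ≤ b)
    (h3 : M 3 = 1) (h4 : M 4 = b) (h5 : M 5 = u.length) (hS : Stored b u (fun _ => True) M)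
    (hβ : b.size ≤ β) (hg : g + 1 ≤ β) (hβ4 : 4 ≤ β) (hcap : (capOf g u).size ≤ β) :
    Reaches (makeCap g) M (200 * β * (u.length + 1)) fun M' =>
      (∀ x < 5, x ≠ 3 → M' x = M x) ∧ M' 3 = capOf g u ∧ Stored b u (fun _ => True) M' := by
  obtain ⟨z1, z7, z8⟩ := size_one_seven_eight
  let I : ℕ → Mem → Prop := fun c M' => c ≤ u.length ∧ M' 5 = c ∧ (∀ x < 5, x ≠ 3 → M' x = M x) ∧
    M' 3 = capOf g (u.drop c) ∧ Stored b u (fun _ => True) M'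
  have hLs : u.length.size ≤ β := (Nat.size_le_size hb.le).trans hβ
  have hstep : ∀ c M', I (c + 1) M' → Reaches (block [.const 6 1, .arith .sub 5 5 6, .const 7 8,
      .arith .mul 7 5 7, .arith .add 7 7 4, .load 7 7, .arith .add 3 3 7, .const 7 (2 ^ g)]
      (.arith .mul 3 3 7)) M' (0 + 9 * (12 * β)) (I c) := by
    rintro c M' ⟨hc, e5, hlow, e3, hS'⟩
    have s1 : (c + 1).size ≤ β := (Nat.size_le_size (by omega)).trans hLs
    have s2 : c.size ≤ β := (Nat.size_le_size (by omega)).trans hLs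
    have s5 := size_mul_le c 8
    have s6 := size_add_le (c * 8) b
    have e4 : M' 4 = b := (hlow 4 (by omega) (by omega)).trans h4
    have hval : M' (c * 8 + b) = u.getD c 0 := by
      rw [show c * 8 + b = b + 8 * c by ring]
      exact hS'.entry c trivial
    have s8 : (u.getD c 0).size ≤ β := (Nat.size_le_size (le_capOf g u c)).trans hcap
    have hdrop : u.drop c = u.getD c 0 :: u.drop (c + 1) := by
      rw [List.getD_eq_getElem _ _ (by omega), List.drop_eq_getElem_cons (by omega)]
    have hcs : ∀ c, (capOf g (u.drop c)).size ≤ β := fun c => by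
      refine (Nat.size_le_size ?_).trans hcap
      conv_rhs => rw [← List.take_append_drop c u]
      exact capOf_append_le g _ _
    have s9 := hcs (c + 1)
    have s10 := size_add_le (capOf g (u.drop (c + 1))) (u.getD c 0)
    have s11 : (2 ^ g).size = g + 1 := Nat.size_pow
    refine reaches_seq_const (by omega) ?_
    refine reaches_seq_arith (x := c + 1) (y := 1) (by simp [e5]) (by simp) (by omega) ?_
    refine reaches_seq_const (by omega) ?_
    refine reaches_seq_arith (x := c) (y := 8) (by simp [Op.eval]) (by simp) (by omega) ?_
    refine reaches_seq_arith (x := c * 8) (y := b) (by simp [Op.eval]) (by simp [e4])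
      (by omega) ?_
    refine reaches_seq_load (x := c * 8 + b) (y := u.getD c 0) (by simp [Op.eval]) ?_
      (by omega) ?_
    · rw [← hval]
      simp only [ne_eq, show c * 8 + b ≠ 5 by omega, show c * 8 + b ≠ 6 by omega,
        show c * 8 + b ≠ 7 by omega, not_false_eq_true, Function.update_of_ne]
    refine reaches_seq_arith (x := capOf g (u.drop (c + 1))) (y := u.getD c 0) (by simp [e3])
      (by simp) (by omega) ?_
    refine reaches_seq_const (by omega) ?_
    refine (reaches_arith (x := capOf g (u.drop (c + 1)) + u.getD c 0) (y := 2 ^ g)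
      (u := 12 * β) (by simp [Op.eval]) (by simp) (by omega) ?_).mono (by omega) fun _ h => h
    refine ⟨by omega, ?_, fun x hx hx3 => ?_, ?_, hS'.of_frame fun x hx => ?_⟩
    · simp [Op.eval]
    · rw [← hlow x hx hx3]
      simp only [ne_eq, hx3, show x ≠ 5 by omega, show x ≠ 6 by omega,
        show x ≠ 7 by omega, not_false_eq_true, Function.update_of_ne]
    · rw [hdrop, Function.update_self]
      rfl
    · simp only [ne_eq, show x ≠ 3 by omega, show x ≠ 5 by omega, show x ≠ 6 by omega,
        show x ≠ 7 by omega, not_false_eq_true, Function.update_of_ne]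
  refine (reaches_for (I := I) (β := β) (fun j M h => h.2.1) hstep u.length
    ⟨le_rfl, h5, fun _ _ _ => rfl, by simpa [capOf] using h3, hS⟩ hLs).mono ?_
    fun M' h => ⟨h.2.2.1, by simpa using h.2.2.2.1, h.2.2.2.2⟩
  nlinarith [Nat.zero_le (u.length * β)]

theorem reaches_setup (β k m g o : ℕ) (u : List ℕ) (hu : u ≠ []) (hm : 7 ≤ m)
    (hmk : m + 2 ≤ 2 ^ (k + 1)) (hg : g + 1 ≤ β) (hk : k + 2 ≤ β)
    (hβ : (2 ^ (k + 1) * u.length + 8 * m + 8 * o + 16).size ≤ β) (h4 : 4 ≤ β)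
    (hcap : (capOf g u).size ≤ β) :
    Reaches (setup k m g o) (input u) ((500 + 4 * k + 6 * m) * β * (u.length + 1))
      fun M' => Holds (2 ^ (k + 1) * u.length) M' (initState g o u) := by
  set b := 2 ^ (k + 1) * u.length with hbdef
  have hL : 0 < u.length := List.length_pos_iff.mpr hu
  have hmb : m + 2 ≤ b := hmk.trans (Nat.le_mul_of_pos_right _ hL)
  have hLb : u.length < b := by
    have h2 : 2 ≤ 2 ^ (k + 1) := by rw [pow_succ]; have := Nat.one_le_two_pow (n := k); omega
    have := Nat.mul_le_mul_right u.length h2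
    omega
  have hsz : ∀ x, x ≤ b + 8 * m + 8 * o + 16 → x.size ≤ β := fun x hx =>
    (Nat.size_le_size hx).trans hβ
  have hbs : b.size ≤ β := hsz b (by omega)
  have hLs : u.length.size ≤ β := hsz _ (by omega)
  have hus : ∀ i, (u.getD i 0).size ≤ β := fun i => (Nat.size_le_size (le_capOf g u i)).trans hcap
  have s11 : (2 ^ (k + 1)).size = k + 1 + 1 := Nat.size_pow
  have key : Reaches (setup k m g o) (input u) ((k + 1) * (2 * β + 1) + ((m + 1) * (4 * β + 2) +
      ((200 * β * (u.length + 1) + ((200 * β * (u.length + 1) + 5 * (3 * β)) + 2 * (3 * β))) +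
        7 * (3 * β)))) fun M' => Holds b M' (initState g o u) := by
    refine (reaches_double β k (input u) hbs).seq fun M₁ h₁ => ?_
    have hin : input u 0 = u.length := rfl
    rw [hin, ← hbdef] at h₁
    refine (reaches_evacuate β b u m M₁ hLb hmb (by simp [h₁]) (fun x hx => by simp [h₁, hx])
      (hsz _ (by omega)) h4 hus).seq fun M₂ h₂ => ?_
    obtain ⟨e0, e1, e2, hS⟩ := h₂
    have t1 := hsz (b + 8 * m) (by omega)
    have t2 := hsz (8 * m) (by omega)
    have t3 := hsz (m + 1) (by omega)
    refine reaches_seq_const (by omega) ?_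
    refine reaches_seq_arith (x := b + 8 * m) (y := 8 * m) (by simp [e0]) (by simp) (by omega) ?_
    refine reaches_seq_const (by omega) ?_
    refine reaches_seq_arith (x := b) (y := 2 ^ (k + 1)) (by simp [Op.eval]) (by simp)
      (by omega) ?_
    refine reaches_seq_const (by omega) ?_
    refine reaches_seq_const (by omega) ?_
    have hdiv : b / 2 ^ (k + 1) = u.length := Nat.mul_div_cancel_left _ (by positivity)
    refine reaches_seq_arith (x := u.length) (y := m + 1) (by simp [Op.eval, hdiv]) (by simp)
      (by omega) ?_
    rw [zero_mul, add_zero]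
    refine Reaches.of_eq fun M₃ h₃ => ?_
    have f0 : M₃ 0 = 0 := by simp [h₃]
    have f1 : M₃ 1 = u.length := by simp [h₃, Op.eval, hdiv]
    have f4 : M₃ 4 = b := by simp [h₃, Op.eval]
    have f5 : M₃ 5 = u.length - (m + 1) := by simp [h₃, Op.eval]
    have f6 : ∀ x, 6 ≤ x → M₃ x = M₂ x := by
      intro x hx
      rw [h₃]
      simp only [ne_eq, show x ≠ 0 by omega, show x ≠ 1 by omega, show x ≠ 2 by omega,
        show x ≠ 4 by omega, show x ≠ 5 by omega, not_false_eq_true, Function.update_of_ne]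
    clear h₃
    refine (reaches_moveRest β b u m M₃ hLb hm hmb f4 f5 (fun x hx hxb => ?_)
      (hS.of_frame fun x hx => f6 x (by omega)) hbs h4 hus).seq fun M₄ h₄ => ?_
    · rw [f6 x (by omega), e2 x (by omega) hxb]
    obtain ⟨hlow, hS₄⟩ := h₄
    refine reaches_seq_const (by omega) ?_
    refine reaches_seq_arith (x := u.length) (y := 0) (by simp [hlow 1, f1]) (by simp [hlow 0, f0])
      (by simp; omega) ?_
    rw [zero_mul, add_zero]
    refine Reaches.of_eq fun M₅ h₅ => ?_
    refine (reaches_makeCap β b g u M₅ hLb (by omega) (by simp [h₅]) (by simp [h₅, hlow 4, f4])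
      (by simp [h₅, Op.eval]) (hS₄.of_frame fun x hx => ?_) hbs hg h4 hcap).seq fun M₆ h₆ => ?_
    · rw [h₅]
      simp only [ne_eq, show x ≠ 3 by omega, show x ≠ 5 by omega, not_false_eq_true,
        Function.update_of_ne]
    obtain ⟨hlow', hc, hS₆⟩ := h₆
    have g0 : M₆ 0 = 0 := by rw [hlow' 0 (by omega) (by omega), h₅]; simp [hlow 0, f0]
    have g1 : M₆ 1 = u.length := by rw [hlow' 1 (by omega) (by omega), h₅]; simp [hlow 1, f1]
    have g4 : M₆ 4 = b := by rw [hlow' 4 (by omega) (by omega), h₅]; simp [hlow 4, f4]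
    clear h₅ hlow'
    have t4 := hsz (8 * o) (by omega)
    have t5 := hsz (8 * o + b) (by omega)
    have t6 := hus o
    have t7 : (u.length - u.getD o 0).size ≤ β := (Nat.size_le_size (by omega)).trans hLs
    conv => arg 3; rw [← Nat.zero_add (5 * (3 * β))]
    refine reaches_seq_const (by omega) ?_
    refine reaches_seq_arith (x := 8 * o) (y := b) (by simp) (by simp [g4]) (by omega) ?_
    refine reaches_seq_load (x := 8 * o + b) (y := u.getD o 0) (by simp [Op.eval]) ?_ (by omega) ?_
    · rw [← hS₆.entry o trivial, add_comm]
      simp only [ne_eq, show b + 8 * o ≠ 6 by omega, not_false_eq_true, Function.update_of_ne]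
    refine reaches_seq_arith (x := u.length) (y := u.getD o 0) (by simp [g1]) (by simp)
      (by omega) ?_
    refine (reaches_arith (x := u.length) (y := u.length - u.getD o 0) (u := 3 * β) (by simp [g1])
      (by simp [Op.eval]) (by omega) ?_).mono (by omega) fun _ h => h
    have hhigh : ∀ x, b ≤ x → ∀ y1 y2 y3 y4 y5 : ℕ, Function.update (Function.update
        (Function.update (Function.update (Function.update M₆ 6 y1) 6 y2) 6 y3) 2 y4) 2 y5 x =
        M₆ x := by
      intro x hx y1 y2 y3 y4 y5
      simp only [ne_eq, show x ≠ 6 by omega, show x ≠ 2 by omega, not_false_eq_true,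
        Function.update_of_ne]
    refine ⟨by simp [g0], by simp [g1, initState], ?_, by simp [hc, initState], by simp [g4],
      fun a i => ?_⟩
    · simp only [Function.update_self, Op.eval, initState]
      omega
    · rw [hhigh _ (by omega)]
      have ha := a.2
      simp only [initState]
      split_ifs with h0
      · subst h0
        exact hS₆.entry i trivial
      · refine hS₆.rest _ (by omega) fun j _ hj => h0 (Fin.ext ?_)
        have : (a : ℕ) = 0 := by omega
        simpa using this
  refine key.mono ?_ fun _ h => h
  nlinarith [Nat.zero_le (u.length * β), Nat.zero_le (k * β), Nat.zero_le (m * β),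
    Nat.zero_le (k * β * u.length), Nat.zero_le (m * β * u.length)]

/-- The program that evaluates an expression after running a statement. -/
def Stmt.decide (s : Stmt) (e : Expr) (k m g o : ℕ) : Prog :=
  .ite 0 (block [setup k m g o, s.compile 5, e.compile (fun _ => 0) 5] (.arith .add 0 5 0))
    (.const 0 0)

end RAM

theorem length_le_wordSize (u : List ℕ) : u.length ≤ wordSize u := by
  induction u with
  | nil => simp [wordSize]
  | cons x u ih =>
    have : wordSize (x :: u) = x.size + 1 + wordSize u := by simp [wordSize]
    rw [this, List.length_cons]
    omega

theorem size_le_self (n : ℕ) : n.size ≤ n := Nat.size_le.mpr n.lt_two_pow_self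

open RAM in
/-- Languages that are decided by a statement and an expression are in P. -/
theorem inP_of_stmt (g o : ℕ) (s : Stmt) (e : Expr) {L : Set (List ℕ)}
    (h : ∀ u, u ∈ L ↔ u ≠ [] ∧ e.eval (s.run (initState g o u)) (fun _ => 0) = 1) : InP L := by
  obtain ⟨K₁, k₁, h₁⟩ := s.reaches_compile
  obtain ⟨K₂, k₂, h₂⟩ := e.exec_compile
  -- Enough registers for the statement and the expression, whose register stacks start at `5`, and
  -- for the loops of the setup.
  set m := s.height + e.height + 7 with hm
  have hmk : m + 2 ≤ 2 ^ (m + 1 + 1) := (m + 2).lt_two_pow_self.le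
  -- Everything that does not depend on the input, so that `κ * (S + 1)` bounds all bit lengths that
  -- occur.
  set κ := m + 1 + 2 + g + 1 + 2 ^ (m + 1 + 1) + 8 * m + 8 * o + 16 with hκ
  let C := ((500 + 4 * (m + 1) + 6 * m) + K₁ + (2 * K₂ + 1) + 4) * κ
  let f : Polynomial ℕ := Polynomial.C C * (Polynomial.X + 1) ^ (k₁ + k₂ + 2)
  refine ⟨s.decide e (m + 1) m g o, f, fun u => ?_⟩
  set S := wordSize u with hS
  have hf : f.eval S = C * (S + 1) ^ (k₁ + k₂ + 2) := by simp [f]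
  rw [hf]
  have hpos : 1 ≤ (S + 1) ^ (k₁ + k₂ + 2) := Nat.one_le_pow _ _ (by omega)
  have hκ1 : 20 ≤ κ := by omega
  by_cases hu : u = []
  · subst hu
    refine ⟨_, _, .ite_false rfl (.const _ _ _), ?_, ?_⟩
    · have : 4 * κ ≤ C := Nat.mul_le_mul_right κ (by omega)
      nlinarith
    · simp [h]
  set β := κ * (S + 1) with hβ
  have hLS := length_le_wordSize u
  rw [← hS] at hLS
  have hκβ : κ ≤ β := Nat.le_mul_of_pos_right _ (by omega)
  have hcap : (capOf g u).size ≤ β := by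
    refine (capOf_size_le g u).trans ?_
    rw [← hS, hβ]
    have : (g + 2) * (S + 1) ≤ κ * (S + 1) := Nat.mul_le_mul_right _ (by omega)
    nlinarith
  have hbs : (2 ^ (m + 1 + 1) * u.length + 8 * m + 8 * o + 16).size ≤ β := by
    refine (size_le_self _).trans ?_
    have : 2 ^ (m + 1 + 1) * u.length ≤ 2 ^ (m + 1 + 1) * S := Nat.mul_le_mul_left _ hLS
    rw [hβ, hκ]
    nlinarith [Nat.zero_le (m * S), Nat.zero_le (g * S), Nat.zero_le (o * S)]
  set b := 2 ^ (m + 1 + 1) * u.length with hb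
  have hL : 0 < u.length := List.length_pos_iff.mpr hu
  have hmb : m + 2 ≤ b := hmk.trans (Nat.le_mul_of_pos_right _ hL)
  have hset := reaches_setup β (m + 1) m g o u hu (by omega) hmk (by omega) (by omega) hbs
    (by omega) hcap
  have hb' : b.size ≤ β := (Nat.size_le_size (by omega)).trans hbs
  have hLs : u.length.size ≤ β := (Nat.size_le_size
    (Nat.le_mul_of_pos_left _ (by positivity))).trans hb'
  have hF : Fits β b (initState g o u) := by
    refine ⟨by omega, hLs, (Nat.size_le_size (min_le_left _ _)).trans hLs, hcap, hb',
      fun a i => ?_⟩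
    simp only [initState]
    split_ifs
    · exact (Nat.size_le_size (le_capOf g u i)).trans hcap
    · simp
  have hd : (initState g o u).dim ≤ S := (min_le_left _ _).trans hLS
  have hrun := s.run_fits _ hF
  set st := s.run (initState g o u) with hst
  have key : Reaches (block [setup (m + 1) m g o, s.compile 5, e.compile (fun _ => 0) 5]
      (.arith .add 0 5 0)) (input u) ((500 + 4 * (m + 1) + 6 * m) * β * (u.length + 1) +
        (K₁ * β * ((initState g o u).dim + 1) ^ k₁ + (K₂ * β * ((initState g o u).dim + 1) ^ k₂ +
          (1 + K₂ * β)))) fun M' => M' 0 = e.eval st fun _ => 0 := by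
    refine hset.seq fun M₁ hM₁ => (h₁ β b _ M₁ 5 le_rfl (by omega) hM₁ hF).seq fun M₂ hM₂ => ?_
    obtain ⟨hsz, t, M₃, he, hv, hfr, ht⟩ := h₂ β b st M₂ (fun _ => 0) (fun _ => 0) 5 le_rfl
      (by omega) hM₂.1 hrun.1 fun x => ⟨hM₂.1.zero, by omega, by simp⟩
    rw [hrun.2.1] at ht
    refine Reaches.seq (P := fun M => M = M₃) ⟨t, M₃, he, ht, rfl⟩ fun M₄ h₄ => ?_
    rw [h₄]
    refine reaches_arith hv ((hfr 0 (by omega)).trans hM₂.1.zero) (by simp; omega) ?_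
    simp [Op.eval]
  obtain ⟨t, M', he, ht, hM'⟩ := key
  refine ⟨_, M', .ite_true (by simp [input, hu]) he, ?_, ?_⟩
  · have hz : (input u 0).size ≤ β := hLs
    have p : ∀ k ≤ k₁ + k₂ + 1, ∀ x ≤ S, (x + 1) ^ k ≤ (S + 1) ^ (k₁ + k₂ + 1) :=
      fun k hk x hx => (Nat.pow_le_pow_left (by omega) k).trans
        (Nat.pow_le_pow_right (by omega) hk)
    have p1 := p k₁ (by omega) _ hd
    have p2 := p k₂ (by omega) _ hd
    have p3 := p 1 (by omega) _ hLS
    have p0 := p 0 (by omega) _ hLS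
    rw [pow_one] at p3
    rw [pow_zero] at p0
    set D := (S + 1) ^ (k₁ + k₂ + 1) with hD
    have q0 := Nat.mul_le_mul_left ((500 + 4 * (m + 1) + 6 * m) * β) p3
    have q1 := Nat.mul_le_mul_left (K₁ * β) p1
    have q2 := Nat.mul_le_mul_left (K₂ * β) p2
    have q3 := Nat.mul_le_mul_left (K₂ * β) p0
    have q4 := Nat.mul_le_mul_left β p0
    have hfin : C * (S + 1) ^ (k₁ + k₂ + 2) = (500 + 4 * (m + 1) + 6 * m) * β * D + K₁ * β * D +
        K₂ * β * D + K₂ * β * D + 5 * (β * D) := by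
      rw [hD, hβ, pow_succ (S + 1) (k₁ + k₂ + 1)]
      ring
    rw [hfin]
    omega
  · rw [hM', h]
    simp [hu, hst]

/-! ### Encodings of instances -/

namespace Objective

variable {n : ℕ}

/-- The kind of an objective in its encoding. -/
def kind : Objective (Fin n) → ℕ
  | .reach _ => 0
  | .safe _ => 1
  | .buchi _ => 2
  | .parity _ => 3

open Classical in
/-- The numbers attached to the vertices in the encoding of an objective. -/
noncomputable def label : Objective (Fin n) → Fin n → ℕ
  | .reach S => fun v => if v ∈ S then 1 else 0
  | .safe S => fun v => if v ∈ S then 1 else 0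
  | .buchi S => fun v => if v ∈ S then 1 else 0
  | .parity col => col

theorem encode_eq (Φ : Objective (Fin n)) : Φ.encode = Φ.kind :: List.ofFn Φ.label := by
  cases Φ <;> rfl

theorem kind_le (Φ : Objective (Fin n)) : Φ.kind ≤ 3 := by
  cases Φ <;> simp [kind]

theorem label_le (Φ : Objective (Fin n)) (h : Φ.kind ≤ 2) (v : Fin n) : Φ.label v ≤ 1 := by
  cases Φ with
  | parity col => simp [kind] at h
  | _ S => simp only [label]; split_ifs <;> simp

/-- The colors `2` and `1` of the objectives given by a set are its indicator plus one, so an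
expression can compute them from the encoding. -/
theorem color_eq (Φ : Objective (Fin n)) (v : Fin n) :
    Φ.color v = Φ.label v + if Φ.kind ≤ 2 then 1 else 0 := by
  cases Φ with
  | parity col => simp [kind, label, color]
  | _ S =>
    simp only [kind, label, color]
    split_ifs <;> simp_all

theorem mem_absorb_iff (Φ : Objective (Fin n)) (v : Fin n) :
    v ∈ Φ.absorb ↔ (Φ.kind = 0 ∧ Φ.label v = 1) ∨ (Φ.kind = 1 ∧ Φ.label v = 0) := by
  cases Φ with
  | parity col => simp [kind, absorb]
  | _ S => simp [kind, label, absorb]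

/-- The objective with a given kind and labels. -/
def ofLabel (k : ℕ) (l : Fin n → ℕ) : Objective (Fin n) :=
  if k = 0 then .reach {v | l v = 1} else if k = 1 then .safe {v | l v = 1}
    else if k = 2 then .buchi {v | l v = 1} else .parity l

theorem kind_ofLabel {k : ℕ} (l : Fin n → ℕ) (hk : k ≤ 3) : (ofLabel k l).kind = k := by
  unfold ofLabel
  split_ifs <;> simp only [kind] <;> omega

theorem label_ofLabel {k : ℕ} {l : Fin n → ℕ} (hl : k ≤ 2 → ∀ v, l v ≤ 1) (v : Fin n) :
    (ofLabel k l).label v = l v := by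
  unfold ofLabel
  split_ifs with h0 h1 h2
  · have := hl (by omega) v
    simp only [label, Set.mem_ofPred_eq]
    split_ifs <;> omega
  · have := hl (by omega) v
    simp only [label, Set.mem_ofPred_eq]
    split_ifs <;> omega
  · have := hl (by omega) v
    simp only [label, Set.mem_ofPred_eq]
    split_ifs <;> omega
  · rfl

end Objective

namespace Instance

/-- The two objectives of an instance. -/
def obj (I : Instance) (q : Fin 2) : Objective (Fin I.n) := if q = 0 then I.obj₁ else I.obj₂

open Classical in
theorem encode_eq (I : Instance) :
    I.encode = I.n :: (I.graph.init : ℕ) ::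
      (List.ofFn (fun k : Fin (I.n * I.n) =>
          if I.graph.Adj k.divNat k.modNat then 1 else 0) ++
        ((I.obj 0).kind :: List.ofFn (I.obj 0).label) ++
        ((I.obj 1).kind :: List.ofFn (I.obj 1).label)) := by
  have h : (List.finRange I.n).flatMap
      (fun u => List.ofFn fun v => if I.graph.Adj u v then 1 else 0) =
      List.ofFn (fun k : Fin (I.n * I.n) => if I.graph.Adj k.divNat k.modNat then 1 else 0) := by
    rw [List.ofFn_mul, List.flatMap_def, ← List.ofFn_eq_map]
    congr 1
    refine congrArg List.ofFn (funext fun i => congrArg List.ofFn (funext fun j => ?_))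
    have hi := i.2
    have hj := j.2
    congr 2
    · ext
      simp only [Fin.coe_divNat]
      rw [Nat.add_comm, Nat.add_mul_div_right _ _ (by omega), Nat.div_eq_of_lt hj, zero_add]
    · ext
      simp only [Fin.coe_modNat]
      rw [Nat.add_comm, Nat.add_mul_mod_self_right, Nat.mod_eq_of_lt hj]
  simp [Instance.encode, h, obj, Objective.encode_eq]

theorem length_encode (I : Instance) : I.encode.length = 2 + I.n * I.n + 2 * (I.n + 1) := by
  rw [encode_eq]
  simp
  ring

theorem encode_zero (I : Instance) : I.encode.getD 0 0 = I.n := by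
  rw [encode_eq]; simp

theorem encode_one (I : Instance) : I.encode.getD 1 0 = I.graph.init := by
  rw [encode_eq]; simp

open Classical in
theorem encode_adj (I : Instance) (u v : Fin I.n) :
    I.encode.getD (2 + u * I.n + v) 0 = if I.graph.Adj u v then 1 else 0 := by
  have hlt : (u : ℕ) * I.n + v < I.n * I.n := by
    have h1 := u.2
    have h2 := v.2
    have := Nat.mul_le_mul_right I.n (Nat.succ_le_of_lt h1)
    rw [Nat.succ_mul] at this
    omega
  rw [encode_eq, show 2 + (u : ℕ) * I.n + v = ((u : ℕ) * I.n + v) + 1 + 1 by ring,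
    List.getD_cons_succ, List.getD_cons_succ, List.append_assoc,
    List.getD_append _ _ _ _ (by simpa using hlt), List.getD_eq_getElem _ _ (by simpa using hlt)]
  simp only [List.getElem_ofFn]
  have hv := v.2
  congr 2
  · ext
    simp only [Fin.coe_divNat]
    rw [Nat.add_comm, Nat.add_mul_div_right _ _ (by omega), Nat.div_eq_of_lt hv, zero_add]
  · ext
    simp only [Fin.coe_modNat]
    rw [Nat.add_comm, Nat.add_mul_mod_self_right, Nat.mod_eq_of_lt hv]

theorem encode_kind (I : Instance) (q : Fin 2) :
    I.encode.getD (2 + I.n * I.n + q * (I.n + 1)) 0 = (I.obj q).kind := by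
  rw [encode_eq]
  fin_cases q
  · rw [show 2 + I.n * I.n + ((⟨0, by omega⟩ : Fin 2) : ℕ) * (I.n + 1) = I.n * I.n + 1 + 1 by
      simp; ring, List.getD_cons_succ, List.getD_cons_succ, List.append_assoc,
      List.getD_append_right _ _ _ _ (by simp)]
    simp
  · rw [show 2 + I.n * I.n + ((⟨1, by omega⟩ : Fin 2) : ℕ) * (I.n + 1) =
      I.n * I.n + (I.n + 1) + 1 + 1 by simp; ring, List.getD_cons_succ, List.getD_cons_succ,
      List.getD_append_right _ _ _ _ (by simp)]
    simp

theorem encode_label (I : Instance) (q : Fin 2) (v : Fin I.n) :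
    I.encode.getD (2 + I.n * I.n + q * (I.n + 1) + 1 + v) 0 = (I.obj q).label v := by
  have hv := v.2
  rw [encode_eq]
  fin_cases q
  · rw [show 2 + I.n * I.n + ((⟨0, by omega⟩ : Fin 2) : ℕ) * (I.n + 1) + 1 + v =
      I.n * I.n + (v + 1) + 1 + 1 by simp; ring, List.getD_cons_succ, List.getD_cons_succ,
      List.append_assoc, List.getD_append_right _ _ _ _ (by simp)]
    simp only [List.length_ofFn, Nat.add_sub_cancel_left, List.cons_append, List.getD_cons_succ]
    rw [List.getD_append _ _ _ _ (by simp), List.getD_eq_getElem _ _ (by simp)]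
    simp
  · rw [show 2 + I.n * I.n + ((⟨1, by omega⟩ : Fin 2) : ℕ) * (I.n + 1) + 1 + v =
      I.n * I.n + (I.n + 1) + (v + 1) + 1 + 1 by simp; ring, List.getD_cons_succ,
      List.getD_cons_succ, List.getD_append_right _ _ _ _ (by simp)]
    simp only [List.length_append, List.length_ofFn, List.length_cons, Nat.add_sub_cancel_left,
      List.getD_cons_succ]
    rw [List.getD_eq_getElem _ _ (by simp)]
    simp

end Instance

/-- The conditions on the entries `W` of a word of length `len` that make it an encoding. -/
structure ValidWord (W : ℕ → ℕ) (len n : ℕ) : Prop where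
  zero : W 0 = n
  length : len = 2 + n * n + 2 * (n + 1)
  init : W 1 < n
  adj_le : ∀ u < n, ∀ v < n, W (2 + u * n + v) ≤ 1
  exists_adj : ∀ u < n, ∃ v < n, W (2 + u * n + v) = 1
  kind_le : ∀ q < 2, W (2 + n * n + q * (n + 1)) ≤ 3
  label_le : ∀ q < 2, W (2 + n * n + q * (n + 1)) ≤ 2 → ∀ v < n,
    W (2 + n * n + q * (n + 1) + 1 + v) ≤ 1

theorem Instance.validWord (I : Instance) :
    ValidWord (fun i => I.encode.getD i 0) I.encode.length I.n where
  zero := I.encode_zero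
  length := I.length_encode
  init := by rw [I.encode_one]; exact I.graph.init.2
  adj_le u hu v hv := by
    have := I.encode_adj ⟨u, hu⟩ ⟨v, hv⟩
    simp only at this
    rw [this]
    split_ifs <;> omega
  exists_adj u hu := by
    obtain ⟨v, hv⟩ := I.graph.exists_succ ⟨u, hu⟩
    refine ⟨v, v.2, ?_⟩
    have := I.encode_adj ⟨u, hu⟩ v
    simp only at this
    rw [this, if_pos hv]
  kind_le q hq := by
    have := I.encode_kind ⟨q, hq⟩
    simp only at this
    rw [this]
    exact Objective.kind_le _
  label_le q hq hk v hv := by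
    have h1 := I.encode_kind ⟨q, hq⟩
    have h2 := I.encode_label ⟨q, hq⟩ ⟨v, hv⟩
    simp only at h1 h2
    rw [h1] at hk
    rw [h2]
    exact Objective.label_le _ hk _

/-- Only positions below the length are inspected, so the check may be run on a memory in which
other data follow the word. -/
theorem ValidWord.congr {W W' : ℕ → ℕ} {len n : ℕ} (h : ValidWord W len n)
    (hW : ∀ i < len, W' i = W i) : ValidWord W' len n := by
  have hl := h.length
  have key : ∀ u < n, u * n + n ≤ n * n := fun u hu => by
    have := Nat.mul_le_mul_right n (Nat.succ_le_of_lt hu)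
    rwa [Nat.succ_mul] at this
  have key' : ∀ q < 2, q * (n + 1) + (n + 1) ≤ 2 * (n + 1) := fun q hq => by
    have := Nat.mul_le_mul_right (n + 1) (Nat.succ_le_of_lt hq)
    rwa [Nat.succ_mul] at this
  refine ⟨?_, hl, ?_, fun u hu v hv => ?_, fun u hu => ?_, fun q hq => ?_, fun q hq hk v hv => ?_⟩
  · rw [hW 0 (by omega)]; exact h.zero
  · rw [hW 1 (by omega)]; exact h.init
  · have := key u hu
    rw [hW _ (by omega)]; exact h.adj_le u hu v hv
  · obtain ⟨v, hv, h1⟩ := h.exists_adj u hu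
    have := key u hu
    exact ⟨v, hv, by rw [hW _ (by omega)]; exact h1⟩
  · have := key' q hq
    rw [hW _ (by omega)]; exact h.kind_le q hq
  · have := key' q hq
    rw [hW _ (by omega)] at hk ⊢; exact h.label_le q hq hk v hv

/-- The bounds on the entries make the indicators and the kind recoverable from the sets they
define, so encoding the instance that was read off returns every entry, and the lengths agree. -/
theorem ValidWord.exists_instance {w : List ℕ} {n : ℕ}
    (h : ValidWord (fun i => w.getD i 0) w.length n) : ∃ I : Instance, I.encode = w := by
  classical
  let lab : ℕ → Fin n → ℕ := fun q v => w.getD (2 + n * n + q * (n + 1) + 1 + v) 0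
  let G : BidGraph (Fin n) :=
    { init := ⟨w.getD 1 0, h.init⟩
      Adj := fun u v => w.getD (2 + u * n + v) 0 = 1
      exists_succ := fun u => by
        obtain ⟨v, hv, h1⟩ := h.exists_adj u u.2
        exact ⟨⟨v, hv⟩, h1⟩ }
  let I : Instance :=
    { n := n, graph := G
      obj₁ := Objective.ofLabel (w.getD (2 + n * n + 0 * (n + 1)) 0) (lab 0)
      obj₂ := Objective.ofLabel (w.getD (2 + n * n + 1 * (n + 1)) 0) (lab 1) }
  refine ⟨I, ?_⟩
  have hlen : I.encode.length = w.length := I.length_encode.trans h.length.symm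
  have hobj : ∀ q : Fin 2, I.obj q =
      Objective.ofLabel (w.getD (2 + n * n + q * (n + 1)) 0) (lab q) := by
    intro q
    fin_cases q <;> rfl
  have hget : ∀ i < w.length, I.encode.getD i 0 = w.getD i 0 := by
    intro i hi
    rw [h.length] at hi
    rcases Nat.lt_or_ge i 2 with h2 | h2
    · interval_cases i
      · rw [I.encode_zero]; exact h.zero.symm
      · rw [I.encode_one]
    rcases Nat.lt_or_ge i (2 + n * n) with h3 | h3
    · have hn : 0 < n := by
        rcases Nat.eq_zero_or_pos n with h | h
        · subst h; omega
        · exact h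
      obtain ⟨u, v, hu, hv, rfl⟩ : ∃ u v, u < n ∧ v < n ∧ i = 2 + u * n + v := by
        have := Nat.div_add_mod' (i - 2) n
        exact ⟨(i - 2) / n, (i - 2) % n, Nat.div_lt_of_lt_mul (by omega), Nat.mod_lt _ hn, by omega⟩
      have h5 := I.encode_adj ⟨u, hu⟩ ⟨v, hv⟩
      have hle : w.getD (2 + u * n + v) 0 ≤ 1 := h.adj_le _ hu _ hv
      refine h5.trans ?_
      by_cases hA : w.getD (2 + u * n + v) 0 = 1
      · rw [hA]; exact if_pos hA
      · refine (if_neg hA).trans ?_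
        omega
    · have hobj' : ∀ q < 2, ∀ j < n + 1, i = 2 + n * n + q * (n + 1) + j →
          I.encode.getD i 0 = w.getD i 0 := by
        intro q hq j hj hij
        subst hij
        rcases Nat.eq_zero_or_pos j with rfl | hj0
        · have := I.encode_kind ⟨q, hq⟩
          rw [hobj, Objective.kind_ofLabel _ (h.kind_le q hq)] at this
          simpa using this
        · obtain ⟨v, rfl⟩ : ∃ v, j = 1 + v := ⟨j - 1, by omega⟩
          have := I.encode_label ⟨q, hq⟩ ⟨v, show v < n by omega⟩
          rw [hobj, Objective.label_ofLabel (fun hk v => h.label_le q hq hk v v.2)] at this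
          simpa [lab, add_assoc] using this
      rcases Nat.lt_or_ge i (2 + n * n + (n + 1)) with h4 | h4
      · exact hobj' 0 (by omega) (i - (2 + n * n)) (by omega) (by omega)
      · exact hobj' 1 (by omega) (i - (2 + n * n + (n + 1))) (by omega) (by omega)
  refine List.ext_getElem hlen fun i h1 h2 => ?_
  have := hget i h2
  rwa [List.getD_eq_getElem _ _ h1, List.getD_eq_getElem _ _ h2] at this

/-! ### Formulas -/

namespace RAM

namespace Expr

instance : Add Expr := ⟨.op .add⟩
instance : Sub Expr := ⟨.op .sub⟩
instance : Mul Expr := ⟨.op .mul⟩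
instance : Div Expr := ⟨.op .div⟩

variable {st : State} {env : ℕ → ℕ}

@[simp] theorem eval_const (c : ℕ) : (const c).eval st env = c := rfl
@[simp] theorem eval_var (x : ℕ) : (var x).eval st env = env x := rfl
@[simp] theorem eval_dim : dim.eval st env = st.dim := rfl
@[simp] theorem eval_cap : cap.eval st env = st.cap := rfl
@[simp] theorem eval_len : len.eval st env = st.len := rfl
@[simp] theorem eval_get (a : Fin 7) (e : Expr) :
    (get a e).eval st env = st.arr a (e.eval st env) := rfl
@[simp] theorem eval_add (a b : Expr) : (a + b).eval st env = a.eval st env + b.eval st env := rfl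
@[simp] theorem eval_sub (a b : Expr) : (a - b).eval st env = a.eval st env - b.eval st env := rfl
@[simp] theorem eval_mul (a b : Expr) : (a * b).eval st env = a.eval st env * b.eval st env := rfl
@[simp] theorem eval_div (a b : Expr) : (a / b).eval st env = a.eval st env / b.eval st env := rfl
@[simp] theorem eval_sum (x : ℕ) (e : Expr) : (sum x e).eval st env =
    ∑ j ∈ Finset.range st.dim, e.eval st (Function.update env x j) := rfl

/-- An expression, read as a formula. -/
def Holds (e : Expr) (st : State) (env : ℕ → ℕ) : Prop := e.eval st env ≠ 0

/-- Nonzero values count as true. Truncated subtraction from `1` is negation, products are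
conjunctions, and sums are disjunctions and existential quantifiers. -/
def neg (a : Expr) : Expr := const 1 - a
def bool (a : Expr) : Expr := neg (neg a)
def le (a b : Expr) : Expr := neg (a - b)
def and (a b : Expr) : Expr := a * b
def or (a b : Expr) : Expr := a + b
def imp (a b : Expr) : Expr := or (neg a) b
def eq (a b : Expr) : Expr := and (le a b) (le b a)
def ex (x : ℕ) (a : Expr) : Expr := sum x a
def all (x : ℕ) (a : Expr) : Expr := neg (ex x (neg a))
def even (a : Expr) : Expr := eq (const 2 * (a / const 2)) a

@[simp] theorem holds_neg {a : Expr} : (neg a).Holds st env ↔ ¬ a.Holds st env := by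
  simp only [Holds, neg, eval_sub, eval_const]
  omega

theorem eval_bool (a : Expr) [Decidable (a.Holds st env)] :
    (bool a).eval st env = if a.Holds st env then 1 else 0 := by
  split_ifs with h <;> simp only [Holds, bool, neg, eval_sub, eval_const] at h ⊢ <;> omega

theorem eval_bool_eq_one {a : Expr} : (bool a).eval st env = 1 ↔ a.Holds st env := by
  classical
  rw [eval_bool]
  split_ifs with h <;> simp [h]

@[simp] theorem holds_le {a b : Expr} :
    (le a b).Holds st env ↔ a.eval st env ≤ b.eval st env := by
  simp only [Holds, le, neg, eval_sub, eval_const]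
  omega

@[simp] theorem holds_and {a b : Expr} :
    (and a b).Holds st env ↔ a.Holds st env ∧ b.Holds st env := by
  simp [Holds, and]

@[simp] theorem holds_or {a b : Expr} :
    (or a b).Holds st env ↔ a.Holds st env ∨ b.Holds st env := by
  simp only [Holds, or, eval_add]
  omega

@[simp] theorem holds_imp {a b : Expr} :
    (imp a b).Holds st env ↔ (a.Holds st env → b.Holds st env) := by
  simp [imp, imp_iff_not_or]

@[simp] theorem holds_eq {a b : Expr} :
    (eq a b).Holds st env ↔ a.eval st env = b.eval st env := by
  simp [eq, le_antisymm_iff]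

@[simp] theorem holds_ex {x : ℕ} {a : Expr} :
    (ex x a).Holds st env ↔ ∃ j < st.dim, a.Holds st (Function.update env x j) := by
  simp [Holds, ex]

@[simp] theorem holds_all {x : ℕ} {a : Expr} :
    (all x a).Holds st env ↔ ∀ j < st.dim, a.Holds st (Function.update env x j) := by
  simp [all]

theorem holds_ex_fin {n : ℕ} (hn : st.dim = n) {x : ℕ} {a : Expr} :
    (ex x a).Holds st env ↔ ∃ v : Fin n, a.Holds st (Function.update env x v) := by
  rw [holds_ex, hn, Fin.exists_iff]
  simp

theorem holds_all_fin {n : ℕ} (hn : st.dim = n) {x : ℕ} {a : Expr} :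
    (all x a).Holds st env ↔ ∀ v : Fin n, a.Holds st (Function.update env x v) := by
  rw [holds_all, hn, Fin.forall_iff]

@[simp] theorem holds_even {a : Expr} : (even a).Holds st env ↔ Even (a.eval st env) := by
  simp only [even, holds_eq, eval_mul, eval_const, eval_div, Nat.even_iff]
  omega

end Expr

/-! ### The effect of tabulation -/

/-- The states `st` and `st'` differ in the array `a` only. -/
structure State.EqOff (a : Fin 7) (st st' : State) : Prop where
  dim : st'.dim = st.dim
  cap : st'.cap = st.cap
  len : st'.len = st.len
  arr : ∀ b ≠ a, st'.arr b = st.arr b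

namespace State.EqOff

theorem refl (a : Fin 7) (st : State) : State.EqOff a st st := ⟨rfl, rfl, rfl, fun _ _ => rfl⟩

theorem trans {a : Fin 7} {st₁ st₂ st₃ : State} (h : State.EqOff a st₁ st₂)
    (h' : State.EqOff a st₂ st₃) : State.EqOff a st₁ st₃ :=
  ⟨h'.dim.trans h.dim, h'.cap.trans h.cap, h'.len.trans h.len,
    fun b hb => (h'.arr b hb).trans (h.arr b hb)⟩

theorem tab (a : Fin 7) (e : Expr) (st : State) : State.EqOff a st ((Stmt.tab a e).run st) :=
  ⟨rfl, rfl, rfl, fun _ hb => Function.update_of_ne hb _ _⟩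

theorem iterate {a : Fin 7} {s : Stmt} (h : ∀ st, State.EqOff a st (s.run st)) (k : ℕ) (st : State) :
    State.EqOff a st (s.run^[k] st) := by
  induction k with
  | zero => exact refl a st
  | succ k ih => rw [Function.iterate_succ_apply']; exact ih.trans (h _)

theorem rep {a : Fin 7} {s : Stmt} (h : ∀ st, State.EqOff a st (s.run st)) (st : State) :
    State.EqOff a st ((Stmt.rep s).run st) := iterate h _ st

theorem seq {a : Fin 7} {s₁ s₂ : Stmt} (h₁ : ∀ st, State.EqOff a st (s₁.run st))
    (h₂ : ∀ st, State.EqOff a st (s₂.run st)) (st : State) :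
    State.EqOff a st ((Stmt.seq s₁ s₂).run st) := (h₁ st).trans (h₂ _)

end State.EqOff

/-- The entry in row `i` and column `j` of the array `a`. -/
def State.entry (st : State) (a : Fin 7) (i j : ℕ) : ℕ := st.arr a (i * st.dim + j)

/-- The expression for an entry of an array. -/
def Expr.entry (a : Fin 7) (i j : Expr) : Expr := .get a (i * .dim + j)

@[simp] theorem Expr.eval_entry (a : Fin 7) (i j : Expr) (st : State) (env : ℕ → ℕ) :
    (Expr.entry a i j).eval st env = st.entry a (i.eval st env) (j.eval st env) := rfl

theorem State.EqOff.entry {a b : Fin 7} {st st' : State} (h : State.EqOff a st st') (hb : b ≠ a)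
    (i j : ℕ) : st'.entry b i j = st.entry b i j := by
  rw [State.entry, State.entry, h.dim, h.arr b hb]

theorem Stmt.entry_tab (a : Fin 7) (e : Expr) (st : State) {i j : ℕ} (hi : i < st.dim)
    (hj : j < st.dim) :
    ((Stmt.tab a e).run st).entry a i j = min (e.eval st (env₂ i j)) st.cap := by
  have hlt : i * st.dim + j < st.dim * st.dim := by
    have := Nat.mul_le_mul_right st.dim (Nat.succ_le_of_lt hi)
    rw [Nat.succ_mul] at this
    omega
  simp only [State.entry, Stmt.run, Function.update_self]
  rw [if_pos hlt, Nat.add_comm, Nat.add_mul_div_right _ _ (by omega), Nat.div_eq_of_lt hj,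
    Nat.add_mul_mod_self_right, Nat.mod_eq_of_lt hj, zero_add]

@[simp] theorem env₂_zero (i j : ℕ) : env₂ i j 0 = i := by simp [env₂]

@[simp] theorem env₂_one (i j : ℕ) : env₂ i j 1 = j := by simp [env₂]

/-! ### Transitive closure -/

/-- As long as the increasing sets grow strictly, their sizes exceed their indices. If one of them
fails to grow, it is closed under `E` and contains everything reachable. -/
theorem mem_or_lt_ncard_of_relPow {α : Type*} [Finite α] {E : α → α → Prop} {S : ℕ → Set α} {a : α}
    (h0 : a ∈ S 0) (hS : ∀ k, ∀ v ∈ S k, v ∈ S (k + 1))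
    (hs : ∀ k, ∀ v ∈ S k, ∀ w, E v w → w ∈ S (k + 1)) (k : ℕ) :
    (∀ v, ReflTransGen E a v → v ∈ S k) ∨ k < (S k).ncard := by
  induction k with
  | zero => exact Or.inr (Set.ncard_pos (Set.toFinite _) |>.mpr ⟨a, h0⟩)
  | succ k ih =>
    rcases ih with ih | ih
    · exact Or.inl fun v hv => hS k v (ih v hv)
    by_cases hsub : S (k + 1) ⊆ S k
    · refine Or.inl fun v hv => hS k v ?_
      induction hv with
      | refl =>
        have : ∀ j, a ∈ S j := fun j => by
          induction j with
          | zero => exact h0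
          | succ j ih => exact hS j a ih
        exact this k
      | tail _ he ihv => exact hsub (hs k _ ihv _ he)
    · refine Or.inr (lt_of_le_of_lt (Nat.succ_le_of_lt ih)
        (Set.ncard_lt_ncard ⟨hS k, hsub⟩ (Set.toFinite _)))

namespace Stmt

open RAM.Expr in
/-- Tabulates the reflexive transitive closure of the relation that is given by the formula `e` in the
variables `0` and `1`. -/
def closure (a : Fin 7) (e : Expr) : Stmt :=
  .seq (.tab a (bool (or (eq (var 0) (var 1)) e)))
    -- Each round composes the relation with itself. Logarithmically many rounds would do, but `rep`
    -- runs `dim` of them.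
    (.rep (.tab a (bool (ex 2 (and (entry a (var 0) (var 2)) (entry a (var 2) (var 1)))))))

theorem eqOff_closure (a : Fin 7) (e : Expr) (st : State) :
    State.EqOff a st ((closure a e).run st) :=
  State.EqOff.seq (State.EqOff.tab a _) (State.EqOff.rep (State.EqOff.tab a _)) st

theorem entry_tab_bool (a : Fin 7) (e : Expr) (st : State) (hc : 0 < st.cap) {i j : ℕ}
    (hi : i < st.dim) (hj : j < st.dim) :
    ((Stmt.tab a e.bool).run st).entry a i j ≠ 0 ↔ e.Holds st (env₂ i j) := by
  classical
  rw [entry_tab a _ st hi hj, Expr.eval_bool]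
  split_ifs with h
  · simp only [h, iff_true]; omega
  · simp [h]

/-- Squaring a reflexive relation that contains `E` extends paths by at least one edge per round, so
`n` rounds exhaust what is reachable. Distinct strictly increasing sizes would otherwise exceed `n`.
-/
theorem entry_closure (a : Fin 7) (e : Expr) (st : State) (hc : 0 < st.cap) {n : ℕ}
    (hn : st.dim = n) (E : Fin n → Fin n → Prop)
    (he : ∀ u v : Fin n, e.Holds st (env₂ u v) ↔ E u v) (u v : Fin n) :
    ((closure a e).run st).entry a u v ≠ 0 ↔ ReflTransGen E u v := by
  let s₁ : Stmt := .tab a (Expr.bool (.or (.eq (.var 0) (.var 1)) e))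
  let s₂ : Stmt := .tab a (Expr.bool (.ex 2 (.and (.entry a (.var 0) (.var 2))
    (.entry a (.var 2) (.var 1)))))
  have hrun : (closure a e).run st = s₂.run^[n] (s₁.run st) := by rw [← hn]; rfl
  have hoff : ∀ k, State.EqOff a st (s₂.run^[k] (s₁.run st)) := fun k =>
    (State.EqOff.tab a _ st).trans (State.EqOff.iterate (State.EqOff.tab a _) k _)
  let S : ℕ → Fin n → Fin n → Prop := fun k u v => (s₂.run^[k] (s₁.run st)).entry a u v ≠ 0
  have h0 : ∀ u v, S 0 u v ↔ u = v ∨ E u v := by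
    intro u v
    refine (entry_tab_bool a _ st hc (hn ▸ u.2) (hn ▸ v.2)).trans ?_
    simp [he, Fin.ext_iff]
  have step : ∀ st' : State, st'.dim = n → 0 < st'.cap → ∀ u v : Fin n,
      (s₂.run st').entry a u v ≠ 0 ↔
        ∃ x : Fin n, st'.entry a u x ≠ 0 ∧ st'.entry a x v ≠ 0 := by
    intro st' hn' hc' u v
    refine (entry_tab_bool a _ st' hc' (hn' ▸ u.2) (hn' ▸ v.2)).trans ?_
    rw [Expr.holds_ex_fin hn']
    simp only [Expr.holds_and]
    simp [Expr.Holds, env₂]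
  have hs : ∀ k u v, S (k + 1) u v ↔ ∃ x, S k u x ∧ S k x v := by
    intro k u v
    simp only [S, Function.iterate_succ_apply']
    exact step _ ((hoff k).dim.trans hn) (by rw [(hoff k).cap]; exact hc) u v
  have hrefl : ∀ k u, S k u u := by
    intro k u
    induction k with
    | zero => exact (h0 u u).mpr (Or.inl rfl)
    | succ k ih => exact (hs k u u).mpr ⟨u, ih, ih⟩
  have hE : ∀ k u v, E u v → S k u v := by
    intro k u v h
    induction k with
    | zero => exact (h0 u v).mpr (Or.inr h)
    | succ k ih => exact (hs k u v).mpr ⟨u, hrefl k u, ih⟩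
  rw [hrun]
  change S n u v ↔ _
  constructor
  · have : ∀ k u v, S k u v → ReflTransGen E u v := by
      intro k
      induction k with
      | zero =>
        intro u v h
        rcases (h0 u v).mp h with rfl | h
        · exact ReflTransGen.refl
        · exact ReflTransGen.single h
      | succ k ih =>
        intro u v h
        obtain ⟨x, h1, h2⟩ := (hs k u v).mp h
        exact (ih u x h1).trans (ih x v h2)
    exact this _ u v
  · intro h
    rcases mem_or_lt_ncard_of_relPow (E := E) (S := fun k => {v | S k u v}) (a := u) (hrefl 0 u)
      (fun k v hv => (hs k u v).mpr ⟨v, hv, hrefl k v⟩)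
      (fun k v hv w hw => (hs k u w).mpr ⟨v, hv, hE k v w hw⟩) n with h1 | h1
    · exact h1 v h
    · have := Set.ncard_le_card {v | S n u v}
      simp only [Nat.card_eq_fintype_card, Fintype.card_fin] at this
      omega

end Stmt

end RAM

/-! ### Formulas about encoded instances -/

namespace RAM

namespace Expr

/-- The entry `e` of the word that is stored from address `o` on. -/
def word (o : ℕ) (e : Expr) : Expr := get 0 (const o + e)

/-- The kind of the objective `q`. -/
def kind (o : ℕ) (q : Fin 2) : Expr :=
  word o (const 2 + dim * dim + const q * (dim + const 1))

/-- The label of the vertex `e` in the objective `q`. -/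
def label (o : ℕ) (q : Fin 2) (e : Expr) : Expr :=
  word o (const 2 + dim * dim + const q * (dim + const 1) + const 1 + e)

def adj (o : ℕ) (a b : Expr) : Expr := word o (const 2 + a * dim + b)

def color (o : ℕ) (q : Fin 2) (e : Expr) : Expr := label o q e + bool (le (kind o q) (const 2))

def absorb (o : ℕ) (q : Fin 2) (e : Expr) : Expr :=
  or (and (eq (kind o q) (const 0)) (eq (label o q e) (const 1)))
    (and (eq (kind o q) (const 1)) (eq (label o q e) (const 0)))

def edge (o : ℕ) (q : Fin 2) (a b : Expr) : Expr :=
  or (and (absorb o q a) (eq a b)) (and (neg (absorb o q a)) (adj o a b))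

/-- The array that holds the reachability relation of the objective `q`. -/
def reachArr (q : Fin 2) : Fin 7 := if q = 0 then 1 else 2

def reach (q : Fin 2) (a b : Expr) : Expr := entry (reachArr q) a b

/-- The formula for `IsBottom`, at the vertex in the variable `x`. -/
def bottom (q : Fin 2) (x : ℕ) : Expr :=
  all (x + 1) (imp (reach q (var x) (var (x + 1))) (reach q (var (x + 1)) (var x)))

/-- The formula for `EvenTop`, at the vertex in the variable `x`. -/
def evenTop (o : ℕ) (q : Fin 2) (x : ℕ) : Expr :=
  ex (x + 1) (and (and (reach q (var x) (var (x + 1))) (even (color o q (var (x + 1)))))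
    (all (x + 2) (imp (reach q (var x) (var (x + 2)))
      (le (color o q (var (x + 2))) (color o q (var (x + 1)))))))

/-- The formula for `ValidWord`, for the length `l`. -/
def valid (o : ℕ) (l : Expr) : Expr :=
  and (eq (word o (const 0)) dim) (and (eq l (const 2 + dim * dim + const 2 * (dim + const 1)))
    (and (le (word o (const 1) + const 1) dim)
    (and (all 0 (all 1 (le (adj o (var 0) (var 1)) (const 1))))
    (and (all 0 (ex 1 (eq (adj o (var 0) (var 1)) (const 1))))
    (and (and (le (kind o 0) (const 3)) (le (kind o 1) (const 3)))
      (and (imp (le (kind o 0) (const 2)) (all 0 (le (label o 0 (var 0)) (const 1))))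
        (imp (le (kind o 1) (const 2)) (all 0 (le (label o 1 (var 0)) (const 1))))))))))

theorem holds_valid {o : ℕ} {l : Expr} {st : State} {env : ℕ → ℕ} :
    (valid o l).Holds st env ↔
      ValidWord (fun i => st.arr 0 (o + i)) (l.eval st env) st.dim := by
  simp only [valid, holds_and, holds_eq, holds_le, holds_all, holds_ex, holds_imp, word, adj, kind,
    label, eval_get, eval_add, eval_mul, eval_const, eval_dim, eval_var, Function.update_self]
  simp only [Function.update_of_ne (show (0 : ℕ) ≠ 1 by omega), Function.update_self]
  constructor
  · rintro ⟨h1, h2, h3, h4, h5, ⟨h6, h6'⟩, h7, h7'⟩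
    refine ⟨h1, h2, h3, h4, h5, fun q hq => ?_, fun q hq => ?_⟩
    · interval_cases q
      · exact h6
      · exact h6'
    · interval_cases q
      · exact h7
      · exact h7'
  · rintro ⟨h1, h2, h3, h4, h5, h6, h7⟩
    exact ⟨h1, h2, h3, h4, h5, ⟨h6 0 (by omega), h6 1 (by omega)⟩, h7 0 (by omega), h7 1 (by omega)⟩

end Expr

/-- The state holds the encoding of the instance `I`, from address `o` on. -/
structure Represents (o : ℕ) (I : Instance) (st : State) : Prop where
  dim : st.dim = I.n
  cap : 0 < st.cap
  word : ∀ i < I.encode.length, st.arr 0 (o + i) = I.encode.getD i 0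

namespace Represents

variable {o : ℕ} {I : Instance} {st : State} {env : ℕ → ℕ} {a b : Expr} {q : Fin 2}
  {u v : Fin I.n}

theorem congr {c : Fin 7} {st' : State} (h : Represents o I st) (h' : State.EqOff c st st')
    (hc : c ≠ 0) : Represents o I st' where
  dim := h'.dim.trans h.dim
  cap := h'.cap ▸ h.cap
  word i hi := by rw [h'.arr 0 hc.symm, h.word i hi]

theorem mul_add_lt (u v : Fin I.n) : u * I.n + v < I.n * I.n := by
  have := Nat.mul_le_mul_right I.n (Nat.succ_le_of_lt u.2)
  rw [Nat.succ_mul] at this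
  have := v.2
  omega

theorem mul_le (q : Fin 2) : q * (I.n + 1) ≤ I.n + 1 := by
  have := Nat.mul_le_mul_right (I.n + 1) (show (q : ℕ) ≤ 1 by omega)
  omega

theorem eval_init (h : Represents o I st) :
    (Expr.word o (.const 1)).eval st env = I.graph.init := by
  simp only [Expr.word, Expr.eval_get, Expr.eval_add, Expr.eval_const]
  rw [h.word 1 (by rw [I.length_encode]; omega), I.encode_one]

open Classical in
theorem eval_adj (h : Represents o I st) (ha : a.eval st env = u) (hb : b.eval st env = v) :
    (Expr.adj o a b).eval st env = if I.graph.Adj u v then 1 else 0 := by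
  have := mul_add_lt u v
  simp only [Expr.adj, Expr.word, Expr.eval_get, Expr.eval_add, Expr.eval_const, Expr.eval_mul,
    Expr.eval_dim, ha, hb, h.dim]
  rw [h.word _ (by rw [I.length_encode]; omega), I.encode_adj]

theorem holds_adj (h : Represents o I st) (ha : a.eval st env = u) (hb : b.eval st env = v) :
    (Expr.adj o a b).Holds st env ↔ I.graph.Adj u v := by
  rw [Expr.Holds, h.eval_adj ha hb]
  split_ifs with h1 <;> simp [h1]

theorem eval_kind (h : Represents o I st) : (Expr.kind o q).eval st env = (I.obj q).kind := by
  have := mul_le (I := I) q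
  simp only [Expr.kind, Expr.word, Expr.eval_get, Expr.eval_add, Expr.eval_const, Expr.eval_mul,
    Expr.eval_dim, h.dim]
  rw [h.word _ (by rw [I.length_encode]; omega), I.encode_kind]

theorem eval_label (h : Represents o I st) (ha : a.eval st env = u) :
    (Expr.label o q a).eval st env = (I.obj q).label u := by
  have := mul_le (I := I) q
  have := u.2
  simp only [Expr.label, Expr.word, Expr.eval_get, Expr.eval_add, Expr.eval_const, Expr.eval_mul,
    Expr.eval_dim, h.dim, ha]
  rw [h.word _ (by rw [I.length_encode]; omega), I.encode_label]

theorem eval_color (h : Represents o I st) (ha : a.eval st env = u) :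
    (Expr.color o q a).eval st env = (I.obj q).color u := by
  classical
  rw [Objective.color_eq, Expr.color, Expr.eval_add, Expr.eval_bool, h.eval_label ha]
  simp [h.eval_kind]

theorem holds_absorb (h : Represents o I st) (ha : a.eval st env = u) :
    (Expr.absorb o q a).Holds st env ↔ u ∈ (I.obj q).absorb := by
  simp [Expr.absorb, Objective.mem_absorb_iff, h.eval_kind, h.eval_label ha]

theorem holds_edge (h : Represents o I st) (ha : a.eval st env = u) (hb : b.eval st env = v) :
    (Expr.edge o q a b).Holds st env ↔ (I.obj q).edge I.graph u v := by
  simp [Expr.edge, Objective.edge, freeze, h.holds_absorb ha, h.holds_adj ha hb, ha, hb,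
    Fin.ext_iff]

end Represents

/-- Computes the reachability relations of both objectives. -/
def Stmt.prepare (o : ℕ) : Stmt :=
  .seq (.closure (Expr.reachArr 0) (.edge o 0 (.var 0) (.var 1)))
    (.closure (Expr.reachArr 1) (.edge o 1 (.var 0) (.var 1)))

/-- The state holds the instance `I` and its reachability relations. -/
structure Prepared (o : ℕ) (I : Instance) (st : State) : Prop extends Represents o I st where
  reach : ∀ (q : Fin 2) (u v : Fin I.n), st.entry (Expr.reachArr q) u v ≠ 0 ↔
    ReflTransGen ((I.obj q).edge I.graph) u v

theorem Stmt.arr_zero_prepare (o : ℕ) (st : State) :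
    ((prepare o).run st).arr 0 = st.arr 0 ∧ ((prepare o).run st).dim = st.dim ∧
      ((prepare o).run st).cap = st.cap ∧ ((prepare o).run st).len = st.len := by
  have h₁ := eqOff_closure (Expr.reachArr 0) (.edge o 0 (.var 0) (.var 1)) st
  have h₂ := eqOff_closure (Expr.reachArr 1) (.edge o 1 (.var 0) (.var 1))
    ((closure (Expr.reachArr 0) (.edge o 0 (.var 0) (.var 1))).run st)
  exact ⟨(h₂.arr 0 (by decide)).trans (h₁.arr 0 (by decide)), h₂.dim.trans h₁.dim,
    h₂.cap.trans h₁.cap, h₂.len.trans h₁.len⟩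

theorem Represents.prepared {o : ℕ} {I : Instance} {st : State} (h : Represents o I st) :
    Prepared o I ((Stmt.prepare o).run st) := by
  have h₁ := Stmt.eqOff_closure (Expr.reachArr 0) (.edge o 0 (.var 0) (.var 1)) st
  have h₂ := Stmt.eqOff_closure (Expr.reachArr 1) (.edge o 1 (.var 0) (.var 1))
    ((Stmt.closure (Expr.reachArr 0) (.edge o 0 (.var 0) (.var 1))).run st)
  have hr := h.congr h₁ (by decide)
  refine ⟨hr.congr h₂ (by decide), fun q u v => ?_⟩
  obtain rfl | rfl : q = 0 ∨ q = 1 := by omega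
  · rw [Stmt.prepare, Stmt.run, h₂.entry (by decide)]
    exact Stmt.entry_closure _ _ st h.cap h.dim _
      (fun u v => h.holds_edge (a := .var 0) (b := .var 1) (env₂_zero u v) (env₂_one u v)) u v
  · exact Stmt.entry_closure _ _ _ hr.cap hr.dim _
      (fun u v => hr.holds_edge (a := .var 0) (b := .var 1) (env₂_zero u v) (env₂_one u v)) u v

namespace Prepared

variable {o : ℕ} {I : Instance} {st : State} {env : ℕ → ℕ} {a b : Expr} {q : Fin 2}
  {u v : Fin I.n}

theorem congr {c : Fin 7} {st' : State} (h : Prepared o I st) (h' : State.EqOff c st st')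
    (hc : 3 ≤ c) : Prepared o I st' :=
  ⟨h.toRepresents.congr h' (by omega), fun q u v => by
    rw [h'.entry (by unfold Expr.reachArr; split_ifs <;> omega), h.reach]⟩

theorem holds_reach (h : Prepared o I st) (ha : a.eval st env = u) (hb : b.eval st env = v) :
    (Expr.reach q a b).Holds st env ↔ ReflTransGen ((I.obj q).edge I.graph) u v := by
  rw [Expr.Holds, Expr.reach, Expr.eval_entry, ha, hb, h.reach]

theorem holds_bottom (h : Prepared o I st) {x : ℕ} (hx : env x = u) :
    (Expr.bottom q x).Holds st env ↔ IsBottom ((I.obj q).edge I.graph) u := by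
  rw [Expr.bottom, Expr.holds_all_fin h.dim]
  refine forall_congr' fun w => ?_
  have h₁ : (Expr.var x).eval st (Function.update env (x + 1) w) = u := by simp [hx]
  have h₂ : (Expr.var (x + 1)).eval st (Function.update env (x + 1) w) = w := by simp
  rw [Expr.holds_imp, h.holds_reach h₁ h₂, h.holds_reach h₂ h₁]

theorem holds_evenTop (h : Prepared o I st) {x : ℕ} (hx : env x = u) :
    (Expr.evenTop o q x).Holds st env ↔
      EvenTop ((I.obj q).edge I.graph) (I.obj q).color u := by
  rw [Expr.evenTop, Expr.holds_ex_fin h.dim]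
  refine exists_congr fun w => ?_
  have h₁ : (Expr.var x).eval st (Function.update env (x + 1) w) = u := by simp [hx]
  have h₂ : (Expr.var (x + 1)).eval st (Function.update env (x + 1) w) = w := by simp
  rw [Expr.holds_and, Expr.holds_and, h.holds_reach h₁ h₂, Expr.holds_even, h.eval_color h₂,
    and_assoc, Expr.holds_all_fin h.dim]
  refine and_congr_right fun _ => and_congr_right fun _ => forall_congr' fun y => ?_
  have h₃ : (Expr.var x).eval st (Function.update (Function.update env (x + 1) w) (x + 2) y) = u := by
    simp [hx]
  have h₄ : (Expr.var (x + 1)).eval st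
      (Function.update (Function.update env (x + 1) w) (x + 2) y) = w := by simp
  have h₅ : (Expr.var (x + 2)).eval st
      (Function.update (Function.update env (x + 1) w) (x + 2) y) = y := by simp
  rw [Expr.holds_imp, h.holds_reach h₃ h₅, Expr.holds_le, h.eval_color h₅, h.eval_color h₄]

end Prepared

end RAM

/-! ### Membership in NP and coNP -/

theorem Instance.mem_strongSynt_iff (w : List ℕ) :
    w ∈ StrongSynt ↔ ∃ I : Instance, I.encode = w ∧ HasRobustPair I.graph (I.obj 0) (I.obj 1) :=
  exists_congr fun _ => and_congr_right fun _ =>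
    ⟨fun h => h.2, fun h => ⟨HasRobustPair.overlapping h, h⟩⟩

namespace RAM

namespace Expr

/-- The length of the first component of a pair of words. -/
def fstLen : Expr := get 0 (const 0)

/-- The entry `e` of the second component of a pair of words. -/
def cert (e : Expr) : Expr := get 0 (const 1 + fstLen + e)

/-- The common denominator of the certified thresholds of the objective `q`. -/
def den (q : Fin 2) : Expr := cert (const q)

/-- The numerator of the certified threshold of the vertex `e` for the objective `q`. -/
def num (q : Fin 2) (e : Expr) : Expr := cert (const 2 + const q * dim + e)

/-- The certified thresholds of the objective `q` form a Richman function. -/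
def richman (q : Fin 2) : Expr :=
  and (neg (eq (den q) (const 0))) (all 0 (and (le (num q (var 0)) (den q))
    (and (imp (bottom q 0) (and (imp (evenTop 1 q 0) (eq (num q (var 0)) (const 0)))
        (imp (neg (evenTop 1 q 0)) (eq (num q (var 0)) (den q)))))
      (imp (neg (bottom q 0)) (ex 1 (ex 2 (and (edge 1 q (var 0) (var 1))
        (and (edge 1 q (var 0) (var 2))
        (and (all 3 (imp (edge 1 q (var 0) (var 3)) (and (le (num q (var 1)) (num q (var 3)))
          (le (num q (var 3)) (num q (var 2))))))
        (eq (const 2 * num q (var 0)) (num q (var 1) + num q (var 2))))))))))))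

/-- The certified thresholds of the initial vertex sum up to less than `1`. -/
def sumLt : Expr :=
  le (num 0 (word 1 (const 1)) * den 1 + num 1 (word 1 (const 1)) * den 0 + const 1)
    (den 0 * den 1)

end Expr

/-- The state holds the numbers `D` and `N` as a certificate. -/
structure Certifies (I : Instance) (st : State) (D : Fin 2 → ℕ) (N : Fin 2 → Fin I.n → ℕ) : Prop
    extends Prepared 1 I st where
  den : ∀ q env, (Expr.den q).eval st env = D q
  num : ∀ q env (a : Expr) (v : Fin I.n), a.eval st env = v → (Expr.num q a).eval st env = N q v

namespace Certifies

variable {I : Instance} {st : State} {env : ℕ → ℕ} {D : Fin 2 → ℕ} {N : Fin 2 → Fin I.n → ℕ}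

/-- All conditions on a Richman function are linear or order conditions on its values, so with a
common denominator they become conditions on the numerators. -/
theorem holds_richman (h : Certifies I st D N) (q : Fin 2) :
    (Expr.richman q).Holds st env ↔ D q ≠ 0 ∧
      IsRichman ((I.obj q).edge I.graph) (I.obj q).color fun v => (N q v : ℝ) / D q := by
  rw [Expr.richman, Expr.holds_and, Expr.holds_neg, Expr.holds_eq, h.den]
  refine and_congr_right fun hD => ?_
  have hD' : (0 : ℝ) < D q := by
    have : D q ≠ 0 := hD
    positivity
  refine Iff.trans (b := ∀ v : Fin I.n, N q v ≤ D q ∧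
      (IsBottom ((I.obj q).edge I.graph) v →
        (EvenTop ((I.obj q).edge I.graph) (I.obj q).color v → N q v = 0) ∧
        (¬ EvenTop ((I.obj q).edge I.graph) (I.obj q).color v → N q v = D q)) ∧
      (¬ IsBottom ((I.obj q).edge I.graph) v → ∃ x y, (I.obj q).edge I.graph v x ∧
        (I.obj q).edge I.graph v y ∧
        (∀ w, (I.obj q).edge I.graph v w → N q x ≤ N q w ∧ N q w ≤ N q y) ∧
        2 * N q v = N q x + N q y)) ?_ ?_
  · rw [Expr.holds_all_fin h.dim]
    refine forall_congr' fun v => ?_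
    have h0 : (Function.update env 0 (v : ℕ)) 0 = v := by simp
    simp only [Expr.holds_and, Expr.holds_imp, Expr.holds_neg, Expr.holds_le, Expr.holds_eq,
      h.holds_bottom h0, h.holds_evenTop h0, h.den, h.num q (Function.update env 0 (v : ℕ)) (.var 0) v h0, Expr.eval_const]
    refine and_congr_right fun _ => and_congr_right fun _ => forall_congr' fun _ => ?_
    rw [Expr.holds_ex_fin h.dim]
    refine exists_congr fun x => ?_
    rw [Expr.holds_ex_fin h.dim]
    refine exists_congr fun y => ?_
    set env' := Function.update (Function.update (Function.update env 0 (v : ℕ)) 1 x) 2 y with henv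
    have e0 : (Expr.var 0).eval st env' = v := by simp [henv]
    have e1 : (Expr.var 1).eval st env' = x := by simp [henv]
    have e2 : (Expr.var 2).eval st env' = y := by simp [henv]
    simp only [Expr.holds_and, Expr.holds_eq, Expr.eval_mul, Expr.eval_add, Expr.eval_const,
      h.holds_edge e0 e1, h.holds_edge e0 e2, h.num q _ _ _ e0, h.num q _ _ _ e1,
      h.num q _ _ _ e2]
    refine and_congr_right fun _ => and_congr_right fun _ => and_congr_left fun _ => ?_
    rw [Expr.holds_all_fin h.dim]
    refine forall_congr' fun w => ?_
    set env'' := Function.update env' 3 (w : ℕ) with henv''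
    have f0 : (Expr.var 0).eval st env'' = v := by simp [henv'', henv]
    have f1 : (Expr.var 1).eval st env'' = x := by simp [henv'', henv]
    have f2 : (Expr.var 2).eval st env'' = y := by simp [henv'', henv]
    have f3 : (Expr.var 3).eval st env'' = w := by simp [henv'']
    simp only [Expr.holds_imp, Expr.holds_and, Expr.holds_le, h.holds_edge f0 f3,
      h.num q _ _ _ f3, h.num q _ _ _ f1, h.num q _ _ _ f2]
  have hle : ∀ a b : ℕ, (a : ℝ) / D q ≤ (b : ℝ) / D q ↔ a ≤ b := fun a b => by
    rw [div_le_div_iff_of_pos_right hD']; exact Nat.cast_le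
  have havg : ∀ a b c : ℕ, 2 * ((a : ℝ) / D q) = (b : ℝ) / D q + (c : ℝ) / D q ↔
      2 * a = b + c := fun a b c => by
    rw [← add_div, ← mul_div_assoc, div_left_inj' hD'.ne']
    exact_mod_cast Iff.rfl
  have hone : ∀ a : ℕ, (a : ℝ) / D q = 1 ↔ a = D q := fun a => by
    rw [div_eq_one_iff_eq hD'.ne']; exact Nat.cast_inj
  have hzero : ∀ a : ℕ, (a : ℝ) / D q = 0 ↔ a = 0 := fun a => by simp [hD'.ne']
  constructor
  · intro hv
    refine ⟨fun v => by positivity, fun v => ?_, fun v hb he => ?_, fun v hb he => ?_,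
      fun v hb => ?_⟩
    · rw [div_le_one hD']; exact_mod_cast (hv v).1
    · exact (hzero _).mpr (((hv v).2.1 hb).1 he)
    · exact (hone _).mpr (((hv v).2.1 hb).2 he)
    · simpa only [hle, havg] using (hv v).2.2 hb
  · intro hf v
    refine ⟨?_, fun hb => ⟨fun he => (hzero _).mp (hf.bottom_even v hb he),
      fun he => (hone _).mp (hf.bottom_odd v hb he)⟩, fun hb => ?_⟩
    · have := hf.le_one v
      rw [div_le_one hD'] at this
      exact_mod_cast this
    · simpa only [hle, havg] using hf.avg v hb

theorem holds_sumLt (h : Certifies I st D N) (h₁ : (Expr.richman 0).Holds st env)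
    (h₂ : (Expr.richman 1).Holds st env) :
    Expr.sumLt.Holds st env ↔ HasRobustPair I.graph (I.obj 0) (I.obj 1) := by
  obtain ⟨hD₁, hf₁⟩ := (h.holds_richman 0).mp h₁
  obtain ⟨hD₂, hf₂⟩ := (h.holds_richman 1).mp h₂
  have p₁ : (0 : ℝ) < D 0 := by positivity
  have p₂ : (0 : ℝ) < D 1 := by positivity
  rw [hasRobustPair_iff_of_isRichman hf₁ hf₂, div_add_div _ _ p₁.ne' p₂.ne',
    div_lt_one (by positivity)]
  have hi : (Expr.word 1 (.const 1)).eval st env = I.graph.init := h.eval_init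
  simp only [Expr.sumLt, Expr.holds_le, Expr.eval_add, Expr.eval_mul, h.den,
    h.num _ _ _ _ hi, Expr.eval_const, Nat.succ_le_iff]
  rw [mul_comm (N 1 _)]
  exact_mod_cast Iff.rfl

end Certifies

/-- The verifier's state on the pair of words `w` and `y`. -/
def pairState (w y : List ℕ) : State := (Stmt.prepare 1).run (initState 0 1 (pairWord w y))

theorem pairState_arr_zero (w y : List ℕ) (i : ℕ) :
    (pairState w y).arr 0 i = (pairWord w y).getD i 0 := by
  rw [pairState, (Stmt.arr_zero_prepare 1 _).1]
  simp [initState]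

theorem pairState_dim (w y : List ℕ) :
    (pairState w y).dim = min (w.length + y.length + 1) ((w ++ y).getD 0 0) := by
  rw [pairState, (Stmt.arr_zero_prepare 1 _).2.1]
  simp [initState, pairWord]

theorem eval_fstLen (w y : List ℕ) (env : ℕ → ℕ) :
    Expr.fstLen.eval (pairState w y) env = w.length := by
  simp [Expr.fstLen, pairState_arr_zero, pairWord]

theorem pairState_word (w y : List ℕ) {i : ℕ} (hi : i < w.length) :
    (pairState w y).arr 0 (1 + i) = w.getD i 0 := by
  rw [pairState_arr_zero, pairWord, add_comm, List.getD_cons_succ, List.getD_append _ _ _ _ hi]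

theorem eval_cert (w y : List ℕ) (e : Expr) (env : ℕ → ℕ) :
    e.cert.eval (pairState w y) env = y.getD (e.eval (pairState w y) env) 0 := by
  rw [Expr.cert, Expr.eval_get, Expr.eval_add, Expr.eval_add, eval_fstLen, Expr.eval_const,
    pairState_arr_zero, pairWord, add_assoc, add_comm, List.getD_cons_succ,
    List.getD_append_right _ _ _ _ (by omega), Nat.add_sub_cancel_left]

theorem holds_valid_pairState (w y : List ℕ) (env : ℕ → ℕ) :
    (Expr.valid 1 .fstLen).Holds (pairState w y) env ↔ ∃ I : Instance, I.encode = w := by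
  rw [Expr.holds_valid, eval_fstLen]
  constructor
  · intro h
    exact (h.congr fun i hi => (pairState_word w y hi).symm).exists_instance
  · rintro ⟨I, rfl⟩
    have hl := I.length_encode
    have hd : (pairState I.encode y).dim = I.n := by
      rw [pairState_dim, List.getD_append _ _ _ _ (by omega), I.encode_zero]
      omega
    rw [hd]
    exact I.validWord.congr fun i hi => pairState_word _ y hi

/-- In a pair the instance starts at index `1`, so the entry read as the dimension is the number of
vertices. -/
theorem prepared_pairState (I : Instance) (y : List ℕ) : Prepared 1 I (pairState I.encode y) := by
  refine Represents.prepared ⟨?_, capOf_pos _ _, fun i hi => ?_⟩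
  · have hl := I.length_encode
    simp only [initState, pairWord, List.length_cons, List.length_append, List.getD_cons_succ]
    rw [List.getD_append _ _ _ _ (by omega), I.encode_zero]
    omega
  · simp only [initState, if_true]
    rw [pairWord, add_comm, List.getD_cons_succ, List.getD_append _ _ _ _ hi]

theorem certifies_pairState (I : Instance) (y : List ℕ) :
    Certifies I (pairState I.encode y) (fun q => y.getD q 0)
      (fun q v => y.getD (2 + q * I.n + v) 0) where
  toPrepared := prepared_pairState I y
  den q env := by simp [Expr.den, eval_cert]
  num q env a v ha := by
    simp [Expr.num, eval_cert, ha, (prepared_pairState I y).dim]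

theorem size_le_of_lt_two_pow_sq (n x : ℕ) (h : x ≤ n.factorial * 2 ^ n) :
    x.size ≤ n * n + n + 1 := by
  refine Nat.size_le.mpr (lt_of_le_of_lt (h.trans (Nat.mul_le_mul_right _ n.factorial_le_pow)) ?_)
  calc n ^ n * 2 ^ n ≤ (2 ^ n) ^ n * 2 ^ n :=
        Nat.mul_le_mul_right _ (Nat.pow_le_pow_left n.lt_two_pow_self.le _)
    _ = 2 ^ (n * n + n) := by rw [← pow_mul, ← pow_add]
    _ < 2 ^ (n * n + n + 1) := Nat.pow_lt_pow_right (by omega) (by omega)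

theorem wordSize_le {y : List ℕ} {b : ℕ} (h : ∀ x ∈ y, x.size ≤ b) :
    wordSize y ≤ y.length * (b + 1) := by
  rw [wordSize]
  refine (List.sum_le_card_nsmul _ (b + 1) ?_).trans (by simp)
  simp only [List.mem_map]
  rintro _ ⟨x, hx, rfl⟩
  exact Nat.succ_le_succ (h x hx)

/-- A bound for the size of the certificates. -/
noncomputable def certBound : Polynomial ℕ :=
  -- A certificate has two denominators and `2 * n` numerators, each of at most `n * n + n + 1` bits
  -- and a delimiter.
  (2 * Polynomial.X + 2) * (Polynomial.X * Polynomial.X + Polynomial.X + 2)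

/-- Certificates exist whatever the answer is: they list the values of Richman functions, which
`IsRichman.exists_denominator` makes short. They therefore serve for the problem and for its
complement. -/
theorem exists_cert (I : Instance) : ∃ y : List ℕ,
    wordSize y ≤ certBound.eval (wordSize I.encode) ∧
    ∀ env q, (Expr.richman q).Holds (pairState I.encode y) env := by
  have key : ∀ q : Fin 2, ∃ (D : ℕ) (N : Fin I.n → ℕ), D ≠ 0 ∧ D ≤ I.n.factorial * 2 ^ I.n ∧
      (∀ v, N v ≤ D) ∧
      IsRichman ((I.obj q).edge I.graph) (I.obj q).color fun v => (N v : ℝ) / D := by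
    intro q
    obtain ⟨f, hf⟩ := exists_isRichman ((I.obj q).edge I.graph) ((I.obj q).exists_edge I.graph)
      (I.obj q).color
    obtain ⟨D, N, hD, hle, hN⟩ := hf.exists_denominator ((I.obj q).exists_edge I.graph)
    have hD' : (0 : ℝ) < D := by exact_mod_cast hD
    have hf' : (fun v => (N v : ℝ) / D) = f := by
      funext v
      rw [← hN v]
      field_simp
    refine ⟨D, N, hD.ne', by simpa using hle, fun v => ?_, hf' ▸ hf⟩
    have := mul_le_mul_of_nonneg_left (hf.le_one v) hD'.le
    rw [hN v, mul_one] at this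
    exact_mod_cast this
  choose D N hD hle hN hf using key
  set y : List ℕ := D 0 :: D 1 :: (List.ofFn (N 0) ++ List.ofFn (N 1)) with hy
  have hyD : ∀ q : Fin 2, y.getD q 0 = D q := by
    intro q
    fin_cases q <;> simp [hy]
  have hyN : ∀ (q : Fin 2) (v : Fin I.n), y.getD (2 + q * I.n + v) 0 = N q v := by
    intro q v
    have hv := v.2
    rw [show 2 + (q : ℕ) * I.n + v = (q * I.n + v) + 1 + 1 by ring, hy, List.getD_cons_succ,
      List.getD_cons_succ]
    obtain rfl | rfl : q = 0 ∨ q = 1 := by omega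
    · simp only [Fin.val_zero, zero_mul, zero_add]
      rw [List.getD_append _ _ _ _ (by simp), List.getD_eq_getElem _ _ (by simp)]
      simp
    · simp only [Fin.val_one, one_mul]
      rw [List.getD_append_right _ _ _ _ (by simp), List.getD_eq_getElem _ _ (by simp)]
      simp
  refine ⟨y, ?_, fun env q => ((certifies_pairState I y).holds_richman q).mpr ?_⟩
  · have hn : I.n ≤ wordSize I.encode := by
      refine le_trans ?_ (length_le_wordSize _)
      rw [I.length_encode]
      omega
    have hsize : ∀ x ∈ y, x.size ≤ I.n * I.n + I.n + 1 := by
      intro x hx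
      refine size_le_of_lt_two_pow_sq _ _ ?_
      simp only [hy, List.mem_cons, List.mem_append, List.mem_ofFn] at hx
      rcases hx with rfl | rfl | ⟨v, rfl⟩ | ⟨v, rfl⟩
      · exact hle 0
      · exact hle 1
      · exact (hN 0 v).trans (hle 0)
      · exact (hN 1 v).trans (hle 1)
    refine (wordSize_le hsize).trans ?_
    have hlen : y.length = 2 * I.n + 2 := by simp [hy]; ring
    rw [hlen]
    simp only [certBound, Polynomial.eval_mul, Polynomial.eval_add, Polynomial.eval_X,
      Polynomial.eval_ofNat]
    have hnn := Nat.mul_le_mul hn hn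
    exact Nat.mul_le_mul (by omega) (by omega)
  · rw [hyD]
    refine ⟨hD q, ?_⟩
    have : (fun v : Fin I.n => ((y.getD (2 + q * I.n + v) 0 : ℕ) : ℝ) / D q) =
        fun v => (N q v : ℝ) / D q := funext fun v => by rw [hyN]
    rw [this]
    exact hf q

theorem inNP_of_verifier {L : Set (List ℕ)} (e : Expr)
    (h : ∀ w, w ∈ L ↔ ∃ y : List ℕ, wordSize y ≤ certBound.eval (wordSize w) ∧
      e.Holds (pairState w y) fun _ => 0) : InNP L := by
  -- The exponent `0` in the cut-off suffices, because the verifier tabulates truth values only.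
  refine ⟨{u | u ≠ [] ∧ e.bool.eval ((Stmt.prepare 1).run (initState 0 1 u)) (fun _ => 0) = 1},
    certBound, inP_of_stmt 0 1 (Stmt.prepare 1) e.bool fun u => Iff.rfl, fun w => ?_⟩
  rw [h w]
  refine exists_congr fun y => and_congr_right fun _ => ?_
  rw [Set.mem_ofPred_eq, Expr.eval_bool_eq_one]
  simp [pairWord, pairState]

theorem inNP_strongSynt : InNP StrongSynt := by
  refine inNP_of_verifier (.and (.valid 1 .fstLen) (.and (.richman 0) (.and (.richman 1) .sumLt)))
    fun w => ?_
  simp only [Expr.holds_and, holds_valid_pairState, Instance.mem_strongSynt_iff]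
  constructor
  · rintro ⟨I, rfl, hI⟩
    obtain ⟨y, hy, hr⟩ := exists_cert I
    exact ⟨y, hy, ⟨I, rfl⟩, hr _ 0, hr _ 1,
      ((certifies_pairState I y).holds_sumLt (hr _ 0) (hr _ 1)).mpr hI⟩
  · rintro ⟨y, -, ⟨I, rfl⟩, h₁, h₂, h⟩
    exact ⟨I, rfl, ((certifies_pairState I y).holds_sumLt h₁ h₂).mp h⟩

/-- A certified pair of Richman functions settles the sum of the thresholds either way. Words that
encode no instance are accepted outright. -/
theorem inCoNP_strongSynt : InCoNP StrongSynt := by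
  refine inNP_of_verifier (.or (.neg (.valid 1 .fstLen))
    (.and (.richman 0) (.and (.richman 1) (.neg .sumLt)))) fun w => ?_
  simp only [Expr.holds_or, Expr.holds_neg, Expr.holds_and, holds_valid_pairState,
    Set.mem_compl_iff, Instance.mem_strongSynt_iff]
  constructor
  · intro hw
    by_cases hv : ∃ I : Instance, I.encode = w
    · obtain ⟨I, rfl⟩ := hv
      obtain ⟨y, hy, hr⟩ := exists_cert I
      refine ⟨y, hy, Or.inr ⟨hr _ 0, hr _ 1, fun h => hw ⟨I, rfl, ?_⟩⟩⟩
      exact ((certifies_pairState I y).holds_sumLt (hr _ 0) (hr _ 1)).mp h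
    · exact ⟨[], by simp [wordSize], Or.inl hv⟩
  · rintro ⟨y, -, h⟩ ⟨I, rfl, hI⟩
    rcases h with h | ⟨h₁, h₂, h⟩
    · exact h ⟨I, rfl⟩
    · exact h (((certifies_pairState I y).holds_sumLt h₁ h₂).mpr hI)

end RAM

/-! ### Approximation of Richman functions by squaring a stochastic matrix -/

section Approximation

variable {V : Type*} [Fintype V]

/-- The square of a matrix in units of `1 / U`, rounded down. -/
def roundedSq (U : ℕ) (M : V → V → ℕ) (i j : V) : ℕ := (∑ u, M i u * M u j) / U

/-- In units of `1 / U`, and up to the error `e`, the matrix `M` is stochastic, it preserves `f`, and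
it contracts `φ` by `c`. -/
structure IsApprox (U : ℕ) (f φ : V → ℝ) (M : V → V → ℕ) (e : ℕ) (c : ℝ) : Prop where
  le : ∀ i, ∑ j, M i j * f j ≤ U * f i
  le' : ∀ i, ∑ j, M i j * (1 - f j) ≤ U * (1 - f i)
  ge : ∀ i, (U : ℝ) ≤ ∑ j, (M i j : ℝ) + e
  decay : ∀ i, ∑ j, M i j * φ j ≤ U * c * φ i

namespace IsApprox

variable {U : ℕ} {f φ : V → ℝ} {M : V → V → ℕ} {e : ℕ} {c : ℝ}

/-- The sum of `le` and `le'`. -/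
theorem row_sum_le (h : IsApprox U f φ M e c) (i : V) : ∑ j, (M i j : ℝ) ≤ U := by
  have h1 := h.le i
  have h2 := h.le' i
  simp only [mul_sub, mul_one, Finset.sum_sub_distrib] at h2
  linarith

theorem entry_le (h : IsApprox U f φ M e c) (i j : V) : M i j ≤ U := by
  have h1 := h.row_sum_le i
  have h2 := Finset.single_le_sum (f := fun j => M i j) (fun j _ => Nat.zero_le _)
    (Finset.mem_univ j)
  have h3 : ∑ j, M i j ≤ U := by exact_mod_cast h1
  exact h2.trans h3

/-- Rounding down only decreases the sums, so an upper bound of this form, applied twice, survives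
squaring with `b` replaced by `b * b`. -/
theorem sum_roundedSq_le (hU : 0 < U) {g : V → ℝ} {b : ℝ} (hg : ∀ v, 0 ≤ g v) (hb : 0 ≤ b)
    (h : ∀ i, ∑ j, M i j * g j ≤ U * b * g i) (i : V) :
    ∑ j, roundedSq U M i j * g j ≤ U * (b * b) * g i := by
  have hU' : (0 : ℝ) < U := by exact_mod_cast hU
  calc ∑ j, (roundedSq U M i j : ℝ) * g j
      ≤ ∑ j, ((∑ u, (M i u : ℝ) * M u j) / U) * g j := by
        refine Finset.sum_le_sum fun j _ => mul_le_mul_of_nonneg_right ?_ (hg j)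
        refine Nat.cast_div_le.trans (le_of_eq ?_)
        push_cast
        rfl
    _ = (∑ u, M i u * ∑ j, M u j * g j) / U := by
        simp only [Finset.sum_div, Finset.mul_sum, Finset.sum_mul]
        rw [Finset.sum_comm]
        refine Finset.sum_congr rfl fun u _ => Finset.sum_congr rfl fun j _ => ?_
        ring
    _ ≤ (∑ u, M i u * (U * b * g u)) / U := by
        gcongr with u
        exact h u
    _ = b * ∑ u, M i u * g u := by
        rw [div_eq_iff hU'.ne', Finset.mul_sum, Finset.sum_mul]
        refine Finset.sum_congr rfl fun u _ => ?_
        ring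
    _ ≤ b * (U * b * g i) := by
        gcongr
        exact h i
    _ = U * (b * b) * g i := by ring

/-- Upper bounds are stable under rounding down, and only the row sums suffer. The square loses the
defect `e` of each of its two factors, and each of its entries loses at most one unit. -/
theorem roundedSq (hU : 0 < U) (hf : ∀ v, 0 ≤ f v) (hf' : ∀ v, f v ≤ 1) (hφ : ∀ v, 0 ≤ φ v)
    (hc : 0 ≤ c) (h : IsApprox U f φ M e c) :
    IsApprox U f φ (roundedSq U M) (2 * e + Fintype.card V) (c * c) where
  le i := by
    simpa using sum_roundedSq_le hU hf zero_le_one (by simpa using h.le) i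
  le' i := by
    simpa using sum_roundedSq_le (g := fun v => 1 - f v) hU (fun v => sub_nonneg.mpr (hf' v))
      zero_le_one (by simpa using h.le') i
  decay i := sum_roundedSq_le hU hφ hc h.decay i
  ge i := by
    have hU' : (0 : ℝ) < U := by exact_mod_cast hU
    have h1 : ∀ j, ((∑ u, (M i u : ℝ) * M u j) / U) - 1 ≤ _root_.roundedSq U M i j := by
      intro j
      have h2 : ((∑ u, M i u * M u j : ℕ) : ℝ) / U < ((∑ u, M i u * M u j) / U : ℕ) + 1 := by
        rw [div_lt_iff₀ hU']
        have := Nat.lt_mul_div_succ (∑ u, M i u * M u j) hU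
        rw [mul_comm] at this
        exact_mod_cast this
      push_cast at h2
      rw [_root_.roundedSq]
      linarith
    have h2 : ∑ j, (((∑ u, (M i u : ℝ) * M u j) / U) - 1) ≤
        ∑ j, (_root_.roundedSq U M i j : ℝ) := Finset.sum_le_sum fun j _ => h1 j
    have h3 : ∑ j, (((∑ u, (M i u : ℝ) * M u j) / U) - 1) =
        (∑ u, M i u * ∑ j, (M u j : ℝ)) / U - Fintype.card V := by
      rw [Finset.sum_sub_distrib]
      simp only [Finset.sum_const, Finset.card_univ, nsmul_eq_mul, mul_one]
      rw [← Finset.sum_div, Finset.sum_comm]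
      simp only [Finset.mul_sum]
    have h4 : ∑ u, M i u * ((U : ℝ) - e) ≤ ∑ u, M i u * ∑ j, (M u j : ℝ) := by
      gcongr with u
      linarith [h.ge u]
    rw [← Finset.sum_mul] at h4
    have h5 := h.row_sum_le i
    have h6 := h.ge i
    have h7 : (U : ℝ) * (U - 2 * e) ≤ ∑ u, M i u * ∑ j, (M u j : ℝ) := by
      have he : (0 : ℝ) ≤ e := by positivity
      nlinarith
    have h8 : (U : ℝ) - 2 * e ≤ (∑ u, M i u * ∑ j, (M u j : ℝ)) / U := by
      rw [le_div_iff₀ hU']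
      linarith
    push_cast
    linarith

theorem iterate (hU : 0 < U) (hf : ∀ v, 0 ≤ f v) (hf' : ∀ v, f v ≤ 1) (hφ : ∀ v, 0 ≤ φ v)
    (hc : 0 ≤ c) (h : IsApprox U f φ M 0 c) (k : ℕ) :
    ∃ e', e' ≤ Fintype.card V * 2 ^ k ∧
      IsApprox U f φ ((_root_.roundedSq U)^[k] M) e' (c ^ 2 ^ k) := by
  -- The recursion `e ↦ 2 * e + card V` doubles `e + card V`.
  suffices ∃ e', e' + Fintype.card V ≤ Fintype.card V * 2 ^ k ∧
      IsApprox U f φ ((_root_.roundedSq U)^[k] M) e' (c ^ 2 ^ k) by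
    obtain ⟨e', h1, h2⟩ := this
    exact ⟨e', by omega, h2⟩
  induction k with
  | zero => exact ⟨0, by simp, by simpa using h⟩
  | succ k ih =>
    obtain ⟨e', he', h'⟩ := ih
    refine ⟨2 * e' + Fintype.card V, ?_, ?_⟩
    · rw [pow_succ, ← mul_assoc]
      omega
    · rw [Function.iterate_succ_apply', pow_succ, mul_two, pow_add]
      exact h'.roundedSq hU hf hf' hφ (by positivity)

end IsApprox

open Classical in
/-- The transition matrix of the random walk on `E` that stops at the bottom components, in units of
`1 / U`. -/
noncomputable def walkMatrix (U : ℕ) (E : V → V → Prop) (i j : V) : ℕ :=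
  if IsBottom E i then (if i = j then U else 0)
  else if E i j then U / Finset.card {w | E i w} else 0

/-- A single successor is listed twice, so the row is the mean over a pair in every case. Evenness
of `U` makes the division by `2` exact. -/
theorem exists_succ_pair {E : V → V → Prop} (hE : ∀ v, ∃ w, E v w)
    (hb : ∀ v, {w | E v w}.encard ≤ 2) {U : ℕ} (hU : 2 ∣ U) {v : V} (hv : ¬ IsBottom E v) :
    ∃ x y, E v x ∧ E v y ∧ (∀ w, E v w → w = x ∨ w = y) ∧
      ∀ g : V → ℝ, 2 * ∑ j, walkMatrix U E v j * g j = U * (g x + g y) := by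
  classical
  have hs : ({w | E v w} : Set V) = (Finset.univ.filter fun w => E v w : Finset V) := by simp
  have hcard : (Finset.univ.filter fun w => E v w).card ≤ 2 := by
    have := hb v
    rw [hs, Set.encard_coe_eq_coe_finsetCard] at this
    exact_mod_cast this
  have hpos : 0 < (Finset.univ.filter fun w => E v w).card := by
    obtain ⟨w, hw⟩ := hE v
    exact Finset.card_pos.mpr ⟨w, by simpa using hw⟩
  have hsum : ∀ g : V → ℝ, ∑ j, walkMatrix U E v j * g j =
      ∑ j ∈ Finset.univ.filter fun w => E v w,
        ((U / (Finset.univ.filter fun w => E v w).card : ℕ) : ℝ) * g j := by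
    intro g
    rw [Finset.sum_filter]
    refine Finset.sum_congr rfl fun j _ => ?_
    rw [walkMatrix, if_neg hv]
    split_ifs <;> simp
  have hmem : ∀ w, E v w ↔ w ∈ Finset.univ.filter fun w => E v w := fun w => by simp
  obtain h1 | h2 : (Finset.univ.filter fun w => E v w).card = 1 ∨
      (Finset.univ.filter fun w => E v w).card = 2 := by omega
  · obtain ⟨x, hx⟩ := Finset.card_eq_one.mp h1
    refine ⟨x, x, ?_, ?_, fun w hw => ?_, fun g => ?_⟩
    · rw [hmem, hx]; simp
    · rw [hmem, hx]; simp
    · rw [hmem, hx] at hw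
      exact Or.inl (by simpa using hw)
    · rw [hsum, h1, hx]
      simp
      ring
  · obtain ⟨x, y, hxy, hx⟩ := Finset.card_eq_two.mp h2
    refine ⟨x, y, ?_, ?_, fun w hw => ?_, fun g => ?_⟩
    · rw [hmem, hx]; simp
    · rw [hmem, hx]; simp
    · rw [hmem, hx] at hw
      simpa using hw
    · rw [hsum, h2, hx, Finset.sum_pair hxy]
      obtain ⟨m, rfl⟩ := hU
      simp
      ring

/-- With at most two successors, the mean of the extreme values of `f` is the mean over the
successors, so the walk preserves `f`. For the decay let `t = 3 ^ (-d v)`: some successor is closer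
to the bottom components and has `φ ≤ 1 - 3 * t`, the other one has `φ ≤ 1`, and the mean `1 - 3/2 *
t` is at most `(1 - 3 ^ (-n) / 2) * (1 - t)` because `3 ^ (-n) ≤ t`. -/
theorem isApprox_walkMatrix {E : V → V → Prop} {col : V → ℕ} {f : V → ℝ} (hE : ∀ v, ∃ w, E v w)
    (hb : ∀ v, {w | E v w}.encard ≤ 2) (hf : IsRichman E col f) {U : ℕ} (hU : 2 ∣ U)
    {d : V → ℕ} (hd₀ : ∀ v, IsBottom E v → d v = 0) {n : ℕ} (hn : ∀ v, d v ≤ n)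
    (hd : ∀ v, ¬ IsBottom E v → ∃ w, E v w ∧ d w < d v) :
    IsApprox U f (fun v => 1 - (1 / 3 : ℝ) ^ d v) (walkMatrix U E) 0
      (1 - (1 / 3 : ℝ) ^ n / 2) := by
  classical
  have hbot : ∀ v, IsBottom E v → ∀ g : V → ℝ, ∑ j, walkMatrix U E v j * g j = U * g v := by
    intro v hv g
    simp [walkMatrix, hv]
  have havg : ∀ v, ¬ IsBottom E v → ∑ j, walkMatrix U E v j * f j = U * f v := by
    intro v hv
    obtain ⟨x, y, hx, hy, hxy, hg⟩ := exists_succ_pair hE hb hU hv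
    obtain ⟨p, q, hp, hq, hpq, h⟩ := hf.avg v hv
    have hsum : f p + f q = f x + f y := by
      have h1 := hpq x hx
      have h2 := hpq y hy
      rcases hxy p hp with rfl | rfl <;> rcases hxy q hq with rfl | rfl <;> linarith
    have := hg f
    rw [← hsum, ← h] at this
    linarith
  have hone : ∀ v, ∑ j, (walkMatrix U E v j : ℝ) = U := by
    intro v
    by_cases hv : IsBottom E v
    · simpa using hbot v hv fun _ => 1
    · obtain ⟨x, y, -, -, -, hg⟩ := exists_succ_pair hE hb hU hv
      have := hg fun _ => 1
      simp only [mul_one] at this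
      linarith
  have hpres : ∀ v, ∑ j, walkMatrix U E v j * f j = U * f v := fun v => by
    by_cases hv : IsBottom E v
    · exact hbot v hv f
    · exact havg v hv
  refine ⟨fun v => (hpres v).le, fun v => ?_, fun v => by simp [hone], fun v => ?_⟩
  · simp only [mul_sub, mul_one, Finset.sum_sub_distrib, hone, hpres]
    exact le_rfl
  by_cases hv : IsBottom E v
  · rw [hbot v hv]
    simp [hd₀ v hv]
  obtain ⟨x, y, hx, hy, hxy, hg⟩ := exists_succ_pair hE hb hU hv
  obtain ⟨w, hw, hwd⟩ := hd v hv
  have hU' : (0 : ℝ) ≤ U := by positivity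
  have hpow : 3 * (1 / 3 : ℝ) ^ d v ≤ (1 / 3 : ℝ) ^ d w := by
    have : (1 / 3 : ℝ) ^ (d v - 1) ≤ (1 / 3 : ℝ) ^ d w :=
      pow_le_pow_of_le_one (by norm_num) (by norm_num) (by omega)
    refine le_trans (le_of_eq ?_) this
    obtain ⟨k, hk⟩ : ∃ k, d v = k + 1 := ⟨d v - 1, by omega⟩
    rw [hk, Nat.add_sub_cancel, pow_succ]
    ring
  have hpos : ∀ k : ℕ, (0 : ℝ) < (1 / 3 : ℝ) ^ k := fun k => by positivity
  have hmn : (1 / 3 : ℝ) ^ n ≤ (1 / 3 : ℝ) ^ d v :=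
    pow_le_pow_of_le_one (by norm_num) (by norm_num) (hn v)
  have hle : (1 - (1 / 3 : ℝ) ^ d x) + (1 - (1 / 3 : ℝ) ^ d y) ≤
      2 * ((1 - (1 / 3 : ℝ) ^ n / 2) * (1 - (1 / 3 : ℝ) ^ d v)) := by
    have h1 := hpos (d x)
    have h2 := hpos (d y)
    have h3 := hpos (d v)
    have h4 := hpos n
    have h5 : (1 - (1 / 3 : ℝ) ^ d x) + (1 - (1 / 3 : ℝ) ^ d y) ≤ 2 - 3 * (1 / 3 : ℝ) ^ d v := by
      rcases hxy w hw with rfl | rfl <;> linarith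
    nlinarith
  have := hg fun v => 1 - (1 / 3 : ℝ) ^ d v
  have h6 := mul_le_mul_of_nonneg_left hle hU'
  linarith

open Classical in
/-- The probability that the walk from `i` has stopped at an odd bottom component after `2 ^ k` steps,
in units of `1 / U`, approximately. -/
noncomputable def oddMass (U : ℕ) (E : V → V → Prop) (col : V → ℕ) (k : ℕ) (i : V) : ℕ :=
  ∑ j, if IsBottom E j ∧ ¬ EvenTop E col j then (roundedSq U)^[k] (walkMatrix U E) i j else 0

/-- The walk on a binary graph, stopped at the bottom components, approximates the thresholds. -/
theorem IsRichman.oddMass_bounds {E : V → V → Prop} {col : V → ℕ} {f : V → ℝ}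
    (hE : ∀ v, ∃ w, E v w) (hb : ∀ v, {w | E v w}.encard ≤ 2) (hf : IsRichman E col f) {U : ℕ}
    (hU : 2 ∣ U) (hU₀ : 0 < U) (k : ℕ) :
    (∀ i j, (roundedSq U)^[k] (walkMatrix U E) i j ≤ U) ∧ ∀ i,
    oddMass U E col k i ≤ U * f i ∧
    U * f i ≤ oddMass U E col k i + (Fintype.card V * 2 ^ k +
      3 / 2 * (U * (1 - (1 / 3 : ℝ) ^ Fintype.card V / 2) ^ 2 ^ k)) := by
  classical
  obtain ⟨d', hd'⟩ := exists_dist E {v | IsBottom E v} fun v => by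
    obtain ⟨t, ht, hr⟩ := exists_reach_topSet E col v
    exact ⟨t, ht.1, hr⟩
  obtain ⟨r, hr, hrd⟩ := exists_rank d'
  rw [Nat.card_eq_fintype_card] at hr
  let d : V → ℕ := fun v => if IsBottom E v then 0 else r v + 1
  have hd₀ : ∀ v, IsBottom E v → d v = 0 := fun v hv => if_pos hv
  have hdn : ∀ v, d v ≤ Fintype.card V := fun v => by
    simp only [d]
    split_ifs
    · omega
    · exact hr v
  have hd : ∀ v, ¬ IsBottom E v → ∃ w, E v w ∧ d w < d v := fun v hv => by
    obtain ⟨w, hw, h⟩ := hd' v hv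
    refine ⟨w, hw, ?_⟩
    have := hrd v w h
    simp only [d, hv, if_false]
    split_ifs <;> omega
  have happ := isApprox_walkMatrix hE hb hf hU hd₀ hdn hd
  set φ : V → ℝ := fun v => 1 - (1 / 3 : ℝ) ^ d v with hφ
  have hpow : ∀ m : ℕ, (1 / 3 : ℝ) ^ m ≤ 1 := fun m => pow_le_one₀ (by norm_num) (by norm_num)
  have hφ₀ : ∀ v, 0 ≤ φ v := fun v => by
    have := hpow (d v)
    simp only [hφ]
    linarith
  set c : ℝ := 1 - (1 / 3 : ℝ) ^ Fintype.card V / 2 with hc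
  have hc₀ : 0 ≤ c := by
    have := hpow (Fintype.card V)
    linarith
  obtain ⟨e, he, h⟩ := happ.iterate hU₀ hf.nonneg hf.le_one hφ₀ hc₀ k
  set M := (roundedSq U)^[k] (walkMatrix U E) with hM
  refine ⟨h.entry_le, fun i => ?_⟩
  -- At the bottom vertices `f` is the indicator of the odd components, so `oddMass` differs from
  -- the preserved sum only by the mass that has not stopped yet.
  have hsplit : ∑ j, M i j * f j = oddMass U E col k i +
      ∑ j ∈ Finset.univ.filter (fun v => ¬ IsBottom E v), M i j * f j := by
    rw [Finset.sum_filter, oddMass, Nat.cast_sum, ← Finset.sum_add_distrib, ← hM]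
    refine Finset.sum_congr rfl fun j _ => ?_
    by_cases hj : IsBottom E j
    · by_cases hj' : EvenTop E col j
      · simp [hj, hj', hf.bottom_even j hj hj']
      · simp [hj, hj', hf.bottom_odd j hj hj']
    · simp [hj]
  have hint₀ : 0 ≤ ∑ j ∈ Finset.univ.filter (fun v => ¬ IsBottom E v), M i j * f j :=
    Finset.sum_nonneg fun j _ => mul_nonneg (by positivity) (hf.nonneg j)
  have hint : ∑ j ∈ Finset.univ.filter (fun v => ¬ IsBottom E v), M i j * f j ≤
      3 / 2 * (U * c ^ 2 ^ k) := by
    calc ∑ j ∈ Finset.univ.filter (fun v => ¬ IsBottom E v), M i j * f j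
        ≤ ∑ j ∈ Finset.univ.filter (fun v => ¬ IsBottom E v), 3 / 2 * (M i j * φ j) := by
          refine Finset.sum_le_sum fun j hj => ?_
          have hj' : ¬ IsBottom E j := by simpa using hj
          obtain ⟨m, hm⟩ : ∃ m, d j = m + 1 := ⟨r j, if_neg hj'⟩
          -- Off the bottom components `d j ≥ 1`, so `φ j ≥ 2 / 3`.
          have h1 : 1 ≤ 3 / 2 * φ j := by
            simp only [hφ, hm, pow_succ]
            linarith [hpow m]
          have h2 : (0 : ℝ) ≤ M i j := by positivity
          have h3 := hf.le_one j
          nlinarith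
      _ ≤ ∑ j, 3 / 2 * (M i j * φ j) := by
          refine Finset.sum_le_univ_sum_of_nonneg fun j => ?_
          have := hφ₀ j
          positivity
      _ ≤ 3 / 2 * (U * c ^ 2 ^ k * φ i) := by
          rw [← Finset.mul_sum]
          exact mul_le_mul_of_nonneg_left (h.decay i) (by norm_num)
      _ ≤ 3 / 2 * (U * c ^ 2 ^ k) := by
          have h1 : φ i ≤ 1 := by
            have : (0 : ℝ) ≤ (1 / 3 : ℝ) ^ d i := by positivity
            simp only [hφ]
            linarith
          have h2 : (0 : ℝ) ≤ U * c ^ 2 ^ k := by positivity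
          nlinarith
  have h1 := h.le i
  have h2 := h.le' i
  have h3 := h.ge i
  simp only [mul_sub, mul_one, Finset.sum_sub_distrib] at h2
  have he' : (e : ℝ) ≤ Fintype.card V * 2 ^ k := by exact_mod_cast he
  exact ⟨by linarith, by linarith⟩

end Approximation

/-! ### Rounding errors -/

theorem eight_mul_sq_pow_le (n : ℕ) : (8 * n * n) ^ n ≤ 2 ^ (2 * n * n + 3 * n) := by
  calc (8 * n * n) ^ n ≤ (2 ^ 3 * 2 ^ n * 2 ^ n) ^ n := by
        have := n.lt_two_pow_self.le
        gcongr
        norm_num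
    _ = 2 ^ (2 * n * n + 3 * n) := by
        rw [← pow_add, ← pow_add, ← pow_mul]
        congr 1
        ring

/-- The base is at most `exp (-3 ^ (-n) / 2)`, and `2 ^ (8 * n)` steps with `3 ^ n ≤ 4 ^ n` bring
the power below `2 ^ (-2 ^ (6 * n - 1))`. This doubly exponential decay beats `(8 * n * n) ^ n`,
which has only about `2 * n * n` bits. -/
theorem walk_decay_le {n : ℕ} (hn : 0 < n) :
    6 * ((8 * n * n) ^ n : ℕ) * (1 - (1 / 3 : ℝ) ^ n / 2) ^ 2 ^ (8 * n) ≤ 1 := by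
  have hexp : (1 - (1 / 3 : ℝ) ^ n / 2) ^ 2 ^ (8 * n) ≤ (1 / 2 : ℝ) ^ 2 ^ (6 * n - 1) := by
    have h1 : 1 - (1 / 3 : ℝ) ^ n / 2 ≤ Real.exp (-((1 / 3 : ℝ) ^ n / 2)) :=
      Real.one_sub_le_exp_neg _
    have h0 : 0 ≤ 1 - (1 / 3 : ℝ) ^ n / 2 := by
      have : (1 / 3 : ℝ) ^ n ≤ 1 := pow_le_one₀ (by norm_num) (by norm_num)
      linarith
    have h2 : (2 : ℝ) ^ (6 * n - 1) ≤ 2 ^ (8 * n) * ((1 / 3 : ℝ) ^ n / 2) := by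
      have h3 : (1 / 4 : ℝ) ^ n ≤ (1 / 3 : ℝ) ^ n :=
        pow_le_pow_left₀ (by norm_num) (by norm_num) n
      have h4 : (2 : ℝ) ^ (6 * n - 1) * 2 = 2 ^ (8 * n) * (1 / 4 : ℝ) ^ n := by
        rw [← pow_succ, show 6 * n - 1 + 1 = 6 * n by omega, show 8 * n = 6 * n + 2 * n by ring,
          pow_add, mul_assoc, pow_mul 2 2 n, ← mul_pow]
        norm_num
      have h5 := mul_le_mul_of_nonneg_left h3 (show (0 : ℝ) ≤ 2 ^ (8 * n) by positivity)
      linarith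
    have h6 : Real.exp (-1) ≤ 1 / 2 := by
      rw [Real.exp_neg, ← one_div]
      exact one_div_le_one_div_of_le (by norm_num) (by linarith [Real.add_one_le_exp (1 : ℝ)])
    calc (1 - (1 / 3 : ℝ) ^ n / 2) ^ 2 ^ (8 * n)
        ≤ Real.exp (-((1 / 3 : ℝ) ^ n / 2)) ^ 2 ^ (8 * n) := pow_le_pow_left₀ h0 h1 _
      _ = Real.exp (-(2 ^ (8 * n) * ((1 / 3 : ℝ) ^ n / 2))) := by
          rw [← Real.exp_nat_mul]
          push_cast
          ring_nf
      _ ≤ Real.exp (-(2 : ℝ) ^ (6 * n - 1)) := Real.exp_le_exp.mpr (by linarith)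
      _ = Real.exp (-1) ^ 2 ^ (6 * n - 1) := by
          rw [← Real.exp_nat_mul]
          push_cast
          ring_nf
      _ ≤ (1 / 2 : ℝ) ^ 2 ^ (6 * n - 1) := pow_le_pow_left₀ (Real.exp_pos _).le h6 _
  have hm : 2 * n * n + 3 * n + 3 ≤ 2 ^ (6 * n - 1) := by
    obtain ⟨k, rfl⟩ : ∃ k, n = k + 1 := ⟨n - 1, by omega⟩
    have h1 : k + 1 ≤ 2 ^ k := k.lt_two_pow_self
    have h2 : 2 ^ (6 * (k + 1) - 1) = 32 * (2 ^ k * 2 ^ k) * 2 ^ (4 * k) := by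
      rw [show 6 * (k + 1) - 1 = 5 + (k + k) + 4 * k by omega, pow_add, pow_add, pow_add]
      norm_num
    have h3 : 1 ≤ 2 ^ (4 * k) := Nat.one_le_two_pow
    have h4 := Nat.mul_le_mul h1 h1
    have h5 := Nat.mul_le_mul_left (32 * (2 ^ k * 2 ^ k)) h3
    rw [h2]
    nlinarith
  have hS : 6 * (8 * n * n) ^ n ≤ 2 ^ 2 ^ (6 * n - 1) := by
    calc 6 * (8 * n * n) ^ n ≤ 2 ^ 3 * 2 ^ (2 * n * n + 3 * n) :=
          Nat.mul_le_mul (by norm_num) (eight_mul_sq_pow_le n)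
      _ = 2 ^ (2 * n * n + 3 * n + 3) := by rw [← pow_add, add_comm]
      _ ≤ 2 ^ 2 ^ (6 * n - 1) := Nat.pow_le_pow_right (by omega) hm
  have hS' : (6 * ((8 * n * n) ^ n : ℕ) : ℝ) ≤ 2 ^ 2 ^ (6 * n - 1) := by exact_mod_cast hS
  calc 6 * ((8 * n * n) ^ n : ℕ) * (1 - (1 / 3 : ℝ) ^ n / 2) ^ 2 ^ (8 * n)
      ≤ 6 * ((8 * n * n) ^ n : ℕ) * (1 / 2 : ℝ) ^ 2 ^ (6 * n - 1) :=
        mul_le_mul_of_nonneg_left hexp (by positivity)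
    _ ≤ 2 ^ 2 ^ (6 * n - 1) * (1 / 2 : ℝ) ^ 2 ^ (6 * n - 1) :=
        mul_le_mul_of_nonneg_right hS' (by positivity)
    _ = 1 := by rw [← mul_pow]; norm_num

/-- One half of `U / (8 * n * n) ^ n` absorbs the accumulated rounding and the rounding of the
quotient itself, since `U` has enough bits. The other half absorbs the mass that has not stopped, by
`walk_decay_le`. -/
theorem error_le_slack {n U : ℕ} (hn : 0 < n) (hU : 2 ^ (8 * (2 + n * n + 2 * (n + 1))) ≤ U) :
    2 * (n * 2 ^ (8 * n) + 3 / 2 * (U * (1 - (1 / 3 : ℝ) ^ n / 2) ^ 2 ^ (8 * n))) ≤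
      (U / (8 * n * n) ^ n : ℕ) := by
  have hS : 0 < (8 * n * n) ^ n := by positivity
  have hS' : (0 : ℝ) < ((8 * n * n) ^ n : ℕ) := by exact_mod_cast hS
  have hdec := walk_decay_le hn
  have hround : (2 * (n * 2 ^ (8 * n)) + 1) * (2 * (8 * n * n) ^ n) ≤ U := by
    have h1 : 2 * (n * 2 ^ (8 * n)) + 1 ≤ 2 ^ (9 * n + 2) := by
      have h2 : n * 2 ^ (8 * n) ≤ 2 ^ n * 2 ^ (8 * n) :=
        Nat.mul_le_mul_right _ n.lt_two_pow_self.le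
      rw [← pow_add, show n + 8 * n = 9 * n by ring] at h2
      have h3 : 1 ≤ 2 ^ (9 * n) := Nat.one_le_two_pow
      rw [pow_add]
      omega
    refine le_trans (Nat.mul_le_mul h1 (Nat.mul_le_mul_left 2 (eight_mul_sq_pow_le n))) ?_
    refine le_trans ?_ hU
    rw [← pow_succ', ← pow_add]
    refine Nat.pow_le_pow_right (by omega) ?_
    nlinarith
  have hfloor : (U : ℝ) / ((8 * n * n) ^ n : ℕ) < (U / (8 * n * n) ^ n : ℕ) + 1 := by
    rw [div_lt_iff₀ hS']
    have := Nat.lt_mul_div_succ U hS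
    rw [mul_comm] at this
    exact_mod_cast this
  have hround' : (2 * (n * 2 ^ (8 * n)) + 1 : ℝ) ≤ U / ((8 * n * n) ^ n : ℕ) / 2 := by
    rw [div_div, le_div_iff₀ (by positivity)]
    have : ((2 * (n * 2 ^ (8 * n)) + 1 : ℕ) : ℝ) * (2 * ((8 * n * n) ^ n : ℕ) : ℕ) ≤ U := by
      exact_mod_cast hround
    push_cast at this ⊢
    linarith
  have hdec' : 3 * (U * (1 - (1 / 3 : ℝ) ^ n / 2) ^ 2 ^ (8 * n)) ≤
      U / ((8 * n * n) ^ n : ℕ) / 2 := by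
    rw [div_div, le_div_iff₀ (by positivity)]
    have := mul_le_mul_of_nonneg_left hdec (show (0 : ℝ) ≤ U by positivity)
    linarith
  linarith

/-- The sum of two numbers with small denominators is less than `1` if their approximations stay below
`1` by a margin. -/
theorem add_lt_one_iff_of_approx {n U a₁ a₂ : ℕ} {x₁ x₂ r : ℝ} (hn : 0 < n)
    (hU : 2 ^ (8 * (2 + n * n + 2 * (n + 1))) ≤ U)
    (hr : r = n * 2 ^ (8 * n) + 3 / 2 * (U * (1 - (1 / 3 : ℝ) ^ n / 2) ^ 2 ^ (8 * n)))
    (h₁ : a₁ ≤ U * x₁) (h₁' : U * x₁ ≤ a₁ + r) (h₂ : a₂ ≤ U * x₂) (h₂' : U * x₂ ≤ a₂ + r)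
    (hx₁ : ∃ D N : ℕ, 0 < D ∧ D ≤ n.factorial * 2 ^ n ∧ D * x₁ = N)
    (hx₂ : ∃ D N : ℕ, 0 < D ∧ D ≤ n.factorial * 2 ^ n ∧ D * x₂ = N) :
    x₁ + x₂ < 1 ↔ a₁ + a₂ + U / (8 * n * n) ^ n < U := by
  have hU₀ : 0 < U := lt_of_lt_of_le (by positivity) hU
  have hU₀' : (0 : ℝ) < U := by exact_mod_cast hU₀
  have herr := error_le_slack hn hU
  rw [← hr] at herr
  constructor
  · intro hlt
    obtain ⟨D₁, N₁, hD₁, hle₁, hN₁⟩ := hx₁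
    obtain ⟨D₂, N₂, hD₂, hle₂, hN₂⟩ := hx₂
    have p₁ : (0 : ℝ) < D₁ := by exact_mod_cast hD₁
    have p₂ : (0 : ℝ) < D₂ := by exact_mod_cast hD₂
    have hS : 0 < (8 * n * n) ^ n := by positivity
    have hDD : D₁ * D₂ < (8 * n * n) ^ n := by
      have hf := n.factorial_le_pow
      calc D₁ * D₂ ≤ (n.factorial * 2 ^ n) * (n.factorial * 2 ^ n) := Nat.mul_le_mul hle₁ hle₂
        _ ≤ (n ^ n * 2 ^ n) * (n ^ n * 2 ^ n) := by gcongr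
        _ = (4 * n * n) ^ n := by
            rw [← mul_pow, ← mul_pow]
            congr 1
            ring
        _ < (8 * n * n) ^ n := by
            refine Nat.pow_lt_pow_left ?_ hn.ne'
            nlinarith
    -- The margin is smaller than `U / (D₁ * D₂)`, which is the least distance from `U` of a sum
    -- below `1` with these denominators.
    have hT : U / (8 * n * n) ^ n * (D₁ * D₂) < U := by
      rcases Nat.eq_zero_or_pos (U / (8 * n * n) ^ n) with h0 | h0
      · rw [h0, zero_mul]; exact hU₀
      · exact lt_of_lt_of_le (Nat.mul_lt_mul_of_pos_left hDD h0) (Nat.div_mul_le_self _ _)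
    have hNN : N₁ * D₂ + N₂ * D₁ + 1 ≤ D₁ * D₂ := by
      have : (N₁ * D₂ + N₂ * D₁ : ℝ) < D₁ * D₂ := by
        rw [← hN₁, ← hN₂]
        have := mul_lt_mul_of_pos_left hlt (mul_pos p₁ p₂)
        linarith
      exact_mod_cast this
    have hNN' : (N₁ * D₂ + N₂ * D₁ + 1 : ℝ) ≤ D₁ * D₂ := by exact_mod_cast hNN
    have hT' : ((U / (8 * n * n) ^ n : ℕ) : ℝ) * (D₁ * D₂) < U := by exact_mod_cast hT
    have key : ((a₁ : ℝ) + a₂ + (U / (8 * n * n) ^ n : ℕ)) * (D₁ * D₂) < U * (D₁ * D₂) := by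
      have e₁ := mul_le_mul_of_nonneg_right (add_le_add h₁ h₂) (mul_pos p₁ p₂).le
      have e₂ : (U * x₁ + U * x₂) * (D₁ * D₂ : ℝ) = U * (N₁ * D₂ + N₂ * D₁) := by
        rw [← hN₁, ← hN₂]
        ring
      have e₃ := mul_le_mul_of_nonneg_left hNN' hU₀'.le
      rw [e₂] at e₁
      linarith
    have := lt_of_mul_lt_mul_right key (mul_pos p₁ p₂).le
    exact_mod_cast this
  -- The margin is at least the sum of the two errors, so a sum of at least `1` would push the
  -- approximations above `U` minus the margin.
  · intro hlt
    have hlt' : (a₁ : ℝ) + a₂ + (U / (8 * n * n) ^ n : ℕ) < U := by exact_mod_cast hlt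
    by_contra hge
    have := mul_le_mul_of_nonneg_left (not_lt.mp hge) hU₀'.le
    linarith

/-! ### Binary graphs -/

namespace RAM

namespace Expr

/-- The array that holds the matrix of the objective `q`. -/
def walkArr (q : Fin 2) : Fin 7 := if q = 0 then 3 else 4

/-- The entry of `walkMatrix` at the variables `0` and `1`. -/
def walk (o : ℕ) (q : Fin 2) : Expr :=
  bool (bottom q 0) * (bool (eq (var 0) (var 1)) * cap) +
    neg (bottom q 0) * (bool (edge o q (var 0) (var 1)) *
      (cap / sum 2 (bool (edge o q (var 0) (var 2)))))

/-- The entry of the squared matrix at the variables `0` and `1`. -/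
def walkSq (q : Fin 2) : Expr :=
  sum 2 (entry (walkArr q) (var 0) (var 2) * entry (walkArr q) (var 2) (var 1)) / cap

/-- The value of `oddMass` at the initial vertex. -/
def oddMass (o : ℕ) (q : Fin 2) : Expr :=
  sum 2 (bool (and (bottom q 2) (neg (evenTop o q 2))) *
    entry (walkArr q) (word o (const 1)) (var 2))

/-- The formula for `BidGraph.Binary`. -/
def binary (o : ℕ) : Expr := all 0 (le (sum 1 (adj o (var 0) (var 1))) (const 2))

end Expr

/-- Iterates a statement eight times. -/
def Stmt.eightfold (s : Stmt) : Stmt :=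
  let s₂ := Stmt.seq s s
  let s₄ := Stmt.seq s₂ s₂
  .seq s₄ s₄

/-- Computes the iterated square of the matrix of the objective `q`. -/
def Stmt.walk (o : ℕ) (q : Fin 2) : Stmt :=
  .seq (.tab (Expr.walkArr q) (.walk o q)) (.rep (eightfold (.tab (Expr.walkArr q) (.walkSq q))))

/-- Computes the margin for the rounding errors. -/
def Stmt.slack : Stmt :=
  .seq (.tab 5 .cap) (.rep (.tab 5 (.entry 5 (.var 0) (.var 1) / (.const 8 * .dim * .dim))))

theorem Stmt.run_rep_eightfold (s : Stmt) (st : State) :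
    (Stmt.rep (eightfold s)).run st = s.run^[8 * st.dim] st := by
  rw [Function.iterate_mul]
  rfl

theorem Expr.eval_neg (a : Expr) (st : State) (env : ℕ → ℕ) [Decidable (a.Holds st env)] :
    (neg a).eval st env = if a.Holds st env then 0 else 1 := by
  split_ifs with h <;> simp only [Holds, neg, eval_sub, eval_const] at h ⊢ <;> omega

theorem Stmt.eqOff_walk (o : ℕ) (q : Fin 2) (st : State) :
    State.EqOff (Expr.walkArr q) st ((walk o q).run st) := by
  have h := State.EqOff.tab (Expr.walkArr q) (.walkSq q)
  exact State.EqOff.seq (State.EqOff.tab _ _) (State.EqOff.rep (State.EqOff.seq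
    (State.EqOff.seq (State.EqOff.seq h h) (State.EqOff.seq h h))
    (State.EqOff.seq (State.EqOff.seq h h) (State.EqOff.seq h h)))) st

theorem Stmt.eqOff_slack (st : State) : State.EqOff 5 st (slack.run st) :=
  State.EqOff.seq (State.EqOff.tab _ _) (State.EqOff.rep (State.EqOff.tab _ _)) st

/-- Rounded divisions compose, so `n` divisions by `8 * n * n` amount to one division by the power,
which itself is never tabulated. -/
theorem Stmt.entry_slack (st : State) {i j : ℕ} (hi : i < st.dim) (hj : j < st.dim) :
    (slack.run st).entry 5 i j = st.cap / (8 * st.dim * st.dim) ^ st.dim := by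
  let s₁ : Stmt := .tab 5 .cap
  let s₂ : Stmt := .tab 5 (.entry 5 (.var 0) (.var 1) / (.const 8 * .dim * .dim))
  have hoff : ∀ k, State.EqOff 5 st (s₂.run^[k] (s₁.run st)) := fun k =>
    (State.EqOff.tab 5 _ st).trans (State.EqOff.iterate (State.EqOff.tab 5 _) k _)
  have key : ∀ k, (s₂.run^[k] (s₁.run st)).entry 5 i j =
      st.cap / (8 * st.dim * st.dim) ^ k := by
    intro k
    induction k with
    | zero => simpa [s₁] using entry_tab 5 .cap st hi hj
    | succ k ih =>
      have hd := (hoff k).dim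
      rw [Function.iterate_succ_apply']
      refine (entry_tab 5 _ _ (by rw [hd]; exact hi) (by rw [hd]; exact hj)).trans ?_
      simp only [Expr.eval_div, Expr.eval_entry, Expr.eval_var, env₂_zero, env₂_one, ih,
        Expr.eval_mul, Expr.eval_const, Expr.eval_dim, hd, (hoff k).cap]
      rw [Nat.div_div_eq_div_mul, ← pow_succ, min_eq_left (Nat.div_le_self _ _)]
  exact key st.dim

namespace Prepared

variable {o : ℕ} {I : Instance} {st : State} {env : ℕ → ℕ} {q : Fin 2}

theorem eval_walk (h : Prepared o I st) (u v : Fin I.n) :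
    (Expr.walk o q).eval st (env₂ u v) =
      walkMatrix st.cap ((I.obj q).edge I.graph) u v := by
  classical
  have h0 : env₂ (u : ℕ) v 0 = u := by simp
  have h1 : env₂ (u : ℕ) v 1 = v := by simp
  have hcard : ∑ j ∈ Finset.range st.dim, (Expr.bool (.edge o q (.var 0) (.var 2))).eval st
      (Function.update (env₂ (u : ℕ) v) 2 j) =
      Finset.card {w | (I.obj q).edge I.graph u w} := by
    rw [h.dim, Finset.sum_range, Finset.card_filter]
    refine Finset.sum_congr rfl fun w _ => ?_
    rw [Expr.eval_bool, h.holds_edge (u := u) (v := w) (by simp) (by simp)]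
  have hedge : (Expr.edge o q (.var 0) (.var 1)).Holds st (env₂ u v) ↔
      (I.obj q).edge I.graph u v := h.holds_edge (by simp) (by simp)
  rw [Expr.walk, Expr.eval_add, Expr.eval_mul, Expr.eval_mul, Expr.eval_mul, Expr.eval_mul,
    Expr.eval_div, Expr.eval_cap, Expr.eval_sum, hcard, Expr.eval_bool, Expr.eval_bool,
    Expr.eval_bool, Expr.eval_neg]
  simp only [h.holds_bottom h0, Expr.holds_eq, hedge, Expr.eval_var, h0, h1, walkMatrix,
    Fin.ext_iff]
  split_ifs <;> simp

/-- The bound on the entries ensures that the cut-off never acts, so the tables hold the exact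
rounded squares. -/
theorem entry_walk (h : Prepared o I st)
    (hle : ∀ k i j, (roundedSq st.cap)^[k] (walkMatrix st.cap ((I.obj q).edge I.graph)) i j ≤ st.cap)
    (u v : Fin I.n) : ((Stmt.walk o q).run st).entry (Expr.walkArr q) u v =
      (roundedSq st.cap)^[8 * I.n] (walkMatrix st.cap ((I.obj q).edge I.graph)) u v := by
  let s₁ : Stmt := .tab (Expr.walkArr q) (.walk o q)
  let s₂ : Stmt := .tab (Expr.walkArr q) (.walkSq q)
  have hoff : ∀ k, State.EqOff (Expr.walkArr q) st (s₂.run^[k] (s₁.run st)) := fun k =>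
    (State.EqOff.tab _ _ st).trans (State.EqOff.iterate (State.EqOff.tab _ _) k _)
  have key : ∀ k (u v : Fin I.n), (s₂.run^[k] (s₁.run st)).entry (Expr.walkArr q) u v =
      (roundedSq st.cap)^[k] (walkMatrix st.cap ((I.obj q).edge I.graph)) u v := by
    intro k
    induction k with
    | zero =>
      intro u v
      refine (Stmt.entry_tab _ _ st (by rw [h.dim]; exact u.2) (by rw [h.dim]; exact v.2)).trans ?_
      rw [h.eval_walk]
      exact min_eq_left (hle 0 u v)
    | succ k ih =>
      intro u v
      have hd := (hoff k).dim.trans h.dim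
      have hsq : (Expr.walkSq q).eval (s₂.run^[k] (s₁.run st)) (env₂ u v) =
          (roundedSq st.cap)^[k + 1] (walkMatrix st.cap ((I.obj q).edge I.graph)) u v := by
        rw [Function.iterate_succ_apply', roundedSq]
        simp only [Expr.walkSq, Expr.eval_div, Expr.eval_sum, Expr.eval_mul, Expr.eval_entry,
          Expr.eval_cap, (hoff k).cap, hd, Finset.sum_range]
        congr 1
        refine Finset.sum_congr rfl fun w _ => ?_
        rw [← ih, ← ih]
        simp
      rw [Function.iterate_succ_apply' (f := s₂.run)]
      refine (Stmt.entry_tab _ _ _ (by rw [hd]; exact u.2) (by rw [hd]; exact v.2)).trans ?_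
      rw [hsq, (hoff k).cap, min_eq_left (hle (k + 1) u v)]
  have hrun : (Stmt.walk o q).run st = s₂.run^[8 * I.n] (s₁.run st) := by
    rw [← h.dim]
    exact Stmt.run_rep_eightfold s₂ (s₁.run st)
  rw [hrun, key]

theorem eval_oddMass (h : Prepared o I st) {U k : ℕ}
    (hM : ∀ v : Fin I.n, st.entry (Expr.walkArr q) I.graph.init v =
      (roundedSq U)^[k] (walkMatrix U ((I.obj q).edge I.graph)) I.graph.init v) :
    (Expr.oddMass o q).eval st env =
      oddMass U ((I.obj q).edge I.graph) (I.obj q).color k I.graph.init := by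
  classical
  rw [Expr.oddMass, Expr.eval_sum, h.dim, Finset.sum_range, oddMass]
  refine Finset.sum_congr rfl fun v _ => ?_
  have h2 : Function.update env 2 (v : ℕ) 2 = v := by simp
  rw [Expr.eval_mul, Expr.eval_bool, Expr.holds_and, Expr.holds_neg, h.holds_bottom h2,
    h.holds_evenTop h2, Expr.eval_entry, h.eval_init, Expr.eval_var, h2, hM]
  split_ifs <;> simp

theorem holds_binary (h : Represents o I st) :
    (Expr.binary o).Holds st env ↔ I.graph.Binary := by
  classical
  rw [Expr.binary, Expr.holds_all_fin h.dim, BidGraph.Binary]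
  refine forall_congr' fun v => ?_
  have hs : ({w | I.graph.Adj v w} : Set (Fin I.n)) =
      (Finset.univ.filter fun w => I.graph.Adj v w : Finset (Fin I.n)) := by simp
  have hsum : (Expr.sum 1 (.adj o (.var 0) (.var 1))).eval st (Function.update env 0 v) =
      (Finset.univ.filter fun w => I.graph.Adj v w).card := by
    rw [Expr.eval_sum, h.dim, Finset.sum_range, Finset.card_filter]
    refine Finset.sum_congr rfl fun w _ => ?_
    rw [h.eval_adj (u := v) (v := w) (by simp) (by simp)]
  rw [Expr.holds_le, hsum, Expr.eval_const, hs, Set.encard_coe_eq_coe_finsetCard]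
  exact_mod_cast Iff.rfl

end Prepared

theorem encard_edge_le {V : Type*} {G : BidGraph V} (hG : G.Binary) (Φ : Objective V) (v : V) :
    {w | Φ.edge G v w}.encard ≤ 2 := by
  by_cases hv : v ∈ Φ.absorb
  · have : {w | Φ.edge G v w} ⊆ {v} := by
      rintro w (⟨-, rfl⟩ | ⟨h, -⟩)
      · rfl
      · exact absurd hv h
    refine (Set.encard_le_encard this).trans ?_
    rw [Set.encard_singleton]
    exact one_le_two
  · refine (Set.encard_le_encard ?_).trans (hG v)
    rintro w (⟨h, -⟩ | ⟨-, h⟩)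
    · exact absurd h hv
    · exact h

/-- The program for binary graphs. -/
def Stmt.binary : Stmt :=
  .seq (.prepare 0) (.seq (.walk 0 0) (.seq (.walk 0 1) .slack))

/-- The test that follows the program for binary graphs. -/
def Expr.test : Expr :=
  .and (.valid 0 .len) (.and (.binary 0)
    (.le (.oddMass 0 0 + .oddMass 0 1 + .entry 5 (.const 0) (.const 0) + .const 1) .cap))

theorem represents_initState (g : ℕ) (I : Instance) :
    Represents 0 I (initState g 0 I.encode) where
  dim := by
    have := I.length_encode
    simp only [initState]
    rw [I.encode_zero]
    omega
  cap := capOf_pos _ _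
  word i _ := by simp [initState]

theorem encode_ne_nil (I : Instance) : I.encode ≠ [] :=
  List.ne_nil_of_length_pos (by rw [I.length_encode]; omega)

theorem prepared_binary (I : Instance) (g : ℕ) :
    Prepared 0 I (Stmt.binary.run (initState g 0 I.encode)) :=
  (((represents_initState g I).prepared.congr (Stmt.eqOff_walk 0 0 _) (by decide)).congr
    (Stmt.eqOff_walk 0 1 _) (by decide)).congr (Stmt.eqOff_slack _) (by decide)

theorem cap_binary (w : List ℕ) (g : ℕ) :
    (Stmt.binary.run (initState g 0 w)).cap = capOf g w :=
  (Stmt.eqOff_slack _).cap.trans ((Stmt.eqOff_walk 0 1 _).cap.trans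
    ((Stmt.eqOff_walk 0 0 _).cap.trans (Stmt.arr_zero_prepare 0 _).2.2.1))

theorem entry_slack_binary (I : Instance) (g : ℕ) :
    (Stmt.binary.run (initState g 0 I.encode)).entry 5 0 0 =
      capOf g I.encode / (8 * I.n * I.n) ^ I.n := by
  have hn : 0 < I.n := I.graph.init.pos
  have hd := (prepared_binary I g).dim
  have hc := cap_binary I.encode g
  obtain ⟨st, hst⟩ : ∃ st, Stmt.binary.run (initState g 0 I.encode) = Stmt.slack.run st := ⟨_, rfl⟩
  rw [hst] at hd hc ⊢
  have hoff := Stmt.eqOff_slack st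
  rw [hoff.dim] at hd
  rw [hoff.cap] at hc
  rw [Stmt.entry_slack st (by rw [hd]; exact hn) (by rw [hd]; exact hn), hd, hc]

theorem eval_oddMass_binary (I : Instance) (hI : I.graph.Binary) {g : ℕ} (hg : 0 < g) (q : Fin 2)
    (env : ℕ → ℕ) :
    (Expr.oddMass 0 q).eval (Stmt.binary.run (initState g 0 I.encode)) env =
      oddMass (capOf g I.encode) ((I.obj q).edge I.graph) (I.obj q).color (8 * I.n)
        I.graph.init := by
  refine (prepared_binary I g).eval_oddMass fun v => ?_
  have hle : ∀ q k i j, (roundedSq (capOf g I.encode))^[k]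
      (walkMatrix (capOf g I.encode) ((I.obj q).edge I.graph)) i j ≤ capOf g I.encode := by
    intro q k
    obtain ⟨f, hf⟩ := exists_isRichman ((I.obj q).edge I.graph) ((I.obj q).exists_edge I.graph)
      (I.obj q).color
    exact (hf.oddMass_bounds ((I.obj q).exists_edge I.graph) (encard_edge_le hI _)
      (dvd_trans (dvd_pow_self 2 hg.ne') (two_pow_dvd_capOf g _ (encode_ne_nil I)))
      (capOf_pos _ _) k).1
  set s₀ := (Stmt.prepare 0).run (initState g 0 I.encode)
  set s₁ := (Stmt.walk 0 0).run s₀ with hs₁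
  set s₂ := (Stmt.walk 0 1).run s₁ with hs₂
  have p₀ : Prepared 0 I s₀ := (represents_initState g I).prepared
  have c₀ : s₀.cap = capOf g I.encode := (Stmt.arr_zero_prepare 0 _).2.2.1
  have e₁ : State.EqOff (Expr.walkArr 0) s₀ s₁ := Stmt.eqOff_walk 0 0 s₀
  have e₂ : State.EqOff (Expr.walkArr 1) s₁ s₂ := Stmt.eqOff_walk 0 1 s₁
  have e₃ : State.EqOff 5 s₂ (Stmt.slack.run s₂) := Stmt.eqOff_slack s₂
  have c₁ : s₁.cap = capOf g I.encode := e₁.cap.trans c₀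
  rw [show Stmt.binary.run (initState g 0 I.encode) = Stmt.slack.run s₂ from rfl]
  obtain rfl | rfl : q = 0 ∨ q = 1 := by omega
  · rw [e₃.entry (by decide), e₂.entry (by decide), hs₁,
      p₀.entry_walk (by rw [c₀]; exact hle 0), c₀]
  · rw [e₃.entry (by decide), hs₂,
      (p₀.congr e₁ (by decide)).entry_walk (by rw [c₁]; exact hle 1), c₁]

/-- The parameter `8` of the cut-off makes the unit even and at least `2 ^ (8 * length)`, which is
what `add_lt_one_iff_of_approx` needs. -/
theorem holds_test (I : Instance) (hI : I.graph.Binary) (env : ℕ → ℕ) :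
    (Expr.le (.oddMass 0 0 + .oddMass 0 1 + .entry 5 (.const 0) (.const 0) + .const 1) .cap).Holds
      (Stmt.binary.run (initState 8 0 I.encode)) env ↔
        HasRobustPair I.graph (I.obj 0) (I.obj 1) := by
  set U := capOf 8 I.encode with hc
  have hlen := I.length_encode
  have hne := encode_ne_nil I
  have h2 : 2 ∣ U := dvd_trans (by norm_num) (two_pow_dvd_capOf 8 _ hne)
  have h0 : 0 < U := capOf_pos _ _
  have hU : 2 ^ (8 * (2 + I.n * I.n + 2 * (I.n + 1))) ≤ U := by
    rw [hc, ← hlen]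
    exact two_pow_le_capOf 8 _
  have key : ∀ q, ∃ f, IsRichman ((I.obj q).edge I.graph) (I.obj q).color f := fun q =>
    exists_isRichman ((I.obj q).edge I.graph) ((I.obj q).exists_edge I.graph) (I.obj q).color
  choose f hf using key
  have hb := fun q => ((hf q).oddMass_bounds ((I.obj q).exists_edge I.graph)
    (encard_edge_le hI _) h2 h0 (8 * I.n)).2 I.graph.init
  simp only [Fintype.card_fin] at hb
  have hD : ∀ q, ∃ D N : ℕ, 0 < D ∧ D ≤ I.n.factorial * 2 ^ I.n ∧
      D * f q I.graph.init = N := by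
    intro q
    obtain ⟨D, N, hD, hle, hN⟩ := (hf q).exists_denominator ((I.obj q).exists_edge I.graph)
    exact ⟨D, N I.graph.init, hD, by simpa using hle, hN _⟩
  rw [hasRobustPair_iff_of_isRichman (hf 0) (hf 1),
    add_lt_one_iff_of_approx I.graph.init.pos hU rfl (hb 0).1 (hb 0).2 (hb 1).1 (hb 1).2 (hD 0)
      (hD 1)]
  simp only [Expr.holds_le, Expr.eval_add, eval_oddMass_binary I hI (show 0 < 8 by omega),
    Expr.eval_entry, Expr.eval_const, Expr.eval_cap, entry_slack_binary, cap_binary]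
  exact Nat.succ_le_iff

theorem holds_valid_binary (w : List ℕ) (env : ℕ → ℕ) :
    (Expr.valid 0 .len).Holds (Stmt.binary.run (initState 8 0 w)) env ↔
      ∃ I : Instance, I.encode = w := by
  have hp := Stmt.arr_zero_prepare 0 (initState 8 0 w)
  set s₀ := (Stmt.prepare 0).run (initState 8 0 w)
  have e₁ := Stmt.eqOff_walk 0 0 s₀
  have e₂ := Stmt.eqOff_walk 0 1 ((Stmt.walk 0 0).run s₀)
  have e₃ := Stmt.eqOff_slack ((Stmt.walk 0 1).run ((Stmt.walk 0 0).run s₀))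
  have hrun : Stmt.binary.run (initState 8 0 w) =
    Stmt.slack.run ((Stmt.walk 0 1).run ((Stmt.walk 0 0).run s₀)) := rfl
  rw [Expr.holds_valid, Expr.eval_len, hrun, e₃.dim, e₂.dim, e₁.dim, hp.2.1, e₃.len, e₂.len,
    e₁.len, hp.2.2.2, e₃.arr 0 (by decide), e₂.arr 0 (by decide), e₁.arr 0 (by decide), hp.1]
  simp only [initState, zero_add, if_true]
  constructor
  · exact ValidWord.exists_instance
  · rintro ⟨I, rfl⟩
    have hd := (represents_initState 8 I).dim
    simp only [initState] at hd
    rw [hd]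
    exact I.validWord

theorem inP_binaryStrongSynt : InP BinaryStrongSynt := by
  refine inP_of_stmt 8 0 Stmt.binary Expr.test.bool fun w => ?_
  rw [Expr.eval_bool_eq_one, Expr.test, Expr.holds_and, Expr.holds_and, holds_valid_binary]
  constructor
  · rintro ⟨I, rfl, hI, -, h⟩
    exact ⟨encode_ne_nil I, ⟨I, rfl⟩,
      (Prepared.holds_binary (prepared_binary I 8).toRepresents).mpr hI, (holds_test I hI _).mpr h⟩
  · rintro ⟨-, ⟨I, rfl⟩, hb, h⟩
    have hI := (Prepared.holds_binary (prepared_binary I 8).toRepresents).mp hb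
    have hr := (holds_test I hI _).mp h
    exact ⟨I, rfl, hI, HasRobustPair.overlapping hr, hr⟩

end RAM

theorem mainTheorem2 :
    (∀ (V : Type*) [Finite V] (G : BidGraph V) (Φ₁ Φ₂ : Objective V), Overlapping G Φ₁ Φ₂ →
      (HasRobustPair G Φ₁ Φ₂ ↔ threshold G Φ₁ G.init + threshold G Φ₂ G.init < 1)) ∧
    (InNP StrongSynt ∧ InCoNP StrongSynt) ∧
    InP BinaryStrongSynt :=
  ⟨fun _ _ G Φ₁ Φ₂ _ => hasRobustPair_iff G Φ₁ Φ₂,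
    ⟨RAM.inNP_strongSynt, RAM.inCoNP_strongSynt⟩, RAM.inP_binaryStrongSynt⟩
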